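/- **Setting.** Let $\gamma$ be the round unit metric on $\mathbb S^2$; all operators below ($d$, $\mathrm{div}$, $\mathrm{curl}$, $\Delta$, Sobolev norms $H^k=H^k(\mathbb S^2)$) are taken with respect to $\gamma$. For functions $f_1,f_2$, a one-form $V$ and a symmetric tracefree 2-tensor $W$ put $$\mathcal D_1^*(f_1,f_2)=-df_1+{}^*df_2,\qquad \mathcal D_2W=\mathrm{div}\,W,\qquad (\mathcal D_2^*V)_{AB}=-\tfrac12(\nabla_AV_B+\nabla_BV_A-(\mathrm{div} V)\gamma_{AB}).$$ Let $Y^{lm}$ be the real orthonormal spherical harmonics, $E^{lm}=\mathcal D_1^*(Y^{lm},0)/\sqrt{l(l+1)}$ and $H^{lm}=\mathcal D_1^*(0,Y^{lm})/\sqrt{l(l+1)}$ for $l\ge1$, and $\psi^{lm}=\mathcal D_2^*E^{lm}/\sqrt{\frac12l(l+1)-1}$ (electric) and $\phi^{lm}=\mathcal D_2^*H^{lm}/\sqrt{\frac12l(l+1)-1}$ (magnetic) for $l\ge2$. A superscript $[l]$, $[\le n]$, $[\ge n]$ denotes the projection to the corresponding modes, and $W_\psi^{[\ge n]}$ the part of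 $W$ in the span of the $\psi^{lm}$, $l\ge n$. **Linearised sphere data and perturbations.** Linearised $C^3$ sphere data $\dot{\mathfrak X}$ at the round sphere of radius $v$ in Minkowski space consist of the linearised quantities $\dot\Omega,\dot\phi,\dot g_c,\dot{(\Omega\mathrm{tr}\chi)},\dot{\hat\chi},\dot{(\Omega\mathrm{tr}\underline\chi)},\dot{\underline{\hat\chi}},\dot\eta,\dot\omega,D\dot\omega,D^2\dot\omega,\dot{\underline\omega},\underline D\dot{\underline\omega},\underline D^2\dot{\underline\omega},\dot\alpha,D\dot\alpha,\dot{\underline\alpha},\underline D\dot{\underline\alpha}$, where the metric is split as $\phi^2g_c$ and $\phi^2$ is the ratio of its area element to that of $\gamma$. Perturbation functions are $f=(f_0,\dots,f_4)$, $f_n=\partial_u^nf(0)$, and $q=(q_1,q_2)$. A transversal perturbation passes, on the ingoing cone $t=v+\tilde u$, $r=v-\tilde u$, to the sphere $u=0$ for the new parameter $u$ with $\tilde u=u+f(u,\cdot)$. An angular perturbation is the pullback under the sphere diffeomorphisms generated by $-\mathcal D_1^*(q_1,q_2)$, with index raised by $\gamma$. The linearised perturbation map $\dot{\mathcal P}(f,q)$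 has the components $$\dot\Omega=\tfrac12f_1,\quad \dot\phi=-f_0+\tfrac v2\Delta q_1,\quad \dot g_c=2\mathcal D_2^*\mathcal D_1^*(q_1,q_2),\quad \dot{(\Omega\mathrm{tr}\chi)}=\tfrac2{v^2}(\Delta+1)f_0,\quad \dot{\hat\chi}=-2\mathcal D_2^*df_0,$$ $$\dot{(\Omega\mathrm{tr}\underline\chi)}=-2\Big(\frac{f_1}v+\frac{f_0}{v^2}\Big),\quad \dot\eta=v\,d\Big(\frac{f_1}v+\frac{f_0}{v^2}\Big),\quad \dot{\underline\omega}=\tfrac12f_2,\quad \underline D\dot{\underline\omega}=\tfrac12f_3,\quad \underline D^2\dot{\underline\omega}=\tfrac12f_4,$$ and its other components vanish. **Charges.** Let $\mathrm{T}=\dot{(\Omega\mathrm{tr}\chi)}-\frac4v\dot\Omega$ and $\dot K=\frac1{2v^2}\mathrm{div}\,\mathrm{div}\,\dot g_c-\frac1{v^3}(\Delta+2)\dot\phi$. Put $$\mathcal Q_0=v^2\dot\eta^{[1]}+\tfrac{v^3}2d\,\mathrm T^{[1]},\qquad \mathcal Q_2=v^2\dot{(\Omega\mathrm{tr}\underline\chi)}-\tfrac2v\mathrm{div}\big(v^2\dot\eta+\tfrac{v^3}2d\mathrm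 T\big)-v^2\mathrm T+2v^3\dot K,$$ $$\mathcal Q_{\underline D\dot{\underline\alpha}^{[2]}}=\Big(\tfrac1v\underline D\dot{\underline\alpha}+\tfrac1{v^2}(1-2\mathcal D_2^*\mathrm{div})\dot{\underline\alpha}\Big)^{[2]},$$ $$\mathcal Q_{\underline D\dot{\underline\alpha}^{[\ge3]}_\psi}=\Big(\tfrac1v\underline D\dot{\underline\alpha}+\tfrac1{v^2}(1-2\mathcal D_2^*\mathrm{div})\dot{\underline\alpha}+2\mathcal D_2^*\Big\{\tfrac3v\Big(\tfrac1{v^2}\mathrm{div}\,\dot{\underline{\hat\chi}}-\tfrac12d\dot{(\Omega\mathrm{tr}\underline\chi)}-\tfrac1v\dot\eta\Big)+\mathcal D_1^*(\underline D\dot{\underline\omega},0)\Big\}\Big)^{[\ge3]}_\psi,$$ $$\mathcal Q_{\underline D^2\dot{\underline\omega}^{[\le1]}}=(\underline D^2\dot{\underline\omega})^{[\le1]}-\tfrac1{2v^4}(\Delta-3)\mathcal Q_2^{[\le1]}+\tfrac4{v^5}\mathrm{div}\,\mathcal Q_0 .$$ For sphere data with metric $g$ and curvature components $\underline\alpha$,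 $\hat{\underline D}\underline\alpha$, with $\nabla\hat\otimes\,\mathrm{div}$ taken with respect to $g$, let $$\mathbf U^m=\int_{\mathbb S^2}\mathcal W\cdot\psi^{2m}\,d\mu_\gamma,\quad \mathbf V^m=\int_{\mathbb S^2}\mathcal W\cdot\phi^{2m}\,d\mu_\gamma,\quad \mathcal W=\tfrac1\phi\hat{\underline D}\underline\alpha+\tfrac1{\phi^2}(1+\phi^2\nabla\hat\otimes\mathrm{div})\underline\alpha,\qquad |m|\le2 .$$ **Statement.** Take $v=2$. 1. $\mathcal Q_{\underline D\dot{\underline\alpha}^{[2]}}(\dot{\mathcal P}(f,q))=0$ for all $f$ and $q$. 2. The values of $\mathcal Q_{\underline D\dot{\underline\alpha}^{[2]}}$ on linearised sphere data form exactly the span of $\psi^{2m},\phi^{2m}$, $|m|\le2$, which has dimension 10. 3. Let $\dot{\mathbf U}^m,\dot{\mathbf V}^m$ be the linearisations of $\mathbf U^m,\mathbf V^m$ at the round sphere of radius $v$, that is, their derivatives at $\varepsilon=0$ along $(g,\underline\alpha,\hat{\underline D}\underline\alpha)=(v^2\gamma+\varepsilon h,\varepsilon\dot{\underline\alpha},\varepsilon\underline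 D\dot{\underline\alpha})$ with smooth $h,\dot{\underline\alpha},\underline D\dot{\underline\alpha}$. They exist, do not depend on $h$, and $\mathcal Q_{\underline D\dot{\underline\alpha}^{[2]}}=\sum_{|m|\le2}(\dot{\mathbf U}^m\psi^{2m}+\dot{\mathbf V}^m\phi^{2m})$. 4. There is a constant $C$ with the following property. Let $Q_1$ be a square integrable function with $Q_1=Q_1^{[\le1]}$, let $Q_2$ be a square integrable symmetric tracefree 2-tensor with $Q_2=(Q_2)^{[\ge3]}_\psi$, and let $f_0,f_1,f_2,q_1,q_2$ and $f_3^{[\le2]}$ be prescribed arbitrarily. Then $f_3^{[\ge3]}$ and $f_4$ in $L^2$ can be chosen such that $$\mathcal Q_{\underline D^2\dot{\underline\omega}^{[\le1]}}(\dot{\mathcal P}(f,q))=Q_1,\qquad \mathcal Q_{\underline D\dot{\underline\alpha}^{[\ge3]}_\psi}(\dot{\mathcal P}(f,q))=Q_2,$$ and, if the right-hand side is finite, $$\|f_3^{[\ge3]}\|_{H^4}+\|f_4\|_{H^2}\le C\big(\|Q_2\|_{H^2}+\|Q_1\|_{H^2}\big).$$ 5. $\dot{\mathcal P}$ is the linearisation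 of the sphere perturbations. For smooth $f$, all components listed above (except $\dot\omega,D\dot\omega,D^2\dot\omega,D\dot\alpha$, which enter none of the charges) of $\dot{\mathcal P}(f,0)$ are the derivatives at $\varepsilon=0$ of the sphere data of the perturbed sphere $u=0$ for $\varepsilon f$. For smooth $q$, $\dot\phi$ and $\dot g_c$ of $\dot{\mathcal P}(0,q)$ are the derivatives of the pullbacks of the round metric of radius $v$. -/

import Mathlib

open MeasureTheory Filter Topology
open scoped ENNReal ContDiff

namespace NullGluing

noncomputable section

/-! ### The round unit sphere and its tensor fields -/

abbrev E3 := EuclideanSpace ℝ (Fin 3)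

abbrev S2 := Metric.sphere (0 : E3) 1

/-- The area measure of the round unit sphere (total mass `4 * π`). -/
def surf : Measure S2 := (volume : Measure E3).toSphere

instance : IsFiniteMeasure surf := by unfold surf; infer_instance

/-- Covariant `k`-tensor fields along the sphere, in Cartesian components of the ambient space. -/
abbrev Field (k : ℕ) := S2 → (Fin k → Fin 3) → ℝ

/-- The radial projection of `ℝ³ ∖ {0}` to the sphere (with an arbitrary value at the origin). -/
def dir (y : E3) : S2 :=
  if h : y = 0 then ⟨EuclideanSpace.single 0 1, by simp⟩
  else ⟨‖y‖⁻¹ • y, by simp [norm_smul, h]⟩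

lemma dir_coe {y : E3} (h : y ≠ 0) : (dir y : E3) = ‖y‖⁻¹ • y := by
  simp [dir, h]

lemma S2.ne_zero (x : S2) : (x : E3) ≠ 0 := by
  intro h
  have := x.2
  simp [h] at this

lemma S2.norm_eq (x : S2) : ‖(x : E3)‖ = 1 := by
  simp

lemma dir_self (x : S2) : dir (x : E3) = x := by
  apply Subtype.ext
  rw [dir_coe (S2.ne_zero x), S2.norm_eq x]
  simp

lemma dir_smul (x : S2) {t : ℝ} (ht : 0 < t) : dir (t • (x : E3)) = x := by
  apply Subtype.ext
  rw [dir_coe (smul_ne_zero ht.ne' (S2.ne_zero x)), norm_smul, S2.norm_eq x, smul_smul]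
  simp [abs_of_pos ht, ht.ne']

variable {F G : Type*} [NormedAddCommGroup F] [NormedSpace ℝ F]
  [NormedAddCommGroup G] [NormedSpace ℝ G]

/-- Smoothness of a map on the sphere: its extension to `ℝ³ ∖ {0}`, constant along rays, is
smooth. -/
def Smooth (T : S2 → F) : Prop := ContDiffOn ℝ ∞ (fun y : E3 => T (dir y)) {0}ᶜ

/-- The `i`-th ambient partial derivative, at a point of the sphere, of the extension of `T` which
is constant along rays: the derivative of `T` in the direction of the tangential part of the `i`-th
basis vector. -/
def pd (T : S2 → F) (x : S2) (i : Fin 3) : F :=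
  fderiv ℝ (fun y : E3 => T (dir y)) x (EuclideanSpace.single i 1)

lemma contDiffOn_dir : ContDiffOn ℝ ∞ (fun y : E3 => (dir y : E3)) {0}ᶜ := by
  have : ContDiffOn ℝ ∞ (fun y : E3 => ‖y‖⁻¹ • y) {0}ᶜ := by
    intro y hy
    have h1 : ContDiffAt ℝ ∞ (fun y : E3 => ‖y‖) y := contDiffAt_norm ℝ hy
    exact ((h1.inv (by simpa using hy)).smul contDiffAt_id).contDiffWithinAt
  exact this.congr fun y hy => dir_coe hy

lemma Smooth.restrict {g : E3 → F} (hg : ContDiff ℝ ∞ g) : Smooth (fun x : S2 => g x) :=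
  hg.comp_contDiffOn contDiffOn_dir

lemma Smooth.differentiableAt {T : S2 → F} (h : Smooth T) (x : S2) :
    DifferentiableAt ℝ (fun y : E3 => T (dir y)) x :=
  ((h x (S2.ne_zero x)).contDiffAt (isOpen_compl_singleton.mem_nhds (S2.ne_zero x))).differentiableAt
    (by simp)

lemma Smooth.pd {T : S2 → F} (h : Smooth T) (i : Fin 3) : Smooth (fun x => pd T x i) := by
  have h1 : ContDiffOn ℝ ∞ (fderiv ℝ (fun y : E3 => T (dir y))) {0}ᶜ :=
    h.fderiv_of_isOpen isOpen_compl_singleton (by simp)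
  have h2 : ContDiffOn ℝ ∞ (fun y : E3 => fderiv ℝ (fun y : E3 => T (dir y)) (dir y)) {0}ᶜ :=
    h1.comp contDiffOn_dir fun y _ => S2.ne_zero (dir y)
  exact h2.clm_apply contDiffOn_const

lemma Smooth.continuous {T : S2 → F} (h : Smooth T) : Continuous T := by
  have h1 : Continuous (fun x : S2 => T (dir (x : E3))) :=
    h.continuousOn.comp_continuous continuous_subtype_val fun x => (S2.ne_zero x)
  simpa only [dir_self] using h1

lemma smooth_pi {ι : Type*} [Fintype ι] {T : S2 → ι → ℝ} :
    Smooth T ↔ ∀ i, Smooth (fun x => T x i) := contDiffOn_pi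

lemma sum_mul_pd {T : S2 → F} (h : Smooth T) (x : S2) :
    ∑ i, (x : E3) i • pd T x i = 0 := by
  have e : ∑ i, (x : E3) i • EuclideanSpace.single i (1 : ℝ) = (x : E3) := by
    ext j
    simp [Finset.sum_apply, Pi.single_apply]
  have h1 : ∑ i, (x : E3) i • NullGluing.pd T x i
      = fderiv ℝ (fun y : E3 => T (dir y)) x (x : E3) := by
    conv_rhs => rw [← e]
    rw [map_sum, e]
    simp [NullGluing.pd]
  rw [h1]
  have h2 : HasDerivAt (fun t : ℝ => t • (x : E3)) (x : E3) 1 := by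
    simpa using (hasDerivAt_id (1 : ℝ)).smul_const (x : E3)
  have h3 : HasDerivAt (fun t : ℝ => T (dir (t • (x : E3))))
      (fderiv ℝ (fun y : E3 => T (dir y)) x (x : E3)) 1 := by
    have := (h.differentiableAt x).hasFDerivAt
    have h5 : HasFDerivAt (fun y : E3 => T (dir y)) (fderiv ℝ (fun y : E3 => T (dir y)) x) ((1 : ℝ) • (x : E3)) := by
      rwa [one_smul]
    exact h5.comp_hasDerivAt (1 : ℝ) h2
  have h4 : HasDerivAt (fun t : ℝ => T (dir (t • (x : E3)))) 0 1 := by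
    refine (hasDerivAt_const (1 : ℝ) (T x)).congr_of_eventuallyEq ?_
    filter_upwards [lt_mem_nhds (zero_lt_one (α := ℝ))] with t ht
    rw [dir_smul x ht]
  exact h3.unique h4

/-- The orthogonal projection onto the tangent plane; also the components of the round metric. -/
def proj (x : S2) (i j : Fin 3) : ℝ := (if i = j then 1 else 0) - (x : E3) i * (x : E3) j

lemma sum_mul_self (x : S2) : ∑ i, (x : E3) i * (x : E3) i = 1 := by
  have := EuclideanSpace.norm_sq_eq (x : E3)
  rw [S2.norm_eq x] at this
  simp only [Real.norm_eq_abs, sq_abs] at this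
  simpa [sq] using this.symm

lemma sum_mul_proj (x : S2) (j : Fin 3) : ∑ i, (x : E3) i * proj x i j = 0 := by
  have := sum_mul_self x
  simp only [proj, mul_sub, Finset.sum_sub_distrib, mul_ite, mul_one, mul_zero,
    Finset.sum_ite_eq', Finset.mem_univ, if_true, ← mul_assoc, ← Finset.sum_mul, this]
  simp

lemma sum_proj_self (x : S2) : ∑ i, proj x i i = 2 := by
  have := sum_mul_self x
  simp only [proj, Finset.sum_sub_distrib, this]
  norm_num

lemma proj_comm (x : S2) (i j : Fin 3) : proj x i j = proj x j i := by
  simp [proj, eq_comm, mul_comm]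

lemma Smooth.coord (i : Fin 3) : Smooth (fun x : S2 => (x : E3) i) :=
  Smooth.restrict (g := fun y : E3 => y i) (by fun_prop)

lemma Smooth.proj (i j : Fin 3) : Smooth (fun x : S2 => proj x i j) :=
  contDiffOn_const.sub ((Smooth.coord i).mul (Smooth.coord j))

/-- A tensor field is tangential if it vanishes whenever one of its arguments is normal. -/
def Tangential {k : ℕ} (T : Field k) : Prop :=
  ∀ (x : S2) (a : Fin k → Fin 3) (j : Fin k),
    ∑ i, (x : E3) i * T x (Function.update a j i) = 0

/-- The smooth covariant `k`-tensor fields on the sphere. -/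
def Tens (k : ℕ) : Submodule ℝ (Field k) where
  carrier := {T | Smooth T ∧ Tangential T}
  add_mem' := by
    rintro S T ⟨hS, hS'⟩ ⟨hT, hT'⟩
    refine ⟨hS.add hT, fun x a j => ?_⟩
    simp [mul_add, Finset.sum_add_distrib, hS' x a j, hT' x a j]
  zero_mem' := ⟨contDiffOn_const, fun x a j => by simp⟩
  smul_mem' := by
    rintro c T ⟨hT, hT'⟩
    refine ⟨contDiffOn_const.smul hT, fun x a j => ?_⟩
    have := hT' x a j
    simp only [Pi.smul_apply, smul_eq_mul, mul_left_comm _ c, ← Finset.mul_sum, this, mul_zero]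

lemma Tens.smooth_apply {k : ℕ} (T : Tens k) (a : Fin k → Fin 3) :
    Smooth (fun x => (T : Field k) x a) := smooth_pi.1 T.2.1 a

/-- The Levi-Civita derivative `(∇T) a₀ a₁ ⋯ aₖ = ∇_{a₀} T_{a₁ ⋯ aₖ}` of the round metric: the
tangential projection of the ambient derivative. -/
def covF {k : ℕ} (T : Field k) : Field (k + 1) := fun x a =>
  ∑ b : Fin k → Fin 3, (∏ j, proj x (a j.succ) (b j)) * pd T x (a 0) b

lemma pd_apply {ι : Type*} [Fintype ι] {T : S2 → ι → ℝ} (h : Smooth T) (x : S2) (i : Fin 3)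
    (b : ι) : pd (fun x => T x b) x i = pd T x i b := by
  unfold NullGluing.pd
  have h1 := (h.differentiableAt x).hasFDerivAt
  rw [hasFDerivAt_pi'] at h1
  rw [(h1 b).fderiv]
  rfl

def cov (k : ℕ) : Tens k →ₗ[ℝ] Tens (k + 1) where
  toFun T := ⟨covF T, by
    constructor
    · refine smooth_pi.2 fun a => ?_
      refine ContDiffOn.sum fun b _ => ContDiffOn.mul (contDiffOn_prod fun j _ => ?_) ?_
      · exact Smooth.proj _ _
      · exact smooth_pi.1 (Smooth.pd T.2.1 (a 0)) b
    · intro x a j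
      refine Fin.cases ?_ (fun j => ?_) j
      · simp only [covF, Function.update_self, ne_eq, Fin.succ_ne_zero, not_false_eq_true,
          Function.update_of_ne, Finset.mul_sum]
        rw [Finset.sum_comm]
        refine Finset.sum_eq_zero fun b _ => ?_
        have := congrFun (sum_mul_pd T.2.1 x) b
        simp only [Finset.sum_apply, Pi.smul_apply, smul_eq_mul, Pi.zero_apply] at this
        simp only [mul_left_comm ((x : E3) _), ← Finset.mul_sum, this, mul_zero]
      · simp only [covF, Finset.mul_sum]
        rw [Finset.sum_comm]
        refine Finset.sum_eq_zero fun b _ => ?_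
        have h0 : ∀ i : Fin 3, Function.update a j.succ i 0 = a 0 := fun i =>
          Function.update_of_ne (Fin.succ_ne_zero j).symm _ _
        have h1 : ∀ i : Fin 3, (∏ l, proj x (Function.update a j.succ i l.succ) (b l))
            = proj x i (b j) * ∏ l ∈ Finset.univ.erase j, proj x (a l.succ) (b l) := by
          intro i
          rw [← Finset.mul_prod_erase _ _ (Finset.mem_univ j)]
          congr 1
          · simp
          · refine Finset.prod_congr rfl fun l hl => ?_
            rw [Function.update_of_ne]
            simpa using Finset.ne_of_mem_erase hl
        simp only [h0, h1, ← mul_assoc, ← Finset.sum_mul, sum_mul_proj, zero_mul]⟩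
  map_add' S T := by
    ext x a
    have h := ((S.2.1.differentiableAt x).hasFDerivAt.add
      (T.2.1.differentiableAt x).hasFDerivAt).fderiv
    have h' : ∀ i b, pd ((S : Field k) + (T : Field k)) x i b
        = pd (S : Field k) x i b + pd (T : Field k) x i b := by
      intro i b
      have := congrFun (congrArg (fun L => L (EuclideanSpace.single i 1)) h) b
      exact this
    simp [covF, h', mul_add, Finset.sum_add_distrib]
  map_smul' c T := by
    ext x a
    have h := ((T.2.1.differentiableAt x).hasFDerivAt.const_smul c).fderiv
    have h' : ∀ i b, pd (c • (T : Field k)) x i b = c * pd (T : Field k) x i b := by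
      intro i b
      have := congrFun (congrArg (fun L => L (EuclideanSpace.single i 1)) h) b
      exact this
    simp [covF, h', mul_left_comm _ c, Finset.mul_sum]

/-- Contraction of the first two indices. -/
def contr (k : ℕ) : Tens (k + 2) →ₗ[ℝ] Tens k where
  toFun T := ⟨fun x a => ∑ i, (T : Field (k + 2)) x (Fin.cons i (Fin.cons i a)), by
    constructor
    · exact smooth_pi.2 fun a => ContDiffOn.sum fun i _ => Tens.smooth_apply T _
    · intro x a j
      simp only [Finset.mul_sum]
      rw [Finset.sum_comm]
      refine Finset.sum_eq_zero fun i _ => ?_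
      simpa only [Fin.cons_update] using T.2.2 x (Fin.cons i (Fin.cons i a)) j.succ.succ⟩
  map_add' S T := by
    ext x a
    simp [Finset.sum_add_distrib]
  map_smul' c T := by
    ext x a
    simp [Finset.mul_sum]

/-- The divergence `(div T)_{a₁ ⋯ aₖ} = ∇^b T_{b a₁ ⋯ aₖ}`. -/
def div (k : ℕ) : Tens (k + 1) →ₗ[ℝ] Tens k := contr k ∘ₗ cov (k + 1)

/-- The area form `∈` of the round sphere, oriented by the outward normal. -/
def area (x : S2) (i j : Fin 3) : ℝ :=
  (fun l => (x : E3) l) ⬝ᵥ crossProduct (Pi.single i 1) (Pi.single j 1)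

lemma Smooth.area (i j : Fin 3) : Smooth (fun x : S2 => area x i j) := by
  unfold NullGluing.area dotProduct
  exact ContDiffOn.sum fun l _ => (Smooth.coord l).mul contDiffOn_const

lemma sum_mul_area (x : S2) (j : Fin 3) : ∑ i, (x : E3) i * area x i j = 0 := by
  fin_cases j <;>
  simp [area, dotProduct, Fin.sum_univ_three, crossProduct] <;> ring

/-- The dual `(*V)_i = ∈_{ij} V^j` of a one-form. -/
def star : Tens 1 →ₗ[ℝ] Tens 1 where
  toFun V := ⟨fun x a => ∑ j, area x (a 0) j * (V : Field 1) x ![j], by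
    constructor
    · exact smooth_pi.2 fun a => ContDiffOn.sum fun j _ =>
        (Smooth.area _ _).mul (Tens.smooth_apply V _)
    · intro x a j
      obtain rfl : j = 0 := Subsingleton.elim _ _
      simp only [Function.update_self, Finset.mul_sum]
      rw [Finset.sum_comm]
      refine Finset.sum_eq_zero fun l _ => ?_
      simp only [← mul_assoc, ← Finset.sum_mul, sum_mul_area, zero_mul]⟩
  map_add' S T := by
    ext x a
    simp [mul_add, Finset.sum_add_distrib]
  map_smul' c T := by
    ext x a
    simp [mul_left_comm _ c, Finset.mul_sum]

/-- The curl `∈^{ij} ∇_i V_j` of a one-form. -/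
def curl : Tens 1 →ₗ[ℝ] Tens 0 where
  toFun V := ⟨fun x _ => ∑ i, ∑ j, area x i j * covF (V : Field 1) x ![i, j], by
    refine ⟨smooth_pi.2 fun a => ContDiffOn.sum fun i _ => ContDiffOn.sum fun j _ =>
      (Smooth.area _ _).mul (Tens.smooth_apply (cov 1 V) _), fun x a j => j.elim0⟩⟩
  map_add' S T := by
    ext x a
    have h : covF ((S + T : Tens 1) : Field 1) = covF (S : Field 1) + covF (T : Field 1) :=
      congrArg Subtype.val ((cov 1).map_add S T)
    simp only [h]
    simp [mul_add, Finset.sum_add_distrib]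
  map_smul' c T := by
    ext x a
    have h : covF ((c • T : Tens 1) : Field 1) = c • covF (T : Field 1) :=
      congrArg Subtype.val ((cov 1).map_smul c T)
    simp only [h]
    simp [mul_left_comm _ c, Finset.mul_sum]

/-- Symmetric tracefree 2-tensors. -/
def IsSTF (T : Field 2) : Prop :=
  (∀ x i j, T x ![i, j] = T x ![j, i]) ∧ ∀ x, ∑ i, T x ![i, i] = 0

/-- The smooth symmetric tracefree 2-tensor fields on the sphere. -/
def STF : Submodule ℝ (Tens 2) where
  carrier := {T | IsSTF T}
  add_mem' := by
    rintro S T ⟨hS, hS'⟩ ⟨hT, hT'⟩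
    refine ⟨fun x i j => ?_, fun x => ?_⟩
    · simp [hS x i j, hT x i j]
    · simp [Finset.sum_add_distrib, hS' x, hT' x]
  zero_mem' := ⟨fun x i j => rfl, fun x => by simp⟩
  smul_mem' := by
    rintro c T ⟨hT, hT'⟩
    refine ⟨fun x i j => ?_, fun x => ?_⟩
    · simp [hT x i j]
    · simp [← Finset.mul_sum, hT' x]

/-- The symmetric tracefree part of a 2-tensor. -/
def stf : Tens 2 →ₗ[ℝ] STF where
  toFun T := ⟨⟨fun x a =>
      ((T : Field 2) x ![a 0, a 1] + (T : Field 2) x ![a 1, a 0]) / 2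
        - (∑ i, (T : Field 2) x ![i, i]) / 2 * proj x (a 0) (a 1), by
    constructor
    · refine smooth_pi.2 fun a => ?_
      refine ContDiffOn.sub ?_ (ContDiffOn.mul ?_ (Smooth.proj _ _))
      · exact ((Tens.smooth_apply T _).add (Tens.smooth_apply T _)).div_const _
      · exact (ContDiffOn.sum fun i _ => Tens.smooth_apply T _).div_const _
    · intro x a j
      have h0 : ∀ l : Fin 3, ∑ i, (x : E3) i * (T : Field 2) x ![i, l] = 0 := by
        intro l
        have := T.2.2 x ![l, l] 0
        convert this using 4 with i
        ext b; fin_cases b <;> simp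
      have h1 : ∀ l : Fin 3, ∑ i, (x : E3) i * (T : Field 2) x ![l, i] = 0 := by
        intro l
        have := T.2.2 x ![l, l] 1
        convert this using 4 with i
        ext b; fin_cases b <;> simp
      have h2 := sum_mul_proj x
      have h3 : ∀ l : Fin 3, ∑ i, (x : E3) i * proj x l i = 0 := by
        intro l; simpa only [proj_comm x l] using h2 l
      have key : ∀ A B C : Fin 3 → ℝ, ∀ c : ℝ, (∑ i, (x : E3) i * A i = 0) →
          (∑ i, (x : E3) i * B i = 0) → (∑ i, (x : E3) i * C i = 0) →
          ∑ i, (x : E3) i * ((A i + B i) / 2 - c * C i) = 0 := by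
        intro A B C c hA hB hC
        simp only [Fin.sum_univ_three] at *
        linear_combination hA / 2 + hB / 2 - c * hC
      fin_cases j
      · simpa using key (fun i => (T : Field 2) x ![i, a 1]) (fun i => (T : Field 2) x ![a 1, i])
          (fun i => proj x i (a 1)) _ (h0 _) (h1 _) (h2 _)
      · simpa using key (fun i => (T : Field 2) x ![a 0, i]) (fun i => (T : Field 2) x ![i, a 0])
          (fun i => proj x (a 0) i) _ (h1 _) (h0 _) (h3 _)⟩, by
    refine ⟨fun x i j => ?_, fun x => ?_⟩
    · simp [proj_comm x i j, add_comm]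
    · have := sum_proj_self x
      simp [Finset.sum_sub_distrib, ← Finset.mul_sum, this]⟩
  map_add' S T := by
    ext x a
    simp [Finset.sum_add_distrib]
    ring
  map_smul' c T := by
    ext x a
    simp [← Finset.mul_sum]
    ring

/-! ### Hodge operators on smooth fields -/

/-- `D₁^*(f₁, f₂) = -d f₁ + *d f₂`. -/
def D1star (f₁ f₂ : Tens 0) : Tens 1 := -cov 0 f₁ + star (cov 0 f₂)

/-- `D₂ W = div W`. -/
def D2 : STF →ₗ[ℝ] Tens 1 := div 1 ∘ₗ STF.subtype

/-- `(D₂^* V)_{ij} = -½ (∇_i V_j + ∇_j V_i - (div V) γ_{ij})`. -/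
def D2star : Tens 1 →ₗ[ℝ] STF := (-1 : ℝ) • (stf ∘ₗ cov 1)

/-! ### Generalised fields, by duality with smooth test fields -/

instance : CompactSpace S2 := by unfold S2; infer_instance

lemma integrable_pair {k : ℕ} (S T : Tens k) :
    Integrable (fun x => ∑ a, (S : Field k) x a * (T : Field k) x a) surf := by
  have h : Continuous (fun x => ∑ a, (S : Field k) x a * (T : Field k) x a) :=
    continuous_finsetSum _ fun a _ =>
      (Tens.smooth_apply S a).continuous.mul (Tens.smooth_apply T a).continuous
  exact h.integrable_of_hasCompactSupport (HasCompactSupport.of_compactSpace _)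

/-- Generalised covariant `k`-tensor fields on the sphere: functionals on the smooth ones. -/
abbrev GenField (k : ℕ) := Tens k →ₗ[ℝ] ℝ

/-- Generalised symmetric tracefree 2-tensor fields on the sphere. -/
abbrev DistSTF := STF →ₗ[ℝ] ℝ

/-- A smooth field as a generalised field, through the `L²` product of the round metric. -/
def toDist {k : ℕ} : Tens k →ₗ[ℝ] GenField k :=
  LinearMap.mk₂ ℝ (fun S T => ∫ x, ∑ a, (S : Field k) x a * (T : Field k) x a ∂surf)
    (fun S S' T => by
      rw [← integral_add (integrable_pair S T) (integrable_pair S' T)]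
      simp [add_mul, Finset.sum_add_distrib])
    (fun c S T => by
      rw [smul_eq_mul, ← integral_const_mul]
      simp [mul_assoc, Finset.mul_sum])
    (fun S T T' => by
      rw [← integral_add (integrable_pair S T) (integrable_pair S T')]
      simp [mul_add, Finset.sum_add_distrib])
    (fun c S T => by
      rw [smul_eq_mul, ← integral_const_mul]
      simp [mul_left_comm _ c, Finset.mul_sum])

/-- A smooth symmetric tracefree 2-tensor field as a generalised one. -/
def toDistS : STF →ₗ[ℝ] DistSTF :=
  LinearMap.mk₂ ℝ (fun S T => toDist (S : Tens 2) (T : Tens 2))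
    (fun S S' T => by simp) (fun c S T => by simp) (fun S T T' => by simp) (fun c S T => by simp)

/-- Covariant derivative of generalised fields: `⟨∇T, Φ⟩ = -⟨T, div Φ⟩`. For `k = 0` it is `d`. -/
def dcov {k : ℕ} (T : GenField k) : GenField (k + 1) := -(T ∘ₗ div k)

/-- Divergence of generalised fields: `⟨div V, Φ⟩ = -⟨V, ∇Φ⟩`. -/
def ddiv {k : ℕ} (V : GenField (k + 1)) : GenField k := -(V ∘ₗ cov k)

/-- The Laplace-Beltrami operator of the round metric on generalised functions. -/
def lap (f : GenField 0) : GenField 0 := ddiv (dcov f)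

/-- `D₁^*(f₁, f₂)` on generalised functions: the adjoint of `V ↦ (div V, curl V)`. -/
def dD1s (f₁ f₂ : GenField 0) : GenField 1 := f₁ ∘ₗ div 0 + f₂ ∘ₗ curl

/-- `D₂^*` on generalised one-forms: the adjoint of `D₂`. -/
def dD2s (V : GenField 1) : DistSTF := V ∘ₗ D2

/-- Divergence of generalised symmetric tracefree 2-tensors: the adjoint of `D₂^*`. -/
def ddivS (W : DistSTF) : GenField 1 := W ∘ₗ D2star

/-- A generalised symmetric tracefree field as a generalised 2-tensor field. -/
def ofSTF (W : DistSTF) : GenField 2 := W ∘ₗ stf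

/-! ### Sobolev norms with respect to the round unit metric -/

/-- The generalised field `T` is the square integrable field `S`. -/
def Represents {k : ℕ} (S : Field k) (T : GenField k) : Prop :=
  Tangential S ∧ (∀ a, MemLp (fun x => S x a) 2 surf) ∧
    ∀ Φ : Tens k, T Φ = ∫ x, ∑ a, S x a * (Φ : Field k) x a ∂surf

/-- The square of the `L²` norm (infinite if `T` is not a square integrable field). -/
def l2sq {k : ℕ} (T : GenField k) : ℝ≥0∞ :=
  ⨅ (S : Field k) (_ : Represents S T), ∫⁻ x, ∑ a, ENNReal.ofReal (S x a ^ 2) ∂surf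

/-- The square `∑_{j ≤ m} ‖∇^j T‖²_{L²}` of the `H^m` norm. -/
def sobolevSq : ℕ → {k : ℕ} → GenField k → ℝ≥0∞
  | 0, _, T => l2sq T
  | m + 1, _, T => l2sq T + sobolevSq m (dcov T)

/-- The `H^m` norm. -/
def sobolevNorm (m : ℕ) {k : ℕ} (T : GenField k) : ℝ≥0∞ := sobolevSq m T ^ (1 / 2 : ℝ)

/-! ### Spherical harmonics -/

/-- The Legendre polynomials, by Rodrigues' formula. -/
def legendre (l : ℕ) : Polynomial ℝ :=
  Polynomial.C (1 / (2 ^ l * (l.factorial : ℝ))) *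
    Polynomial.derivative^[l] ((Polynomial.X ^ 2 - 1) ^ l)

/-- The normalisation constants of the real spherical harmonics. -/
def shConst (l n : ℕ) : ℝ :=
  (if n = 0 then 1 else √2) *
    √((2 * l + 1) / (4 * Real.pi) * (((l - n).factorial : ℝ) / ((l + n).factorial : ℝ)))

/-- The real harmonics as functions on the ambient space: `Re` and `Im` of
`c (P_l^{(|m|)}) (y₃) (y₁ + i y₂)^{|m|}` for `m ≥ 0` and `m < 0` respectively. -/
def shFun (l : ℕ) (m : ℤ) (y : E3) : ℝ :=
  shConst l m.natAbs * (Polynomial.derivative^[m.natAbs] (legendre l)).eval (y 2) *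
    (if 0 ≤ m then (((y 0 : ℂ) + y 1 * Complex.I) ^ m.natAbs).re
      else (((y 0 : ℂ) + y 1 * Complex.I) ^ m.natAbs).im)

lemma contDiff_shFun (l : ℕ) (m : ℤ) : ContDiff ℝ ∞ (shFun l m) := by
  have hc : ∀ i : Fin 3, ContDiff ℝ ∞ (fun y : E3 => y i) := fun i => by fun_prop
  have h1 : ContDiff ℝ ∞ (fun y : E3 => ((y 0 : ℂ) + y 1 * Complex.I) ^ m.natAbs) :=
    ((Complex.ofRealCLM.contDiff.comp (hc 0)).add
      ((Complex.ofRealCLM.contDiff.comp (hc 1)).mul contDiff_const)).pow _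
  have h2 : ContDiff ℝ ∞ (fun y : E3 =>
      (Polynomial.derivative^[m.natAbs] (legendre l)).eval (y 2)) :=
    (Polynomial.contDiff_aeval _ ∞).comp (hc 2)
  unfold shFun
  split_ifs
  · exact (contDiff_const.mul h2).mul (Complex.reCLM.contDiff.comp h1)
  · exact (contDiff_const.mul h2).mul (Complex.imCLM.contDiff.comp h1)

/-- The real spherical harmonics `Y^{lm}`, `-l ≤ m ≤ l`. -/
def Y (l : ℕ) (m : ℤ) : Tens 0 :=
  ⟨fun x _ => shFun l m x,
    smooth_pi.2 fun _ => Smooth.restrict (contDiff_shFun l m), fun _ _ j => j.elim0⟩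

/-- The electric vector harmonics `E^{lm}`, `l ≥ 1`. -/
def vecE (l : ℕ) (m : ℤ) : Tens 1 := (√((l : ℝ) * (l + 1)))⁻¹ • D1star (Y l m) 0

/-- The magnetic vector harmonics `H^{lm}`, `l ≥ 1`. -/
def vecH (l : ℕ) (m : ℤ) : Tens 1 := (√((l : ℝ) * (l + 1)))⁻¹ • D1star 0 (Y l m)

/-- The electric tensor harmonics `ψ^{lm}`, `l ≥ 2`. -/
def tenE (l : ℕ) (m : ℤ) : STF := (√((1 / 2 : ℝ) * l * (l + 1) - 1))⁻¹ • D2star (vecE l m)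

/-- The magnetic tensor harmonics `φ^{lm}`, `l ≥ 2`. -/
def tenH (l : ℕ) (m : ℤ) : STF := (√((1 / 2 : ℝ) * l * (l + 1) - 1))⁻¹ • D2star (vecH l m)

/-- The range `-l ≤ m ≤ l`. -/
def ms (l : ℕ) : Finset ℤ := Finset.Icc (-(l : ℤ)) l

/-- The mode `f^{[l]}` of a function. -/
def mode0 (l : ℕ) (f : GenField 0) : GenField 0 := ∑ m ∈ ms l, f (Y l m) • toDist (Y l m)

/-- The mode `V^{[l]}` (electric and magnetic parts) of a one-form, `l ≥ 1`. -/
def mode1 (l : ℕ) (V : GenField 1) : GenField 1 :=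
  ∑ m ∈ ms l, (V (vecE l m) • toDist (vecE l m) + V (vecH l m) • toDist (vecH l m))

/-- The mode `W^{[l]}` (electric and magnetic parts) of a tracefree 2-tensor, `l ≥ 2`. -/
def mode2 (l : ℕ) (W : DistSTF) : DistSTF :=
  ∑ m ∈ ms l, (W (tenE l m) • toDistS (tenE l m) + W (tenH l m) • toDistS (tenH l m))

/-- The low part `f^{[≤ n]}` of a function. -/
def lowPart (n : ℕ) (f : GenField 0) : GenField 0 := ∑ l ∈ Finset.range (n + 1), mode0 l f

/-- `g = f^{[≥ n]}`, the sum of the modes `l ≥ n` (convergence against test functions). -/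
def IsHigh (n : ℕ) (f g : GenField 0) : Prop :=
  ∀ Φ : Tens 0, HasSum (fun l => if n ≤ l then mode0 l f Φ else 0) (g Φ)

/-- `S = W_ψ^{[≥ n]}`, the sum of the electric modes `l ≥ n` (convergence against test fields). -/
def IsElectricHigh (n : ℕ) (W S : DistSTF) : Prop :=
  ∀ Φ : STF, HasSum
    (fun l => if n ≤ l then ∑ m ∈ ms l, W (tenE l m) * toDistS (tenE l m) Φ else 0) (S Φ)

/-! ### Linearised sphere data, linearised perturbations and charges -/

/-- Linearised `C³` sphere data at the round sphere. Here `φ`, `g_c` are given by the splitting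
`g = φ² g_c` of the metric; `trchi`, `trchib` stand for the linearisations of `Ω tr χ` and
`Ω tr χ_`; the suffix `b` marks the ingoing (underlined) quantities. -/
structure LinSphereData where
  Om : GenField 0
  phi : GenField 0
  gc : DistSTF
  trchi : GenField 0
  chih : DistSTF
  trchib : GenField 0
  chibh : DistSTF
  eta : GenField 1
  om : GenField 0
  Dom : GenField 0
  DDom : GenField 0
  omb : GenField 0
  Dbomb : GenField 0
  DbDbomb : GenField 0
  al : DistSTF
  Dal : DistSTF
  alb : DistSTF
  Dbalb : DistSTF

/-- The linearised perturbation map on the sphere `u = 0`, where `r = v - u` has the value `v`. Here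
`f n` stands for `∂_u^n f (0)`, so that `∂_u (f / r) = f 1 / v + f 0 / v ^ 2`. -/
def linPert (v : ℝ) (f : Fin 5 → GenField 0) (q₁ q₂ : GenField 0) : LinSphereData where
  Om := (1 / 2 : ℝ) • f 1
  phi := -f 0 + (v / 2) • lap q₁
  gc := (2 : ℝ) • dD2s (dD1s q₁ q₂)
  trchi := (2 / v ^ 2) • (lap (f 0) + f 0)
  chih := (-2 : ℝ) • dD2s (dcov (f 0))
  trchib := (-2 : ℝ) • ((1 / v) • f 1 + (1 / v ^ 2) • f 0)
  chibh := 0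
  eta := v • dcov ((1 / v) • f 1 + (1 / v ^ 2) • f 0)
  om := 0
  Dom := 0
  DDom := 0
  omb := (1 / 2 : ℝ) • f 2
  Dbomb := (1 / 2 : ℝ) • f 3
  DbDbomb := (1 / 2 : ℝ) • f 4
  al := 0
  Dal := 0
  alb := 0
  Dbalb := 0

/-- The linearised Gauss curvature. -/
def linK (v : ℝ) (X : LinSphereData) : GenField 0 :=
  (1 / (2 * v ^ 2)) • ddiv (ddivS X.gc) - (1 / v ^ 3) • (lap X.phi + (2 : ℝ) • X.phi)

/-- The combination `Ω tr χ - (4 / v) Ω` of linearised data. -/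
def trOm (v : ℝ) (X : LinSphereData) : GenField 0 := X.trchi - (4 / v) • X.Om

/-- The charge of `η^{[1]}`. -/
def chargeEta (v : ℝ) (X : LinSphereData) : GenField 1 :=
  v ^ 2 • mode1 1 X.eta + (v ^ 3 / 2) • dcov (mode0 1 (trOm v X))

/-- The charge of `Ω tr χ_`. -/
def chargeTrchib (v : ℝ) (X : LinSphereData) : GenField 0 :=
  v ^ 2 • X.trchib - (2 / v) • ddiv (v ^ 2 • X.eta + (v ^ 3 / 2) • dcov (trOm v X))
    - v ^ 2 • trOm v X + (2 * v ^ 3) • linK v X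

/-- The `l = 2` charge of `D_ α_`. -/
def chargeDbalbTwo (v : ℝ) (X : LinSphereData) : DistSTF :=
  mode2 2 ((1 / v) • X.Dbalb + (1 / v ^ 2) • (X.alb - (2 : ℝ) • dD2s (ddivS X.alb)))

/-- The field whose electric part with `l ≥ 3` is the charge of `D_ α_` with `l ≥ 3`. -/
def chargeDbalbField (v : ℝ) (X : LinSphereData) : DistSTF :=
  (1 / v) • X.Dbalb + (1 / v ^ 2) • (X.alb - (2 : ℝ) • dD2s (ddivS X.alb))
    + (2 : ℝ) • dD2s ((3 / v) • ((1 / v ^ 2) • ddivS X.chibh - (1 / 2 : ℝ) • dcov X.trchib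
        - (1 / v) • X.eta) + dD1s X.Dbomb 0)

/-- The `l ≤ 1` charge of `D_² ω_`. -/
def chargeDbDbomb (v : ℝ) (X : LinSphereData) : GenField 0 :=
  lowPart 1 X.DbDbomb
    - (1 / (2 * v ^ 4)) • (lap (lowPart 1 (chargeTrchib v X))
        - (3 : ℝ) • lowPart 1 (chargeTrchib v X))
    + (4 / v ^ 5) • ddiv (chargeEta v X)


/-! ### The nonlinear quantities whose linearisations are `U` and `V` -/

/-- The matrix of components of a 2-tensor at a point. -/
def mat (T : Field 2) (x : S2) : Matrix (Fin 3) (Fin 3) ℝ := Matrix.of fun i j => T x ![i, j]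

/-- The 2-tensor field with given matrices of components. -/
def ofMat (A : S2 → Matrix (Fin 3) (Fin 3) ℝ) : Field 2 := fun x a => A x (a 0) (a 1)

/-- A metric of the tangent plane, extended by `1` to the normal direction. -/
def fullMet (x : S2) (g : Matrix (Fin 3) (Fin 3) ℝ) : Matrix (Fin 3) (Fin 3) ℝ :=
  g + Matrix.vecMulVec (fun i => (x : E3) i) (fun i => (x : E3) i)

/-- The trace with respect to a metric `g` of the tangent plane. -/
def trG (x : S2) (g h : Matrix (Fin 3) (Fin 3) ℝ) : ℝ := ∑ i, ∑ j, (fullMet x g)⁻¹ i j * h i j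

/-- The tracefree part with respect to a metric `g` of the tangent plane. -/
def tfG (x : S2) (g h : Matrix (Fin 3) (Fin 3) ℝ) : Matrix (Fin 3) (Fin 3) ℝ :=
  h - (trG x g h / 2) • g

/-- The conformal factor `φ` of a metric `g`: its area element is `φ²` times the round one. -/
def conf (x : S2) (g : Matrix (Fin 3) (Fin 3) ℝ) : ℝ := (fullMet x g).det ^ (1 / 4 : ℝ)

/-- The difference `C^l_{ij}` of the Levi-Civita connections of `g` and of the round metric. -/
def chr (g : Field 2) (x : S2) (l i j : Fin 3) : ℝ :=
  (1 / 2) * ∑ m, (fullMet x (mat g x))⁻¹ l m *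
    (covF g x ![i, j, m] + covF g x ![j, i, m] - covF g x ![m, i, j])

/-- The divergence of a 2-tensor with respect to the Levi-Civita connection of `g`. -/
def divG (g T : Field 2) : Field 1 := fun x a =>
  ∑ k, ∑ i, (fullMet x (mat g x))⁻¹ k i * (covF T x ![k, i, a 0]
    - ∑ l, chr g x l k i * T x ![l, a 0] - ∑ l, chr g x l k (a 0) * T x ![i, l])

/-- The covariant derivative of a one-form with respect to the Levi-Civita connection of `g`. -/
def covG (g : Field 2) (V : Field 1) (x : S2) : Matrix (Fin 3) (Fin 3) ℝ :=
  Matrix.of fun i j => covF V x ![i, j] - ∑ l, chr g x l i j * V x ![l]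

/-- `(∇ ⊗̂ V)_{ij} = ∇_i V_j + ∇_j V_i - (div V) g_{ij}` with respect to `g`. -/
def tensG (g : Field 2) (V : Field 1) (x : S2) : Matrix (Fin 3) (Fin 3) ℝ :=
  covG g V x + (covG g V x).transpose - trG x (mat g x) (covG g V x) • mat g x

/-- The 2-tensor `φ⁻¹ D_ α_ + φ⁻² (1 + φ² ∇ ⊗̂ div) α_` of sphere data with metric `g`, curvature
component `α_ = a` and derivative `D_ α_ = b`. -/
def fieldUV (g a b : Field 2) (x : S2) : Matrix (Fin 3) (Fin 3) ℝ :=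
  (conf x (mat g x))⁻¹ • mat b x + (conf x (mat g x) ^ 2)⁻¹ •
    (mat a x + conf x (mat g x) ^ 2 • tensG g (divG g a) x)

/-- The coefficient `∫ W · Ψ` of a 2-tensor field, for the round metric. -/
def coeff (W : S2 → Matrix (Fin 3) (Fin 3) ℝ) (Ψ : STF) : ℝ :=
  ∫ x, ∑ i, ∑ j, W x i j * ((Ψ : Tens 2) : Field 2) x ![i, j] ∂surf

/-- The charges `U^m`, `-2 ≤ m ≤ 2`. -/
def chargeU (m : ℤ) (g a b : Field 2) : ℝ := coeff (fieldUV g a b) (tenE 2 m)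

/-- The charges `V^m`, `-2 ≤ m ≤ 2`. -/
def chargeV (m : ℤ) (g a b : Field 2) : ℝ := coeff (fieldUV g a b) (tenH 2 m)

/-- The metric `r² γ` of the round sphere of radius `r`. -/
def roundMet (r : ℝ) : Field 2 := fun x a => r ^ 2 * proj x (a 0) (a 1)

/-! ### Sphere perturbations in Minkowski space -/

/-- Points and vectors of Minkowski space, in coordinates `(t, x₁, x₂, x₃)`. -/
abbrev M4 := Fin 4 → ℝ

/-- The Minkowski metric. -/
def mink : Matrix (Fin 4) (Fin 4) ℝ := Matrix.diagonal ![-1, 1, 1, 1]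

/-- The Minkowski product of two vectors. -/
def mdot (X Z : M4) : ℝ := ∑ a, ∑ b, mink a b * X a * Z b

/-- Partial derivatives on `ℝ⁴`. -/
def pd4 (F : M4 → ℝ) (a : Fin 4) (p : M4) : ℝ := fderiv ℝ F p (Pi.single a 1)

/-- The Christoffel symbols `Γ^a_{bc}` of a metric on `ℝ⁴`. -/
def christoffel (G : M4 → Matrix (Fin 4) (Fin 4) ℝ) (p : M4) (a b c : Fin 4) : ℝ :=
  (1 / 2) * ∑ d, (G p)⁻¹ a d * (pd4 (fun q => G q d c) b p + pd4 (fun q => G q d b) c p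
    - pd4 (fun q => G q b c) d p)

/-- The Riemann tensor `R_{abcd}` of a metric on `ℝ⁴`. -/
def riemann (G : M4 → Matrix (Fin 4) (Fin 4) ℝ) (p : M4) (a b c d : Fin 4) : ℝ :=
  ∑ e, G p a e * (pd4 (fun q => christoffel G q e d b) c p - pd4 (fun q => christoffel G q e c b) d p
    + ∑ h, (christoffel G p e c h * christoffel G p h d b
      - christoffel G p e d h * christoffel G p h c b))

/-- The curvature `R(X₁, X₂, X₃, X₄)` of Minkowski space at `p`. -/
def curv (p X₁ X₂ X₃ X₄ : M4) : ℝ :=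
  ∑ a, ∑ b, ∑ c, ∑ d, riemann (fun _ => mink) p a b c d * X₁ a * X₂ b * X₃ c * X₄ d

section Perturbed

variable (f : ℝ → S2 → ℝ) (u : ℝ) (x : S2)

/-- The point with new coordinates `(u, x)` on the ingoing cone `v = 2`, `t = v + ũ`, `r = v - ũ`,
where `ũ = u + f (u, x)`. -/
def emb : M4 := Fin.cons (2 + u + f u x) fun i => (2 - u - f u x) * (x : E3) i

/-- The lapse `Ω = (1 + ∂_u f)^{1/2}`. -/
def lapse : ℝ := √(1 + deriv (fun s => f s x) u)

/-- The coordinate vector fields `∂_i` tangential to the spheres of constant `u`. -/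
def frame (i : Fin 3) : M4 := pd (emb f u) x i

/-- The ingoing null vector `L_ = ∂_u`. -/
def Lbar : M4 := deriv (fun s => emb f s x) u

/-- The outgoing null vector `L`, orthogonal to the spheres of constant `u`, with
`g(L, L_) = -2 Ω²`. -/
def Lout : M4 :=
  Fin.cons 1 (fun i => (x : E3) i)
    + (∑ i, pd (f u) x i ^ 2 / (2 - u - f u x) ^ 2) • (Fin.cons 1 fun i => -(x : E3) i : M4)
    + (2 / (2 - u - f u x)) • (Fin.cons 0 fun i => pd (f u) x i : M4)

/-- The normalised vector `Ω⁻¹ L`. -/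
def LoutN : M4 := (lapse f u x)⁻¹ • Lout f u x

/-- The normalised vector `Ω⁻¹ L_`. -/
def LbarN : M4 := (lapse f u x)⁻¹ • Lbar f u x

/-- The induced metric. -/
def met : Matrix (Fin 3) (Fin 3) ℝ := Matrix.of fun i j => mdot (frame f u x i) (frame f u x j)

/-- The outgoing null second fundamental form. -/
def chi : Matrix (Fin 3) (Fin 3) ℝ :=
  Matrix.of fun i j => mdot (pd (LoutN f u) x i) (frame f u x j)

/-- The ingoing null second fundamental form. -/
def chib : Matrix (Fin 3) (Fin 3) ℝ :=
  Matrix.of fun i j => mdot (pd (LbarN f u) x i) (frame f u x j)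

/-- `η = ζ + d log Ω`, where `ζ_i = ½ g(D_i (Ω⁻¹ L), Ω⁻¹ L_)`. -/
def etaForm (i : Fin 3) : ℝ :=
  (1 / 2) * mdot (pd (LoutN f u) x i) (LbarN f u x) + pd (fun y => Real.log (lapse f u y)) x i

/-- `D_^n log Ω`, so that `n = 1, 2, 3` are `ω_`, `D_ ω_`, `D_² ω_`. -/
def logLapse (n : ℕ) : ℝ := iteratedDeriv n (fun s => Real.log (lapse f s x)) u

/-- `α_{ij} = R(∂_i, Ω⁻¹ L, ∂_j, Ω⁻¹ L)`. -/
def alpha : Matrix (Fin 3) (Fin 3) ℝ := Matrix.of fun i j =>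
  curv (emb f u x) (frame f u x i) (LoutN f u x) (frame f u x j) (LoutN f u x)

/-- `α_` in the direction `L_`: `R(∂_i, Ω⁻¹ L_, ∂_j, Ω⁻¹ L_)`. -/
def alphab : Matrix (Fin 3) (Fin 3) ℝ := Matrix.of fun i j =>
  curv (emb f u x) (frame f u x i) (LbarN f u x) (frame f u x j) (LbarN f u x)

/-- The tracefree part of `D_ α_`, where `D_` is the Lie derivative along `L_ = ∂_u`. -/
def Dalphab : Matrix (Fin 3) (Fin 3) ℝ :=
  tfG x (met f u x) (Matrix.of fun i j => deriv (fun s => alphab f s x i j) u)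

end Perturbed

/-- Smoothness of a family of maps on the sphere, jointly with the parameter. -/
def SmoothFamily {F : Type*} [NormedAddCommGroup F] [NormedSpace ℝ F] (f : ℝ → S2 → F) : Prop :=
  ContDiffOn ℝ ∞ (fun p : ℝ × E3 => f p.1 (dir p.2)) (Set.univ ×ˢ {0}ᶜ)

/-- The derivative at `ε = 0` of the family `F ε` of tensor fields is the smooth field `T`. -/
def LinearisesTo {k : ℕ} (F : ℝ → Field k) (T : GenField k) : Prop :=
  ∃ S : Tens k, toDist S = T ∧
    ∀ x a, HasDerivAt (fun ε => F ε x a) ((S : Field k) x a) 0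

/-- The same for a symmetric tracefree derivative. -/
def LinearisesToS (F : ℝ → Field 2) (T : DistSTF) : Prop :=
  ∃ S : STF, toDistS S = T ∧
    ∀ x a, HasDerivAt (fun ε => F ε x a) (((S : Tens 2) : Field 2) x a) 0

/-- `X` is the linearisation, at the round sphere of radius 2 and in the direction `f`, of the
sphere data of the perturbed spheres `u = 0` for the perturbation functions `ε f`. Only `ω`, `D ω`,
`D² ω` and `D α` are left out, which involve derivatives off the cone. -/
structure IsTransversalLin (f : ℝ → S2 → ℝ) (X : LinSphereData) : Prop where
  Om : LinearisesTo (fun ε x _ => lapse (ε • f) 0 x) X.Om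
  phi : LinearisesTo (fun ε x _ => conf x (met (ε • f) 0 x)) X.phi
  gc : LinearisesToS (fun ε => ofMat fun x =>
    (conf x (met (ε • f) 0 x) ^ 2)⁻¹ • met (ε • f) 0 x) X.gc
  trchi : LinearisesTo (fun ε x _ =>
    lapse (ε • f) 0 x * trG x (met (ε • f) 0 x) (chi (ε • f) 0 x)) X.trchi
  chih : LinearisesToS (fun ε => ofMat fun x =>
    tfG x (met (ε • f) 0 x) (chi (ε • f) 0 x)) X.chih
  trchib : LinearisesTo (fun ε x _ =>
    lapse (ε • f) 0 x * trG x (met (ε • f) 0 x) (chib (ε • f) 0 x)) X.trchib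
  chibh : LinearisesToS (fun ε => ofMat fun x =>
    tfG x (met (ε • f) 0 x) (chib (ε • f) 0 x)) X.chibh
  eta : LinearisesTo (fun ε x a => etaForm (ε • f) 0 x (a 0)) X.eta
  omb : LinearisesTo (fun ε x _ => logLapse (ε • f) 0 x 1) X.omb
  Dbomb : LinearisesTo (fun ε x _ => logLapse (ε • f) 0 x 2) X.Dbomb
  DbDbomb : LinearisesTo (fun ε x _ => logLapse (ε • f) 0 x 3) X.DbDbomb
  al : LinearisesToS (fun ε => ofMat fun x => alpha (ε • f) 0 x) X.al
  alb : LinearisesToS (fun ε => ofMat fun x => alphab (ε • f) 0 x) X.alb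
  Dbalb : LinearisesToS (fun ε => ofMat fun x => Dalphab (ε • f) 0 x) X.Dbalb

/-- The pullback of the round metric of radius 2 under a map of the sphere to itself. -/
def pullMet (Θ : S2 → S2) (x : S2) : Matrix (Fin 3) (Fin 3) ℝ := Matrix.of fun i j =>
  4 * ∑ k : Fin 3, pd (fun y => (Θ y : E3)) x i k * pd (fun y => (Θ y : E3)) x j k

/-- `X` is the linearisation of the metric of the round sphere of radius 2 under sphere
diffeomorphisms generated by the vector field `-D₁^*(q₁, q₂)` (with index raised by the round unit
metric). The other sphere data are constant functions and vanishing tensors and do not change. -/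
def IsAngularLin (q₁ q₂ : Tens 0) (X : LinSphereData) : Prop :=
  ∀ Θ : ℝ → S2 → S2, SmoothFamily (fun ε x => (Θ ε x : E3)) → (∀ x, Θ 0 x = x) →
    (∀ x (i : Fin 3), HasDerivAt (fun ε => (Θ ε x : E3) i)
      (-(D1star q₁ q₂ : Field 1) x ![i]) 0) →
    LinearisesTo (fun ε x _ => conf x (pullMet (Θ ε) x)) X.phi ∧
    LinearisesToS (fun ε => ofMat fun x =>
      (conf x (pullMet (Θ ε) x) ^ 2)⁻¹ • pullMet (Θ ε) x) X.gc

end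

end NullGluing

open NullGluing

/-!
The sphere is treated in the ambient space: a function is extended to `ℝ³ ∖ {0}` so as to be
constant along rays, and the covariant derivative is the tangential part of the ambient one. The
operators then become expressions in the commuting-up-to-a-normal-term derivatives `pd`
(`pd_comm`), and two facts drive all computations. One is the divergence theorem (`integral_pd`),
obtained by integrating over `ℝ³` in polar coordinates; it makes `-div`, `D₁^*` and `D₂^*` adjoint
to `∇`, `(div, curl)` and `D₂`, so that the distributional operators extend the smooth ones. The
other is the identity `D₂ D₂^* V = -½ (Δ + 2) V` in ambient components, up to a normal term
(`comp1_D2_D2star`), which on gradients and their duals reads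
`D₂ D₂^* df = -½ d (Δ + 2) f`.

*Harmonics.* The functions `Y l m` are eigenfunctions of the Laplacian by Legendre's equation, hence
orthogonal for different `l`. For different `m` they are orthogonal because the rotation about the
axis is antisymmetric and maps `Y l m` to `m Y l (-m)`; their norms follow from a recursion in the
order of the associated Legendre functions. Orthonormality of the vector and tensor harmonics is
inherited through the adjointness relations, with `D₂ D₂^*` equal to `μ = ½ l (l + 1) - 1` on degree
`l`.

*The charge with `l = 2`.* It vanishes on `linPert` since the linearised perturbations have
`α_ = 0` and `D_ α_ = 0`. It takes values in the span of the ten orthonormal modes, and all of them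
are attained by prescribing `D_ α_` (`range_chargeDbalbTwo`). The nonlinear expressions `U` and `V`
are linear in `(α_, D_ α_)`, so that along the given curve they are `ε` times a quantity which
depends continuously on the metric; the derivative is the value of that quantity at the round
metric, where the conformal factor is `2` and `∇ ⊗̂ div` is `-½ D₂^* div`
(`hasDerivAt_coeff_fieldUV`).

*Matching.* On `linPert` the charge of `D_ α_` with `l ≥ 3` is `D₂^* D₁^* (∂_u³ f, 0)` and the one
of `D_² ω_` is `½ (∂_u⁴ f)^{[≤ 1]}`. So `∂_u⁴ f = 2 Q₁`, while mode by mode `∂_u³ f` is the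
coefficient of `Q₂` divided by `√(μ λ)`, `λ = l (l + 1)`. For the estimate, the fourth Sobolev norm
of a series of harmonics is bounded by the coefficients weighted with `(1 + λ)⁴`: derivatives along
rotations commute with the Laplacian, and all covariant derivatives are combinations of them
(`sobolevSq_le_of_modes`). In the other direction, the second covariant derivatives of `Q₂`, tested
against `Ψ ⊗ γ`, give `-D₂^* D₂ Q₂`, so that Bessel's inequality bounds the coefficients
weighted with `μ²` (`sum_mu_sq_le`). As `μ` and `λ` are comparable for `l ≥ 3`, the weights agree.

*The linearised perturbations.* Derivatives in the parameter commute with those along the sphere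
(`hasDerivAt_fderiv_swap`). The pulled back round metrics have as derivative the Lie derivative,
whose trace and tracefree part are the stated components. For transversal perturbations the induced
metric is exactly `r² γ`, with `r = 2 - ε f₀`, all curvature components vanish because Minkowski
space is flat, and the remaining quantities are explicit in `f₀`, `∂_u f` and `∇ f₀`.
-/

namespace NullGluing

noncomputable section

/-! ### Derivatives and integrals of functions on the sphere -/

lemma Smooth.add {F : Type*} [NormedAddCommGroup F] [NormedSpace ℝ F] {g h : S2 → F}
    (hg : Smooth g) (hh : Smooth h) : Smooth (fun x => g x + h x) :=
  ContDiffOn.add hg hh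

lemma Smooth.sub {F : Type*} [NormedAddCommGroup F] [NormedSpace ℝ F] {g h : S2 → F}
    (hg : Smooth g) (hh : Smooth h) : Smooth (fun x => g x - h x) :=
  ContDiffOn.sub hg hh

lemma Smooth.neg {F : Type*} [NormedAddCommGroup F] [NormedSpace ℝ F] {g : S2 → F}
    (hg : Smooth g) : Smooth (fun x => -g x) :=
  ContDiffOn.neg hg

lemma Smooth.mul {g h : S2 → ℝ} (hg : Smooth g) (hh : Smooth h) : Smooth (fun x => g x * h x) :=
  ContDiffOn.mul hg hh

lemma Smooth.const (c : ℝ) : Smooth (fun _ => c) := contDiffOn_const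

lemma Smooth.sum {ι : Type*} {s : Finset ι} {g : ι → S2 → ℝ} (hg : ∀ i ∈ s, Smooth (g i)) :
    Smooth (fun x => ∑ i ∈ s, g i x) :=
  ContDiffOn.sum hg

lemma Smooth.prod {ι : Type*} {s : Finset ι} {g : ι → S2 → ℝ} (hg : ∀ i ∈ s, Smooth (g i)) :
    Smooth (fun x => ∏ i ∈ s, g i x) :=
  contDiffOn_prod hg

lemma Smooth.integrable {h : S2 → ℝ} (hh : Smooth h) : Integrable h surf :=
  hh.continuous.integrable_of_hasCompactSupport (HasCompactSupport.of_compactSpace _)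

lemma pd_const (c : ℝ) (x : S2) (i : Fin 3) : pd (fun _ => c) x i = 0 := by
  simp [pd]

lemma pd_add {g h : S2 → ℝ} (hg : Smooth g) (hh : Smooth h) (x : S2) (i : Fin 3) :
    pd (fun y => g y + h y) x i = pd g x i + pd h x i := by
  unfold pd
  rw [fderiv_fun_add (hg.differentiableAt x) (hh.differentiableAt x)]
  rfl

lemma pd_neg (g : S2 → ℝ) (x : S2) (i : Fin 3) :
    pd (fun y => -g y) x i = -pd g x i := by
  unfold pd
  rw [fderiv_fun_neg]
  rfl

lemma pd_sub {g h : S2 → ℝ} (hg : Smooth g) (hh : Smooth h) (x : S2) (i : Fin 3) :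
    pd (fun y => g y - h y) x i = pd g x i - pd h x i := by
  simp only [sub_eq_add_neg]
  rw [pd_add hg hh.neg, pd_neg]

lemma pd_mul {g h : S2 → ℝ} (hg : Smooth g) (hh : Smooth h) (x : S2) (i : Fin 3) :
    pd (fun y => g y * h y) x i = pd g x i * h x + g x * pd h x i := by
  unfold pd
  rw [fderiv_fun_mul (hg.differentiableAt x) (hh.differentiableAt x)]
  simp [dir_self]
  ring

lemma pd_const_mul (c : ℝ) {h : S2 → ℝ} (hh : Smooth h) (x : S2) (i : Fin 3) :
    pd (fun y => c * h y) x i = c * pd h x i := by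
  rw [pd_mul (Smooth.const c) hh, pd_const]
  ring

lemma pd_sum {ι : Type*} {s : Finset ι} {g : ι → S2 → ℝ} (hg : ∀ j ∈ s, Smooth (g j)) (x : S2)
    (i : Fin 3) : pd (fun y => ∑ j ∈ s, g j y) x i = ∑ j ∈ s, pd (g j) x i := by
  unfold pd
  rw [fderiv_fun_sum fun j hj => (hg j hj).differentiableAt x]
  simp

lemma Smooth.pd_comp {h : S2 → ℝ} (hh : Smooth h) (i : Fin 3) :
    Smooth (fun x => NullGluing.pd h x i) :=
  hh.pd i

/-- The derivative of a function which is constant along rays is homogeneous of degree `-1`. -/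
lemma fderiv_comp_dir {h : S2 → ℝ} (hh : Smooth h) {y : E3} (hy : y ≠ 0) (i : Fin 3) :
    fderiv ℝ (fun y : E3 => h (dir y)) y (EuclideanSpace.single i 1) = ‖y‖⁻¹ * pd h (dir y) i := by
  have hn : 0 < ‖y‖ := norm_pos_iff.2 hy
  have h1 : (fun z : E3 => h (dir z)) =ᶠ[𝓝 y] fun z => h (dir (‖y‖⁻¹ • z)) := by
    filter_upwards [isOpen_compl_singleton.mem_nhds hy] with z hz
    congr 1
    apply Subtype.ext
    have hz' : z ≠ 0 := hz
    rw [dir_coe hz', dir_coe (smul_ne_zero (inv_ne_zero hn.ne') hz'), norm_smul, smul_smul]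
    congr 1
    rw [norm_inv, norm_norm, mul_inv, inv_inv, mul_assoc, mul_comm ‖z‖⁻¹, ← mul_assoc,
      mul_inv_cancel₀ hn.ne', one_mul]
  rw [h1.fderiv_eq]
  have h2 := (hh.differentiableAt (dir y)).hasFDerivAt
  rw [dir_coe hy] at h2
  have h3 : HasFDerivAt (fun z : E3 => ‖y‖⁻¹ • z) (‖y‖⁻¹ • ContinuousLinearMap.id ℝ E3) y :=
    HasFDerivAt.fun_const_smul (hasFDerivAt_id y) _
  have h4 := h2.comp y h3
  have h5 : fderiv ℝ (fun z : E3 => h (dir (‖y‖⁻¹ • z))) y = _ := h4.fderiv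
  rw [h5]
  simp [pd, dir_coe hy]

/-- The partial derivative at `x` of a function agreeing on the sphere with an ambient function. -/
lemma pd_restrict {G : E3 → ℝ} (x : S2) (hG : DifferentiableAt ℝ G x) (i : Fin 3) :
    pd (fun y : S2 => G y) x i = ∑ k, proj x i k * fderiv ℝ G x (EuclideanSpace.single k 1) := by
  have hx := S2.ne_zero x
  have hdir : HasFDerivAt (fun y : E3 => (dir y : E3))
      (fderiv ℝ (fun y : E3 => (dir y : E3)) x) x :=
    ((contDiffOn_dir.contDiffAt (isOpen_compl_singleton.mem_nhds hx)).differentiableAt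
      (by simp)).hasFDerivAt
  have key : fderiv ℝ (fun y : E3 => (dir y : E3)) x (EuclideanSpace.single i 1)
      = ∑ k, proj x i k • EuclideanSpace.single k (1 : ℝ) := by
    have h1 : (fun y : E3 => (dir y : E3)) =ᶠ[𝓝 (x : E3)] fun y => ‖y‖⁻¹ • y := by
      filter_upwards [isOpen_compl_singleton.mem_nhds hx] with z hz
      exact dir_coe hz
    rw [h1.fderiv_eq]
    have hn : HasFDerivAt (fun y : E3 => ‖y‖) (innerSL ℝ (x : E3)) (x : E3) := by
      have h2 := (hasStrictFDerivAt_norm_sq (x : E3)).hasFDerivAt.sqrt (by simp)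
      have h3 : (fun y : E3 => √(‖y‖ ^ 2)) = fun y => ‖y‖ := by
        ext y; exact Real.sqrt_sq (norm_nonneg y)
      rw [h3] at h2
      exact h2.congr_fderiv (by ext v; simp)
    have hn' : HasFDerivAt (fun y : E3 => ‖y‖⁻¹) (-(innerSL ℝ (x : E3))) (x : E3) := by
      have := (hasDerivAt_inv (x := ‖(x : E3)‖) (by simp)).comp_hasFDerivAt (x : E3) hn
      exact this.congr_fderiv (by ext v; simp)
    have h4 := (hn'.smul (hasFDerivAt_id (x : E3))).fderiv
    have h5 : fderiv ℝ (fun y : E3 => ‖y‖⁻¹ • y) (x : E3) = _ := h4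
    rw [h5]
    ext j
    simp [proj, EuclideanSpace.inner_single_right, Pi.single_apply, Finset.sum_apply,
      eq_comm]
    ring
  unfold pd
  have h6 : HasFDerivAt G (fderiv ℝ G x) (dir (x : E3) : E3) := by
    rw [dir_self]; exact hG.hasFDerivAt
  have h7 : fderiv ℝ (fun y : E3 => G (dir y)) x = _ := (h6.comp (x : E3) hdir).fderiv
  rw [h7]
  simp [key]

lemma pd_coord (x : S2) (i j : Fin 3) : pd (fun y : S2 => (y : E3) j) x i = proj x i j := by
  rw [pd_restrict (G := fun y : E3 => y j) x (by fun_prop)]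
  have : ∀ v : E3, fderiv ℝ (fun y : E3 => y j) (x : E3) v = v j := by
    intro v
    have h := (EuclideanSpace.proj (𝕜 := ℝ) (ι := Fin 3) j : E3 →L[ℝ] ℝ).fderiv (x := (x : E3))
    exact congrArg (fun L : E3 →L[ℝ] ℝ => L v) h
  simp [this]

/-- Iterated tangential derivatives in terms of second derivatives in the ambient space; the latter
are symmetric. -/
lemma pd_pd {h : S2 → ℝ} (hh : Smooth h) (x : S2) (i j : Fin 3) :
    pd (fun y => pd h y j) x i = (x : E3) i * pd h x j +
      fderiv ℝ (fun z => fderiv ℝ (fun y : E3 => h (dir y)) z (EuclideanSpace.single j 1)) x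
        (EuclideanSpace.single i 1) := by
  have hx := S2.ne_zero x
  set H : E3 → ℝ := fun z => fderiv ℝ (fun y : E3 => h (dir y)) z (EuclideanSpace.single j 1)
  have hH : ContDiffAt ℝ ∞ H x := by
    have h1 : ContDiffOn ℝ ∞ (fderiv ℝ (fun y : E3 => h (dir y))) {0}ᶜ :=
      hh.fderiv_of_isOpen isOpen_compl_singleton (by simp)
    exact (h1.clm_apply contDiffOn_const).contDiffAt (isOpen_compl_singleton.mem_nhds hx)
  have hHd := hH.differentiableAt (by simp)
  have h2 : pd (fun y => pd h y j) x i = pd (fun y : S2 => H y) x i := rfl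
  rw [h2, pd_restrict x hHd]
  have h3 : ∑ k, (x : E3) k * fderiv ℝ H x (EuclideanSpace.single k 1) = -pd h x j := by
    -- Euler's relation for the homogeneous function `H`
    have h4 : HasDerivAt (fun t : ℝ => H (t • (x : E3))) (fderiv ℝ H x (x : E3)) 1 := by
      have h5 : HasDerivAt (fun t : ℝ => t • (x : E3)) (x : E3) 1 := by
        simpa using (hasDerivAt_id (1 : ℝ)).smul_const (x : E3)
      have h6 : HasFDerivAt H (fderiv ℝ H x) ((1 : ℝ) • (x : E3)) := by
        rw [one_smul]; exact hHd.hasFDerivAt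
      exact h6.comp_hasDerivAt (1 : ℝ) h5
    have h7 : HasDerivAt (fun t : ℝ => H (t • (x : E3))) (-pd h x j) 1 := by
      have h8 : HasDerivAt (fun t : ℝ => t⁻¹ * pd h x j) (-pd h x j) 1 := by
        simpa using (hasDerivAt_inv (one_ne_zero (α := ℝ))).mul_const (pd h x j)
      refine h8.congr_of_eventuallyEq ?_
      filter_upwards [lt_mem_nhds (zero_lt_one (α := ℝ))] with t ht
      have := fderiv_comp_dir hh (smul_ne_zero ht.ne' hx) j
      rw [dir_smul x ht, norm_smul, S2.norm_eq, Real.norm_eq_abs, abs_of_pos ht, mul_one] at this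
      exact this
    rw [h7.unique h4]
    conv_rhs => rw [show (x : E3) = ∑ k, (x : E3) k • EuclideanSpace.single k (1 : ℝ) by
      ext j; simp [Finset.sum_apply, Pi.single_apply]]
    conv_rhs => rw [map_sum, ← show (x : E3) = ∑ k, (x : E3) k • EuclideanSpace.single k (1 : ℝ) by
      ext j; simp [Finset.sum_apply, Pi.single_apply]]
    simp
  have h9 : ∀ k, proj x i k * fderiv ℝ H x (EuclideanSpace.single k 1)
      = (if i = k then 1 else 0) * fderiv ℝ H x (EuclideanSpace.single k 1)
        - (x : E3) i * ((x : E3) k * fderiv ℝ H x (EuclideanSpace.single k 1)) := by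
    intro k; simp only [proj]; ring
  simp only [h9, Finset.sum_sub_distrib, ← Finset.mul_sum, h3]
  simp
  ring

/-- The commutator of the tangential parts of the ambient derivatives. -/
lemma pd_comm {h : S2 → ℝ} (hh : Smooth h) (x : S2) (i j : Fin 3) :
    pd (fun y => pd h y j) x i - pd (fun y => pd h y i) x j
      = (x : E3) i * pd h x j - (x : E3) j * pd h x i := by
  rw [pd_pd hh, pd_pd hh]
  have hx := S2.ne_zero x
  have hc : ContDiffAt ℝ ∞ (fun y : E3 => h (dir y)) x :=
    ContDiffOn.contDiffAt hh (isOpen_compl_singleton.mem_nhds hx)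
  have hsym := hc.isSymmSndFDerivAt (by
    rw [minSmoothness_of_isRCLikeNormedField]; exact WithTop.coe_le_coe.2 (le_top (a := (2 : ℕ∞))))
  have hd : DifferentiableAt ℝ (fderiv ℝ (fun y : E3 => h (dir y))) x := by
    have h1 : ContDiffOn ℝ ∞ (fderiv ℝ (fun y : E3 => h (dir y))) {0}ᶜ :=
      ContDiffOn.fderiv_of_isOpen hh isOpen_compl_singleton (by simp)
    exact (h1.contDiffAt (isOpen_compl_singleton.mem_nhds hx)).differentiableAt (by simp)
  have e : ∀ v w : E3, fderiv ℝ (fun z => fderiv ℝ (fun y : E3 => h (dir y)) z v) x w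
      = fderiv ℝ (fderiv ℝ (fun y : E3 => h (dir y))) x w v := by
    intro v w
    rw [fderiv_clm_apply hd (differentiableAt_const v)]
    simp
  rw [e, e, hsym.eq]
  ring

/-- Integration in polar coordinates. -/
lemma integral_polar (φ : ℝ → ℝ) (g : S2 → ℝ) :
    ∫ y : E3, φ ‖y‖ * g (dir y) = (∫ r : Set.Ioi (0 : ℝ), φ r ∂(Measure.volumeIoiPow 2)) *
      ∫ x, g x ∂surf := by
  have h1 : ∫ y : E3, φ ‖y‖ * g (dir y)
      = ∫ y : ({(0 : E3)}ᶜ : Set E3), φ ‖y.1‖ * g (dir y.1) ∂((volume : Measure E3).comap (↑)) := by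
    rw [integral_subtype_comap (measurableSet_singleton _).compl fun y : E3 => φ ‖y‖ * g (dir y),
      restrict_compl_singleton]
  have hd : Module.finrank ℝ E3 - 1 = 2 := by simp
  have h2 := (volume : Measure E3).measurePreserving_homeomorphUnitSphereProd.integral_comp
    (Homeomorph.measurableEmbedding _) (fun p : S2 × Set.Ioi (0 : ℝ) => g p.1 * φ p.2)
  rw [hd, integral_prod_mul (fun x => g x) (fun r : Set.Ioi (0 : ℝ) => φ r)] at h2
  rw [h1, mul_comm, surf, ← h2]
  refine integral_congr_ae (Eventually.of_forall fun y => ?_)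
  have : dir y.1 = (homeomorphUnitSphereProd E3 y).1 := by
    apply Subtype.ext
    rw [dir_coe y.2]
    simp [homeomorphUnitSphereProd]
  simp [this, mul_comm]

lemma surf_univ : surf.real Set.univ = 4 * Real.pi := by
  unfold surf
  rw [Measure.toSphere_real_apply_univ, Measure.real, EuclideanSpace.volume_ball_fin_three]
  have h := Real.pi_pos
  simp [ENNReal.toReal_ofReal (by positivity : 0 ≤ Real.pi * 4 / 3)]
  ring

lemma integral_const_surf (c : ℝ) : ∫ _ : S2, c ∂surf = 4 * Real.pi * c := by
  rw [integral_const, surf_univ, smul_eq_mul]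

lemma continuous_radial_mul {φ : ℝ → ℝ} (hφ : ContinuousOn φ (Set.Ioi 0))
    (h1 : ∀ r < 1, φ r = 0) {g : S2 → ℝ} (hg : Smooth g) :
    Continuous (fun y : E3 => φ ‖y‖ * g (dir y)) := by
  rw [continuous_iff_continuousAt]
  intro y
  by_cases hy : y = 0
  · have h3 : IsOpen {z : E3 | ‖z‖ < 1} := isOpen_lt continuous_norm continuous_const
    refine (continuousAt_const (y := (0 : ℝ))).congr ?_
    filter_upwards [h3.mem_nhds (show ‖y‖ < 1 by simp [hy])] with z hz
    simp [h1 _ hz]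
  · refine ContinuousAt.mul ?_ ?_
    · exact ContinuousAt.comp (f := fun y : E3 => ‖y‖)
        (hφ.continuousAt (Ioi_mem_nhds (norm_pos_iff.2 hy))) continuous_norm.continuousAt
    · exact (hg.continuousOn).continuousAt (isOpen_compl_singleton.mem_nhds hy)

lemma hasCompactSupport_radial_mul {φ : ℝ → ℝ} (h2 : ∀ r, 2 < r → φ r = 0) (g : S2 → ℝ) :
    HasCompactSupport (fun y : E3 => φ ‖y‖ * g (dir y)) := by
  refine HasCompactSupport.intro (isCompact_closedBall (0 : E3) 2) fun y hy => ?_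
  simp [h2 _ (show 2 < ‖y‖ by simpa using hy)]

/-- For a radial cut-off `b`, the integral over `ℝ³` of a partial derivative of `b(|y|) h(y/|y|)`
vanishes; in polar coordinates this is a linear relation between `∫ x_i h` and `∫ pd h x i`, with
coefficients depending on `b` only. -/
lemma radial_relation (b : ContDiffBump (3 / 2 : ℝ)) (hb : b.rOut ≤ 1 / 2) {h : S2 → ℝ}
    (hh : Smooth h) (i : Fin 3) :
    (∫ r : Set.Ioi (0 : ℝ), deriv b r ∂(Measure.volumeIoiPow 2)) * ∫ x, (x : E3) i * h x ∂surf
      + (∫ r : Set.Ioi (0 : ℝ), b r * (r : ℝ)⁻¹ ∂(Measure.volumeIoiPow 2)) * ∫ x, pd h x i ∂surf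
      = 0 := by
  rw [← integral_polar (fun r => deriv b r), ← integral_polar (fun r => b r * r⁻¹)]
  have hb0 : ∀ r : ℝ, r < 1 → b r = 0 := by
    intro r hr
    refine b.zero_of_le_dist (hb.trans ?_)
    rw [Real.dist_eq, abs_sub_comm, abs_of_nonneg] <;> linarith
  have hb2 : ∀ r : ℝ, 2 < r → b r = 0 := by
    intro r hr
    refine b.zero_of_le_dist (hb.trans ?_)
    rw [Real.dist_eq, abs_of_nonneg] <;> linarith
  set F : E3 → ℝ := fun y => b ‖y‖ * h (dir y)
  have hbs : ContDiff ℝ ∞ b := b.contDiff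
  have hF1 : ∀ y : E3, ‖y‖ < 1 → F =ᶠ[𝓝 y] fun _ => 0 := by
    intro y hy
    have : IsOpen {z : E3 | ‖z‖ < 1} := isOpen_lt continuous_norm continuous_const
    filter_upwards [this.mem_nhds hy] with z hz
    simp [F, hb0 _ hz]
  have hF : ContDiff ℝ ∞ F := by
    rw [contDiff_iff_contDiffAt]
    intro y
    by_cases hy : y = 0
    · exact contDiffAt_const.congr_of_eventuallyEq (hF1 y (by simp [hy]))
    · exact (hbs.contDiffAt.comp y (contDiffAt_norm ℝ hy)).mul
        (ContDiffOn.contDiffAt hh (isOpen_compl_singleton.mem_nhds hy))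
  have hFc : HasCompactSupport F := by
    refine HasCompactSupport.intro (isCompact_closedBall (0 : E3) 2) fun y hy => ?_
    have : 2 < ‖y‖ := by simpa using hy
    simp [F, hb2 _ this]
  -- the product rule; near the origin both sides vanish
  have hd : ∀ y : E3, fderiv ℝ F y (EuclideanSpace.single i 1)
      = deriv b ‖y‖ * ((dir y : E3) i * h (dir y)) + b ‖y‖ * ‖y‖⁻¹ * pd h (dir y) i := by
    intro y
    by_cases hy : y = 0
    · have h1 : deriv b ‖y‖ = 0 := by
        have : (b : ℝ → ℝ) =ᶠ[𝓝 ‖y‖] fun _ => 0 := by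
          filter_upwards [(isOpen_gt' (1 : ℝ)).mem_nhds (show ‖y‖ < 1 by simp [hy])] with r hr
          exact hb0 r hr
        rw [this.deriv_eq, deriv_const]
      rw [(hF1 y (by simp [hy])).fderiv_eq, h1, hb0 _ (by simp [hy])]
      simp
    · have hn : HasFDerivAt (fun y : E3 => ‖y‖) (‖y‖⁻¹ • innerSL ℝ y) y := by
        have h2 := (hasStrictFDerivAt_norm_sq y).hasFDerivAt.sqrt (by simpa using hy)
        have h3 : (fun y : E3 => √(‖y‖ ^ 2)) = fun y => ‖y‖ := by
          ext y; exact Real.sqrt_sq (norm_nonneg y)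
        rw [h3] at h2
        exact h2.congr_fderiv (by ext v; simp; ring)
      have h4 : HasFDerivAt (fun y : E3 => b ‖y‖) (deriv b ‖y‖ • (‖y‖⁻¹ • innerSL ℝ y)) y :=
        ((hbs.differentiable (by simp) ‖y‖).hasDerivAt).comp_hasFDerivAt y hn
      have h5 := (ContDiffOn.contDiffAt hh (isOpen_compl_singleton.mem_nhds hy)).differentiableAt
        (by simp)
      have h6 : fderiv ℝ F y = _ := (h4.mul h5.hasFDerivAt).fderiv
      rw [h6]
      simp [fderiv_comp_dir hh hy, dir_coe hy, EuclideanSpace.inner_single_right]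
      ring
  have hint : Integrable F := hF.continuous.integrable_of_hasCompactSupport hFc
  have hFd : Continuous (fun y => fderiv ℝ F y (EuclideanSpace.single i 1)) :=
    (hF.continuous_fderiv (by simp)).clm_apply continuous_const
  have hintd : Integrable (fun y => fderiv ℝ F y (EuclideanSpace.single i 1)) :=
    hFd.integrable_of_hasCompactSupport (hFc.fderiv_apply (𝕜 := ℝ) _)
  -- integration by parts against the constant function `1`
  have hzero : ∫ y, fderiv ℝ F y (EuclideanSpace.single i 1) = 0 := by
    have := integral_mul_fderiv_eq_neg_fderiv_mul_of_integrable (μ := (volume : Measure E3))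
      (f := fun _ => (1 : ℝ)) (g := F) (v := EuclideanSpace.single i 1) (by simp)
      (by simpa using hintd) (by simpa using hint) (fun _ _ => differentiableAt_const _)
      (fun y _ => hF.differentiable (by simp) y)
    simpa using this
  have hcd : Continuous (deriv b) := hbs.continuous_deriv (by simp)
  have hi1 : Integrable (fun y : E3 => deriv b ‖y‖ * ((dir y : E3) i * h (dir y))) := by
    have e1 : ∀ r < (1 : ℝ), deriv b r = 0 := fun r hr => by
      have : (b : ℝ → ℝ) =ᶠ[𝓝 r] fun _ => 0 := by
        filter_upwards [(isOpen_gt' (1 : ℝ)).mem_nhds hr] with r hr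
        exact hb0 r hr
      rw [this.deriv_eq, deriv_const]
    have e2 : ∀ r, (2 : ℝ) < r → deriv b r = 0 := fun r hr => by
      have : (b : ℝ → ℝ) =ᶠ[𝓝 r] fun _ => 0 := by
        filter_upwards [(isOpen_lt' (2 : ℝ)).mem_nhds hr] with r hr
        exact hb2 r hr
      rw [this.deriv_eq, deriv_const]
    exact (continuous_radial_mul hcd.continuousOn e1
      ((Smooth.coord i).mul hh)).integrable_of_hasCompactSupport
        (hasCompactSupport_radial_mul e2 (fun x : S2 => (x : E3) i * h x))
  have hi2 : Integrable (fun y : E3 => b ‖y‖ * ‖y‖⁻¹ * pd h (dir y) i) := by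
    have := hintd.sub hi1
    refine this.congr (Eventually.of_forall fun y => ?_)
    simp [hd]
  rw [← integral_add hi1 hi2, ← hzero]
  simp only [hd]

/-- The divergence theorem on the sphere, for the tangential part of a constant vector times a
function. -/
lemma integral_pd {h : S2 → ℝ} (hh : Smooth h) (i : Fin 3) :
    ∫ x, pd h x i ∂surf = 2 * ∫ x, (x : E3) i * h x ∂surf := by
  obtain ⟨b, hb⟩ : ∃ b : ContDiffBump (3 / 2 : ℝ), b.rOut = 1 / 2 :=
    ⟨⟨1 / 4, 1 / 2, by norm_num, by norm_num⟩, rfl⟩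
  set A := ∫ r : Set.Ioi (0 : ℝ), deriv b r ∂(Measure.volumeIoiPow 2)
  set B := ∫ r : Set.Ioi (0 : ℝ), b r * (r : ℝ)⁻¹ ∂(Measure.volumeIoiPow 2)
  have hrel : ∀ {h : S2 → ℝ} (_ : Smooth h) (i : Fin 3), A * ∫ x, (x : E3) i * h x ∂surf
      + B * ∫ x, pd h x i ∂surf = 0 := fun hh i => radial_relation b hb.le hh i
  -- the constants are compared by inserting the coordinate functions, for which
  -- `∑ x_i x_i = 1` and `∑ pd x_i = 2`
  have hAB : A + 2 * B = 0 := by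
    have h1 : ∑ i : Fin 3, (A * ∫ x : S2, (x : E3) i * (x : E3) i ∂surf
        + B * ∫ x : S2, pd (fun y : S2 => (y : E3) i) x i ∂surf) = 0 :=
      Finset.sum_eq_zero fun i _ => hrel (Smooth.coord i) i
    rw [Finset.sum_add_distrib, ← Finset.mul_sum, ← Finset.mul_sum,
      ← integral_finsetSum _ fun i _ => ((Smooth.coord i).mul (Smooth.coord i)).integrable,
      ← integral_finsetSum _ fun i _ => ((Smooth.coord i).pd_comp i).integrable] at h1
    simp only [sum_mul_self, pd_coord, sum_proj_self, integral_const_surf] at h1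
    have := Real.pi_pos
    have h2 : 4 * Real.pi * (A + 2 * B) = 0 := by linarith
    exact (mul_eq_zero.1 h2).resolve_left (by positivity)
  -- the integrand is positive at radius `3 / 2`, where the cut-off is `1`
  have hB : 0 < B := by
    have hb0 : ∀ r : ℝ, r < 1 → b r * r⁻¹ = 0 := by
      intro r hr
      rw [b.zero_of_le_dist, zero_mul]
      rw [Real.dist_eq, abs_sub_comm, abs_of_nonneg] <;> linarith
    have hb2 : ∀ r : ℝ, 2 < r → b r * r⁻¹ = 0 := by
      intro r hr
      rw [b.zero_of_le_dist, zero_mul]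
      rw [Real.dist_eq, abs_of_nonneg] <;> linarith
    have hc : ContinuousOn (fun r : ℝ => b r * r⁻¹) (Set.Ioi 0) :=
      (b.continuous.continuousOn).mul (continuousOn_inv₀.mono fun r hr => (ne_of_gt hr))
    have h1 := integral_polar (fun r => b r * r⁻¹) (fun _ => 1)
    rw [integral_const_surf] at h1
    have h2 : 0 < ∫ y : E3, b ‖y‖ * ‖y‖⁻¹ * (1 : ℝ) := by
      refine (continuous_radial_mul hc hb0 (Smooth.const 1)
        ).integral_pos_of_hasCompactSupport_nonneg_nonzero
        (hasCompactSupport_radial_mul hb2 fun _ => (1 : ℝ)) (fun y => ?_)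
        (x := EuclideanSpace.single 0 (3 / 2 : ℝ)) ?_
      · have := b.nonneg (x := ‖y‖)
        positivity
      · have h3 : ‖(EuclideanSpace.single 0 (3 / 2 : ℝ) : E3)‖ = 3 / 2 := by
          rw [PiLp.norm_single]; norm_num
        rw [h3, b.one_of_mem_closedBall (by simpa using b.rIn_pos.le)]
        norm_num
    rw [h1] at h2
    have := Real.pi_pos
    exact pos_of_mul_pos_left h2 (by positivity)
  have h3 := hrel hh i
  have h4 : B * (∫ x, pd h x i ∂surf - 2 * ∫ x, (x : E3) i * h x ∂surf) = 0 := by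
    linear_combination h3 - (∫ x, (x : E3) i * h x ∂surf) * hAB
  have := (mul_eq_zero.1 h4).resolve_left hB.ne'
  linarith

/-! ### Integration by parts for tensor fields -/

lemma sum_fin_cons {M : Type*} [AddCommMonoid M] {k : ℕ} (F : (Fin (k + 1) → Fin 3) → M) :
    ∑ a, F a = ∑ i, ∑ b : Fin k → Fin 3, F (Fin.cons i b) := by
  rw [← (Fin.consEquiv fun _ : Fin (k + 1) => Fin 3).sum_comp, Fintype.sum_prod_type]
  rfl

lemma sum_proj_mul (x : S2) (i : Fin 3) (t : Fin 3 → ℝ) (ht : ∑ j, (x : E3) j * t j = 0) :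
    ∑ j, proj x j i * t j = t i := by
  have h : ∀ j, proj x j i * t j = (if j = i then 1 else 0) * t j
      - (x : E3) i * ((x : E3) j * t j) := fun j => by simp only [proj]; ring
  simp only [h, Finset.sum_sub_distrib, ← Finset.mul_sum, ht]
  simp

/-- The projection to the tangent plane fixes the components of a tangential tensor. -/
lemma sum_prod_proj_mul (x : S2) : ∀ {k : ℕ} (t : (Fin k → Fin 3) → ℝ)
    (_ : ∀ a j, ∑ i, (x : E3) i * t (Function.update a j i) = 0) (c : Fin k → Fin 3),
    ∑ b, (∏ j, proj x (b j) (c j)) * t b = t c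
  | 0, t, _, c => by
    simpa using congrArg t (Subsingleton.elim _ _)
  | k + 1, t, ht, c => by
    have h0 : ∀ b : Fin k → Fin 3, ∑ i, (x : E3) i * t (Fin.cons i b) = 0 := fun b => by
      simpa using ht (Fin.cons 0 b) 0
    rw [sum_fin_cons]
    have h1 : ∀ i, ∑ b : Fin k → Fin 3, (∏ j, proj x ((Fin.cons i b : Fin (k + 1) → Fin 3) j) (c j))
        * t (Fin.cons i b) = proj x i (c 0) * t (Fin.cons i (Fin.tail c)) := by
      intro i
      rw [← sum_prod_proj_mul x (fun b => t (Fin.cons i b)) (fun b j => by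
        simpa only [Fin.cons_update] using ht (Fin.cons i b) j.succ) (Fin.tail c), Finset.mul_sum]
      refine Finset.sum_congr rfl fun b _ => ?_
      rw [Fin.prod_univ_succ]
      simp [Fin.tail, mul_assoc]
    rw [Finset.sum_congr rfl fun i _ => h1 i, sum_proj_mul x (c 0) _ (h0 _), Fin.cons_self_tail]

lemma Tens.tangential_cons {k : ℕ} (T : Tens (k + 1)) (x : S2) (b : Fin k → Fin 3) :
    ∑ i, (x : E3) i * (T : Field (k + 1)) x (Fin.cons i b) = 0 := by
  simpa using T.2.2 x (Fin.cons 0 b) 0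

lemma Tens.tangential_tail {k : ℕ} (T : Tens (k + 1)) (x : S2) (i : Fin 3) (b : Fin k → Fin 3)
    (j : Fin k) :
    ∑ l, (x : E3) l * (T : Field (k + 1)) x (Fin.cons i (Function.update b j l)) = 0 := by
  simpa only [Fin.cons_update] using T.2.2 x (Fin.cons i b) j.succ

lemma sum_mul_pd' {h : S2 → ℝ} (hh : Smooth h) (x : S2) : ∑ i, (x : E3) i * pd h x i = 0 := by
  simpa using sum_mul_pd hh x

lemma covF_cons {k : ℕ} (T : Tens k) (x : S2) (i : Fin 3) (b : Fin k → Fin 3) :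
    covF (T : Field k) x (Fin.cons i b)
      = ∑ c, (∏ j, proj x (b j) (c j)) * pd (fun y => (T : Field k) y c) x i := by
  simp only [covF, Fin.cons_zero, Fin.cons_succ, pd_apply T.2.1]

lemma sum_cov_mul {k : ℕ} (S : Tens k) (T : Tens (k + 1)) (x : S2) :
    ∑ a, (cov k S : Field (k + 1)) x a * (T : Field (k + 1)) x a
      = ∑ i, ∑ b, pd (fun y => (S : Field k) y b) x i * (T : Field (k + 1)) x (Fin.cons i b) := by
  rw [sum_fin_cons]
  refine Finset.sum_congr rfl fun i _ => ?_
  change ∑ b, covF (S : Field k) x (Fin.cons i b) * _ = _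
  simp only [covF_cons, Finset.sum_mul]
  rw [Finset.sum_comm]
  refine Finset.sum_congr rfl fun c _ => ?_
  rw [← sum_prod_proj_mul x (fun b => (T : Field (k + 1)) x (Fin.cons i b))
    (fun b j => Tens.tangential_tail T x i b j) c, Finset.mul_sum]
  exact Finset.sum_congr rfl fun b _ => by ring

lemma div_apply {k : ℕ} (T : Tens (k + 1)) (x : S2) (b : Fin k → Fin 3) :
    (div k T : Field k) x b = ∑ m, ∑ d, (∏ j, proj x (b j) (d j)) *
      pd (fun y => (T : Field (k + 1)) y (Fin.cons m d)) x m := by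
  change ∑ i, covF (T : Field (k + 1)) x (Fin.cons i (Fin.cons i b)) = _
  simp only [covF_cons]
  simp only [sum_fin_cons (k := k), Fin.prod_univ_succ, Fin.cons_zero, Fin.cons_succ]
  rw [Finset.sum_comm]
  refine Finset.sum_congr rfl fun m _ => ?_
  rw [Finset.sum_comm]
  refine Finset.sum_congr rfl fun d _ => ?_
  rw [← sum_proj_mul x m _ (sum_mul_pd' (Tens.smooth_apply T (Fin.cons m d)) x), Finset.mul_sum]
  exact Finset.sum_congr rfl fun b _ => by ring

lemma sum_mul_div {k : ℕ} (S : Tens k) (T : Tens (k + 1)) (x : S2) :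
    ∑ b, (S : Field k) x b * (div k T : Field k) x b
      = ∑ i, ∑ b, (S : Field k) x b * pd (fun y => (T : Field (k + 1)) y (Fin.cons i b)) x i := by
  simp only [div_apply, Finset.mul_sum]
  rw [Finset.sum_comm]
  refine Finset.sum_congr rfl fun m _ => ?_
  rw [Finset.sum_comm]
  refine Finset.sum_congr rfl fun d _ => ?_
  rw [← sum_prod_proj_mul x (fun b => (S : Field k) x b) (fun b j => S.2.2 x b j) d,
    Finset.sum_mul]
  exact Finset.sum_congr rfl fun b _ => by ring

lemma toDist_apply {k : ℕ} (S T : Tens k) :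
    toDist S T = ∫ x, ∑ a, (S : Field k) x a * (T : Field k) x a ∂surf := rfl

lemma toDist_comm {k : ℕ} (S T : Tens k) : toDist S T = toDist T S := by
  simp only [toDist_apply, mul_comm]

lemma toDistS_apply (S T : STF) : toDistS S T = toDist (S : Tens 2) (T : Tens 2) := rfl

lemma toDistS_comm (S T : STF) : toDistS S T = toDistS T S := by
  rw [toDistS_apply, toDist_comm, toDistS_apply]

/-- The divergence is minus the adjoint of the covariant derivative. -/
lemma toDist_cov {k : ℕ} (S : Tens k) (T : Tens (k + 1)) :
    toDist (cov k S) T = -toDist S (div k T) := by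
  rw [eq_neg_iff_add_eq_zero, toDist_apply, toDist_apply,
    ← integral_add (integrable_pair _ _) (integrable_pair _ _)]
  have hs : ∀ i : Fin 3, Smooth (fun y => ∑ b : Fin k → Fin 3, (S : Field k) y b *
      (T : Field (k + 1)) y (Fin.cons i b)) := fun i =>
    Smooth.sum fun b _ => (Tens.smooth_apply S b).mul (Tens.smooth_apply T _)
  have h : ∀ x, ∑ a, (cov k S : Field (k + 1)) x a * (T : Field (k + 1)) x a
      + ∑ b, (S : Field k) x b * (div k T : Field k) x b
      = ∑ i, pd (fun y => ∑ b, (S : Field k) y b * (T : Field (k + 1)) y (Fin.cons i b)) x i := by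
    intro x
    rw [sum_cov_mul, sum_mul_div, ← Finset.sum_add_distrib]
    refine Finset.sum_congr rfl fun i _ => ?_
    rw [pd_sum fun b _ => (Tens.smooth_apply S b).mul (Tens.smooth_apply T _),
      ← Finset.sum_add_distrib]
    exact Finset.sum_congr rfl fun b _ =>
      (pd_mul (Tens.smooth_apply S b) (Tens.smooth_apply T _) x i).symm
  simp only [h]
  rw [integral_finsetSum _ fun i _ => ((hs i).pd_comp i).integrable]
  simp only [fun i => integral_pd (hs i) i]
  rw [← Finset.mul_sum, ← integral_finsetSum _ fun i _ => ((Smooth.coord i).mul (hs i)).integrable]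
  have h2 : ∀ x : S2, ∑ i, (x : E3) i * ∑ b, (S : Field k) x b *
      (T : Field (k + 1)) x (Fin.cons i b) = 0 := by
    intro x
    simp only [Finset.mul_sum]
    rw [Finset.sum_comm]
    refine Finset.sum_eq_zero fun b _ => ?_
    simp only [mul_left_comm _ ((S : Field k) x b), ← Finset.mul_sum, Tens.tangential_cons,
      mul_zero]
  simp [h2]

lemma dcov_toDist {k : ℕ} (S : Tens k) : dcov (toDist S) = toDist (cov k S) := by
  ext T
  rw [toDist_cov]
  rfl

lemma ddiv_toDist {k : ℕ} (T : Tens (k + 1)) : ddiv (toDist T) = toDist (div k T) := by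
  ext S
  rw [toDist_comm, ← neg_eq_iff_eq_neg.2 (toDist_cov S T), toDist_comm]
  rfl

/-! ### The Hodge operators in ambient components -/

/-- The value of a smooth function on the sphere. -/
def sval (f : Tens 0) (x : S2) : ℝ := (f : Field 0) x ![]

lemma sval_eq (f : Tens 0) (x : S2) (a : Fin 0 → Fin 3) : (f : Field 0) x a = sval f x := by
  rw [sval, Subsingleton.elim a ![]]

lemma smooth_sval (f : Tens 0) : Smooth (sval f) := Tens.smooth_apply f _

lemma ext_sval {f g : Tens 0} (h : ∀ x, sval f x = sval g x) : f = g := by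
  ext x a
  rw [sval_eq, sval_eq, h]

lemma sval_add (f g : Tens 0) (x : S2) : sval (f + g) x = sval f x + sval g x := rfl

lemma sval_smul (c : ℝ) (f : Tens 0) (x : S2) : sval (c • f) x = c * sval f x := rfl

/-- A smooth function on the sphere as a `0`-tensor field. -/
def ofFun (h : S2 → ℝ) (hh : Smooth h) : Tens 0 :=
  ⟨fun x _ => h x, smooth_pi.2 fun _ => hh, fun _ _ j => j.elim0⟩

lemma sval_ofFun (h : S2 → ℝ) (hh : Smooth h) : sval (ofFun h hh) = h := rfl

lemma toDist_zero_apply (f g : Tens 0) : toDist f g = ∫ x, sval f x * sval g x ∂surf := by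
  rw [toDist_apply]
  simp [sval_eq]

lemma cov_zero_apply (f : Tens 0) (x : S2) (a : Fin 1 → Fin 3) :
    (cov 0 f : Field 1) x a = pd (sval f) x (a 0) := by
  have : a = Fin.cons (a 0) ![] := by ext j; fin_cases j; rfl
  conv_lhs => rw [this]
  change covF (f : Field 0) x (Fin.cons (a 0) ![]) = _
  rw [covF_cons]
  simp
  rfl

/-- The components of a one-form. -/
def comp1 (V : Tens 1) (i : Fin 3) (x : S2) : ℝ := (V : Field 1) x ![i]

lemma comp1_eq (V : Tens 1) (x : S2) (a : Fin 1 → Fin 3) :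
    (V : Field 1) x a = comp1 V (a 0) x := by
  have : a = ![a 0] := by ext j; fin_cases j; rfl
  rw [comp1, ← this]

lemma smooth_comp1 (V : Tens 1) (i : Fin 3) : Smooth (comp1 V i) := Tens.smooth_apply V _

lemma sum_mul_comp1 (V : Tens 1) (x : S2) : ∑ i, (x : E3) i * comp1 V i x = 0 := by
  have := Tens.tangential_cons V x ![]
  simpa [comp1_eq] using this

lemma ext_comp1 {V W : Tens 1} (h : ∀ i x, comp1 V i x = comp1 W i x) : V = W := by
  ext x a
  rw [comp1_eq, comp1_eq, h]

lemma toDist_one_apply (V W : Tens 1) :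
    toDist V W = ∫ x, ∑ i, comp1 V i x * comp1 W i x ∂surf := by
  rw [toDist_apply]
  simp [sum_fin_cons, comp1_eq]

lemma comp1_cov (f : Tens 0) (i : Fin 3) (x : S2) : comp1 (cov 0 f) i x = pd (sval f) x i :=
  cov_zero_apply f x ![i]

lemma Smooth.sum_mul_pd_eq {V : Fin 3 → S2 → ℝ} (hV : ∀ j, Smooth (V j))
    (ht : ∀ x : S2, ∑ j, (x : E3) j * V j x = 0) (x : S2) (i : Fin 3) :
    ∑ j, (x : E3) j * NullGluing.pd (V j) x i = -V i x := by
  have h1 : NullGluing.pd (fun y : S2 => ∑ j, (y : E3) j * V j y) x i = 0 := by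
    simp only [ht, pd_const]
  rw [pd_sum fun j _ => (Smooth.coord j).mul (hV j)] at h1
  simp only [fun j => pd_mul (Smooth.coord j) (hV j), pd_coord, Finset.sum_add_distrib] at h1
  have h2 := sum_proj_mul x i (fun j => V j x) (ht x)
  simp only [proj_comm x _ i] at h2
  linarith

lemma sum_proj_mul_left (x : S2) (i : Fin 3) (t : Fin 3 → ℝ) :
    ∑ j, proj x i j * t j = t i - (x : E3) i * ∑ j, (x : E3) j * t j := by
  have h : ∀ j, proj x i j * t j = (if i = j then 1 else 0) * t j
      - (x : E3) i * ((x : E3) j * t j) := fun j => by simp only [proj]; ring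
  simp only [h, Finset.sum_sub_distrib, ← Finset.mul_sum]
  simp

lemma cov_one_apply (V : Tens 1) (x : S2) (i j : Fin 3) :
    covF (V : Field 1) x ![i, j] = pd (comp1 V j) x i + (x : E3) j * comp1 V i x := by
  change covF (V : Field 1) x (Fin.cons i ![j]) = _
  rw [covF_cons]
  simp only [sum_fin_cons]
  have h : ∀ (c : Fin 3) (d : Fin 0 → Fin 3), (fun y => (V : Field 1) y (Fin.cons c d)) =
      comp1 V c := by
    intro c d; ext y; rw [comp1_eq]; rfl
  simp only [Finset.univ_unique, Finset.sum_singleton, h]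
  have h2 := Smooth.sum_mul_pd_eq (smooth_comp1 V) (sum_mul_comp1 V) x i
  have h3 := sum_proj_mul_left x j (fun c => pd (comp1 V c) x i)
  rw [h2] at h3
  simpa using h3

lemma div_zero_apply (V : Tens 1) (x : S2) (a : Fin 0 → Fin 3) :
    (div 0 V : Field 0) x a = ∑ i, pd (comp1 V i) x i := by
  rw [div_apply]
  have h : ∀ (c : Fin 3) (d : Fin 0 → Fin 3), (fun y => (V : Field 1) y (Fin.cons c d)) =
      comp1 V c := by
    intro c d; ext y; rw [comp1_eq]; rfl
  simp [h]

lemma sval_div (V : Tens 1) (x : S2) : sval (div 0 V) x = ∑ i, pd (comp1 V i) x i :=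
  div_zero_apply V x _

/-- The components of a 2-tensor. -/
def comp2 (T : Tens 2) (i j : Fin 3) (x : S2) : ℝ := (T : Field 2) x ![i, j]

lemma comp2_eq (T : Tens 2) (x : S2) (a : Fin 2 → Fin 3) :
    (T : Field 2) x a = comp2 T (a 0) (a 1) x := by
  have : a = ![a 0, a 1] := by ext j; fin_cases j <;> rfl
  rw [comp2, ← this]

lemma smooth_comp2 (T : Tens 2) (i j : Fin 3) : Smooth (comp2 T i j) := Tens.smooth_apply T _

lemma ext_comp2 {S T : Tens 2} (h : ∀ i j x, comp2 S i j x = comp2 T i j x) : S = T := by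
  ext x a
  rw [comp2_eq, comp2_eq, h]

lemma sum_mul_comp2_left (T : Tens 2) (x : S2) (j : Fin 3) :
    ∑ i, (x : E3) i * comp2 T i j x = 0 := by
  have := Tens.tangential_cons T x ![j]
  simpa [comp2_eq] using this

lemma sum_mul_comp2_right (T : Tens 2) (x : S2) (i : Fin 3) :
    ∑ j, (x : E3) j * comp2 T i j x = 0 := by
  have := Tens.tangential_tail T x i ![0] 0
  simpa [comp2_eq] using this

lemma comp2_cov (V : Tens 1) (i j : Fin 3) (x : S2) :
    comp2 (cov 1 V) i j x = pd (comp1 V j) x i + (x : E3) j * comp1 V i x :=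
  cov_one_apply V x i j

lemma sum_fin_two {M : Type*} [AddCommMonoid M] (F : (Fin 2 → Fin 3) → M) :
    ∑ a, F a = ∑ i, ∑ j, F ![i, j] := by
  rw [sum_fin_cons]
  refine Finset.sum_congr rfl fun i _ => ?_
  rw [sum_fin_cons]
  refine Finset.sum_congr rfl fun j _ => ?_
  rw [Fintype.sum_unique]
  congr 1

lemma toDist_two_apply (S T : Tens 2) :
    toDist S T = ∫ x, ∑ i, ∑ j, comp2 S i j x * comp2 T i j x ∂surf := by
  rw [toDist_apply]
  simp [sum_fin_two, comp2_eq]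

lemma comp1_div (T : Tens 2) (j : Fin 3) (x : S2) :
    comp1 (div 1 T) j x = ∑ i, pd (comp2 T i j) x i + (x : E3) j * ∑ i, comp2 T i i x := by
  change (div 1 T : Field 1) x ![j] = _
  rw [div_apply, Finset.mul_sum, ← Finset.sum_add_distrib]
  refine Finset.sum_congr rfl fun i _ => ?_
  rw [sum_fin_cons]
  have h : ∀ (c : Fin 3) (d : Fin 0 → Fin 3), (fun y => (T : Field 2) y (Fin.cons i (Fin.cons c d)))
      = comp2 T i c := by
    intro c d; ext y; rw [comp2_eq]; rfl
  simp only [Finset.univ_unique, Finset.sum_singleton, h]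
  have h3 := sum_proj_mul_left x j (fun c => pd (comp2 T i c) x i)
  have h4 : ∑ c, (x : E3) c * pd (comp2 T i c) x i = -comp2 T i i x :=
    Smooth.sum_mul_pd_eq (V := fun c => comp2 T i c) (fun c => (smooth_comp2 T) i c)
      (fun y => (sum_mul_comp2_right T) y i) x i
  rw [h4] at h3
  simpa using h3

/-! ### The Laplacian and the rotation fields -/

/-- The Laplace-Beltrami operator on functions. -/
def slap (h : S2 → ℝ) (x : S2) : ℝ := ∑ i, pd (fun y => pd h y i) x i

lemma Smooth.slap {h : S2 → ℝ} (hh : Smooth h) : Smooth (NullGluing.slap h) :=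
  Smooth.sum fun i _ => (hh.pd_comp i).pd_comp i

lemma slap_add {g h : S2 → ℝ} (hg : Smooth g) (hh : Smooth h) (x : S2) :
    slap (fun y => g y + h y) x = slap g x + slap h x := by
  simp only [slap, fun y i => pd_add hg hh y i, ← Finset.sum_add_distrib,
    fun i => pd_add (hg.pd_comp i) (hh.pd_comp i) x i]

lemma slap_mul {g h : S2 → ℝ} (hg : Smooth g) (hh : Smooth h) (x : S2) :
    slap (fun y => g y * h y) x
      = slap g x * h x + 2 * ∑ i, pd g x i * pd h x i + g x * slap h x := by
  have h1 : ∀ i, pd (fun y => pd (fun y => g y * h y) y i) x i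
      = pd (fun y => pd g y i) x i * h x + 2 * (pd g x i * pd h x i)
        + g x * pd (fun y => pd h y i) x i := by
    intro i
    simp only [fun y => pd_mul hg hh y i]
    rw [pd_add ((hg.pd_comp i).mul hh) (hg.mul (hh.pd_comp i)), pd_mul (hg.pd_comp i) hh,
      pd_mul hg (hh.pd_comp i)]
    ring
  simp only [slap, h1, Finset.sum_add_distrib, Finset.sum_mul, Finset.mul_sum]

lemma slap_const_mul (c : ℝ) {h : S2 → ℝ} (hh : Smooth h) (x : S2) :
    slap (fun y => c * h y) x = c * slap h x := by
  rw [slap_mul (Smooth.const c) hh]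
  simp [slap, pd_const]

lemma slap_sub {g h : S2 → ℝ} (hg : Smooth g) (hh : Smooth h) (x : S2) :
    slap (fun y => g y - h y) x = slap g x - slap h x := by
  have h1 := slap_add hg ((Smooth.const (-1)).mul hh) x
  rw [slap_const_mul (-1) hh] at h1
  have h2 : (fun y => g y + -1 * h y) = fun y => g y - h y := by ext y; ring
  rw [h2] at h1
  linarith

lemma pd_proj (x : S2) (l i j : Fin 3) :
    pd (fun y => proj y i j) x l = -(proj x l i * (x : E3) j + (x : E3) i * proj x l j) := by
  unfold proj
  rw [pd_sub (Smooth.const _) ((Smooth.coord i).mul (Smooth.coord j)), pd_const,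
    pd_mul (Smooth.coord i) (Smooth.coord j), pd_coord, pd_coord]
  simp [proj]

lemma sum_proj_pd {h : S2 → ℝ} (hh : Smooth h) (x : S2) (j : Fin 3) :
    ∑ i, proj x i j * pd h x i = pd h x j :=
  sum_proj_mul x j _ (sum_mul_pd' hh x)

lemma slap_coord (x : S2) (j : Fin 3) : slap (fun y : S2 => (y : E3) j) x = -2 * (x : E3) j := by
  unfold slap
  simp only [pd_coord, pd_proj]
  have h1 := sum_proj_self x
  have h2 := sum_mul_proj x j
  simp only [Fin.sum_univ_three] at *
  linear_combination -h1 * (x : E3) j - h2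

lemma slap_coord_mul {h : S2 → ℝ} (hh : Smooth h) (x : S2) (j : Fin 3) :
    slap (fun y : S2 => (y : E3) j * h y) x
      = -2 * (x : E3) j * h x + 2 * pd h x j + (x : E3) j * slap h x := by
  rw [slap_mul (Smooth.coord j) hh, slap_coord]
  simp only [pd_coord]
  rw [sum_proj_pd hh]

/-- The commutator of the Laplacian with a partial derivative. -/
lemma slap_pd {h : S2 → ℝ} (hh : Smooth h) (x : S2) (j : Fin 3) :
    slap (fun y => pd h y j) x = pd (slap h) x j - 2 * (x : E3) j * slap h x := by
  have hi : ∀ i, Smooth (fun y => pd h y i) := fun i => hh.pd_comp i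
  have h1 : ∀ i, pd (fun y => pd (fun y => pd h y j) y i) x i
      = pd (fun y => pd (fun y => pd h y i) y i) x j
        + (x : E3) i * pd (fun y => pd h y i) x j - (x : E3) j * pd (fun y => pd h y i) x i
        + proj x i i * pd h x j + (x : E3) i * pd (fun y => pd h y j) x i
        - proj x i j * pd h x i - (x : E3) j * pd (fun y => pd h y i) x i := by
    intro i
    have e : (fun y => pd (fun y => pd h y j) y i) = fun y =>
        pd (fun y => pd h y i) y j + ((y : E3) i * pd h y j - (y : E3) j * pd h y i) := by
      ext y
      linarith [pd_comm hh y i j]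
    rw [e, pd_add ((hi i).pd_comp j)
        (((Smooth.coord i).mul (hi j)).sub ((Smooth.coord j).mul (hi i))),
      pd_sub ((Smooth.coord i).mul (hi j)) ((Smooth.coord j).mul (hi i)),
      pd_mul (Smooth.coord i) (hi j), pd_mul (Smooth.coord j) (hi i), pd_coord, pd_coord]
    linear_combination pd_comm (hi i) x i j
  have h2 : pd (slap h) x j = ∑ i, pd (fun y => pd (fun y => pd h y i) y i) x j :=
    pd_sum (fun i _ => (hi i).pd_comp i) x j
  have h3 : ∑ i, (x : E3) i * pd (fun y => pd h y i) x j = -pd h x j :=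
    Smooth.sum_mul_pd_eq (V := fun i y => pd h y i) hi (sum_mul_pd' hh) x j
  have h4 := sum_mul_pd' (hi j) x
  have h5 := sum_proj_pd hh x j
  have h6 := sum_proj_self x
  rw [h2]
  unfold slap
  simp only [h1]
  simp only [Fin.sum_univ_three] at *
  linear_combination h3 + h6 * pd h x j + h4 - h5

/-- The derivative along the rotation field `∂_i ↦ x × e_i`. -/
def rot (i : Fin 3) (h : S2 → ℝ) (x : S2) : ℝ := ∑ j, area x i j * pd h x j

lemma rot_zero (h : S2 → ℝ) (x : S2) :
    rot 0 h x = (x : E3) 2 * pd h x 1 - (x : E3) 1 * pd h x 2 := by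
  simp [rot, area, dotProduct, Fin.sum_univ_three, crossProduct]
  ring

lemma rot_one (h : S2 → ℝ) (x : S2) :
    rot 1 h x = (x : E3) 0 * pd h x 2 - (x : E3) 2 * pd h x 0 := by
  simp [rot, area, dotProduct, Fin.sum_univ_three, crossProduct]
  ring

lemma rot_two (h : S2 → ℝ) (x : S2) :
    rot 2 h x = (x : E3) 1 * pd h x 0 - (x : E3) 0 * pd h x 1 := by
  simp [rot, area, dotProduct, Fin.sum_univ_three, crossProduct]
  ring

/-- Every rotation derivative is one in a coordinate plane. -/
lemma exists_rot_eq (i : Fin 3) : ∃ a b : Fin 3, ∀ (h : S2 → ℝ) (x : S2),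
    rot i h x = (x : E3) b * pd h x a - (x : E3) a * pd h x b := by
  fin_cases i
  · exact ⟨1, 2, rot_zero⟩
  · exact ⟨2, 0, rot_one⟩
  · exact ⟨0, 1, rot_two⟩

lemma Smooth.rot {h : S2 → ℝ} (hh : Smooth h) (i : Fin 3) : Smooth (NullGluing.rot i h) :=
  Smooth.sum fun _ _ => (Smooth.area _ _).mul (hh.pd_comp _)

lemma pd_eq_rot {h : S2 → ℝ} (hh : Smooth h) (x : S2) (i : Fin 3) :
    pd h x i = ∑ j, area x j i * rot j h x := by
  have h1 := sum_mul_pd' hh x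
  have h2 := sum_mul_self x
  simp only [Fin.sum_univ_three] at h1 h2 ⊢
  simp only [rot_zero, rot_one, rot_two]
  fin_cases i <;> simp [area, dotProduct, Fin.sum_univ_three, crossProduct]
  · linear_combination (x : E3) 0 * h1 - pd h x 0 * h2
  · linear_combination (x : E3) 1 * h1 - pd h x 1 * h2
  · linear_combination (x : E3) 2 * h1 - pd h x 2 * h2

lemma sum_rot_mul_rot {g h : S2 → ℝ} (hg : Smooth g) (hh : Smooth h) (x : S2) :
    ∑ i, rot i g x * rot i h x = ∑ i, pd g x i * pd h x i := by
  have h1 := sum_mul_pd' hh x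
  have h1' := sum_mul_pd' hg x
  have h2 := sum_mul_self x
  simp only [Fin.sum_univ_three] at *
  simp only [rot_zero, rot_one, rot_two]
  linear_combination -((x : E3) 0 * pd g x 0 + (x : E3) 1 * pd g x 1 + (x : E3) 2 * pd g x 2) * h1
    + (pd g x 0 * pd h x 0 + pd g x 1 * pd h x 1 + pd g x 2 * pd h x 2) * h2

lemma rot_mul {g h : S2 → ℝ} (hg : Smooth g) (hh : Smooth h) (i : Fin 3) (x : S2) :
    rot i (fun y => g y * h y) x = rot i g x * h x + g x * rot i h x := by
  simp only [rot, fun j => pd_mul hg hh x j, Fin.sum_univ_three]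
  ring

lemma integral_rot {h : S2 → ℝ} (hh : Smooth h) (i : Fin 3) : ∫ x, rot i h x ∂surf = 0 := by
  obtain ⟨a, b, hab⟩ := exists_rot_eq i
  have h1 : ∀ x : S2, rot i h x = pd (fun y : S2 => (y : E3) b * h y) x a
      - pd (fun y : S2 => (y : E3) a * h y) x b := by
    intro x
    rw [hab, pd_mul (Smooth.coord b) hh, pd_mul (Smooth.coord a) hh, pd_coord, pd_coord,
      proj_comm x a b]
    ring
  simp only [h1]
  rw [integral_sub (((Smooth.coord b).mul hh).pd_comp a).integrable
    (((Smooth.coord a).mul hh).pd_comp b).integrable, integral_pd ((Smooth.coord b).mul hh),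
    integral_pd ((Smooth.coord a).mul hh)]
  have h2 : ∀ x : S2, (x : E3) a * ((x : E3) b * h x) = (x : E3) b * ((x : E3) a * h x) :=
    fun x => mul_left_comm _ _ _
  simp only [h2, sub_self]

lemma integral_rot_mul {g h : S2 → ℝ} (hg : Smooth g) (hh : Smooth h) (i : Fin 3) :
    ∫ x, rot i g x * h x ∂surf = -∫ x, g x * rot i h x ∂surf := by
  rw [eq_neg_iff_add_eq_zero, ← integral_add ((hg.rot i).mul hh).integrable
    (hg.mul (hh.rot i)).integrable, ← integral_rot (hg.mul hh) i]
  simp only [fun x => rot_mul hg hh i x]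

/-- Rotations commute with the Laplacian. -/
lemma slap_rot {h : S2 → ℝ} (hh : Smooth h) (i : Fin 3) (x : S2) :
    slap (rot i h) x = rot i (slap h) x := by
  obtain ⟨a, b, hab⟩ := exists_rot_eq i
  have h1 : rot i h = fun x : S2 => (x : E3) b * pd h x a - (x : E3) a * pd h x b := by
    ext x; exact hab h x
  rw [hab, h1, slap_sub ((Smooth.coord b).mul (hh.pd_comp a)) ((Smooth.coord a).mul (hh.pd_comp b)),
    slap_coord_mul (hh.pd_comp a), slap_coord_mul (hh.pd_comp b), slap_pd hh, slap_pd hh]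
  linear_combination 2 * pd_comm hh x b a

/-- Green's identity. -/
lemma integral_pd_mul_pd {g h : S2 → ℝ} (hg : Smooth g) (hh : Smooth h) :
    ∫ x, ∑ i, pd g x i * pd h x i ∂surf = -∫ x, g x * slap h x ∂surf := by
  have h1 := toDist_cov (ofFun g hg) (cov 0 (ofFun h hh))
  rw [toDist_one_apply, toDist_zero_apply] at h1
  simpa only [comp1_cov, sval_div, sval_ofFun, funext (comp1_cov (ofFun h hh) _), slap] using h1

/-! ### The Hodge operators -/

lemma comp1_star (V : Tens 1) (i : Fin 3) (x : S2) :
    comp1 (star V) i x = ∑ j, area x i j * comp1 V j x := rfl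

lemma comp1_add (V W : Tens 1) (i : Fin 3) (x : S2) :
    comp1 (V + W) i x = comp1 V i x + comp1 W i x := rfl

lemma comp1_smul (c : ℝ) (V : Tens 1) (i : Fin 3) (x : S2) :
    comp1 (c • V) i x = c * comp1 V i x := rfl

lemma comp1_star_cov (f : Tens 0) (i : Fin 3) (x : S2) :
    comp1 (star (cov 0 f)) i x = rot i (sval f) x := by
  simp only [comp1_star, comp1_cov, rot]

lemma area_comm (x : S2) (i j : Fin 3) : area x i j = -area x j i := by
  fin_cases i <;> fin_cases j <;>
    simp [area, dotProduct, Fin.sum_univ_three, crossProduct]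

lemma sum_area_mul (x : S2) (i : Fin 3) : ∑ j, area x i j * (x : E3) j = 0 := by
  have h := sum_mul_area x i
  have h1 : ∀ j, area x i j * (x : E3) j = -((x : E3) j * area x j i) := fun j => by
    rw [area_comm x i j]; ring
  simp only [h1, Finset.sum_neg_distrib, h, neg_zero]

/-- The area form is parallel, in the form needed to pull it out of a divergence. -/
lemma sum_pd_area (x : S2) (j : Fin 3) : ∑ i, pd (fun y => area y i j) x i = 0 := by
  have h1 : ∀ i, pd (fun y => area y i j) x i
      = ∑ l, proj x i l * crossProduct (Pi.single i (1 : ℝ)) (Pi.single j 1) l := by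
    intro i
    unfold area dotProduct
    rw [pd_sum fun l _ => (Smooth.coord l).mul (Smooth.const _)]
    refine Finset.sum_congr rfl fun l _ => ?_
    rw [pd_mul (Smooth.coord l) (Smooth.const _), pd_const, pd_coord]
    ring
  simp only [h1]
  fin_cases j <;> simp [Fin.sum_univ_three, crossProduct, proj] <;> ring

/-- The curl of a one-form is the divergence of its dual. -/
lemma curl_eq (V : Tens 1) : curl V = div 0 (star V) := by
  refine ext_sval fun x => ?_
  rw [sval_div]
  change ∑ i, ∑ j, area x i j * covF (V : Field 1) x ![i, j] = _
  simp only [cov_one_apply]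
  have h1 : ∀ i, pd (comp1 (star V) i) x i
      = ∑ j, (pd (fun y => area y i j) x i * comp1 V j x + area x i j * pd (comp1 V j) x i) := by
    intro i
    have e : comp1 (star V) i = fun y => ∑ j, area y i j * comp1 V j y := by
      ext y; rw [comp1_star]
    rw [e, pd_sum fun j _ => (Smooth.area i j).mul (smooth_comp1 V j)]
    exact Finset.sum_congr rfl fun j _ => pd_mul (Smooth.area i j) (smooth_comp1 V j) x i
  have h2 : ∑ i, ∑ j, pd (fun y => area y i j) x i * comp1 V j x = 0 := by
    rw [Finset.sum_comm]
    refine Finset.sum_eq_zero fun j _ => ?_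
    rw [← Finset.sum_mul, sum_pd_area, zero_mul]
  have h3 : ∑ i, ∑ j, area x i j * ((x : E3) j * comp1 V i x) = 0 := by
    refine Finset.sum_eq_zero fun i _ => ?_
    simp only [← mul_assoc, ← Finset.sum_mul, sum_area_mul, zero_mul]
  simp only [h1, mul_add, Finset.sum_add_distrib, h2, h3]
  ring

lemma toDist_star (V W : Tens 1) : toDist (star V) W = -toDist V (star W) := by
  rw [toDist_one_apply, toDist_one_apply, ← integral_neg]
  refine integral_congr_ae (Eventually.of_forall fun x => ?_)
  simp only [comp1_star, Finset.sum_mul, Finset.mul_sum, ← Finset.sum_neg_distrib]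
  rw [Finset.sum_comm]
  refine Finset.sum_congr rfl fun i _ => Finset.sum_congr rfl fun j _ => ?_
  rw [area_comm x j i]
  ring

/-- `D₁^*` is the adjoint of `V ↦ (div V, curl V)`. -/
lemma dD1s_toDist (f₁ f₂ : Tens 0) : dD1s (toDist f₁) (toDist f₂) = toDist (D1star f₁ f₂) := by
  ext V
  have h1 := toDist_cov f₁ V
  have h2 := toDist_cov f₂ (star V)
  have h3 := toDist_star (cov 0 f₂) V
  change toDist f₁ (div 0 V) + toDist f₂ (curl V) = toDist (-cov 0 f₁ + star (cov 0 f₂)) V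
  rw [map_add, map_neg, LinearMap.add_apply, LinearMap.neg_apply, h1, h3, h2, curl_eq]
  ring

lemma curl_cov (f : Tens 0) : curl (cov 0 f) = 0 := by
  refine ext_sval fun x => ?_
  change ∑ i, ∑ j, area x i j * covF (cov 0 f : Field 1) x ![i, j] = 0
  have h1 : ∀ i j, pd (comp1 (cov 0 f) j) x i = pd (fun y => pd (sval f) y j) x i := by
    intro i j
    rw [show comp1 (cov 0 f) j = fun y => pd (sval f) y j from funext (comp1_cov f j)]
  simp only [cov_one_apply, comp1_cov, h1]
  have h2 := pd_comm (smooth_sval f) x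
  simp only [Fin.sum_univ_three]
  simp [area, dotProduct, Fin.sum_univ_three, crossProduct]
  linear_combination (x : E3) 2 * h2 0 1 - (x : E3) 1 * h2 0 2 + (x : E3) 0 * h2 1 2

lemma div_star_cov (f : Tens 0) : div 0 (star (cov 0 f)) = 0 := by
  rw [← curl_eq, curl_cov]

lemma sval_div_cov (f : Tens 0) (x : S2) : sval (div 0 (cov 0 f)) x = slap (sval f) x := by
  rw [sval_div]
  simp only [funext (comp1_cov f _), slap]

/-! ### Symmetric tracefree tensors -/

lemma STF.symm (W : STF) (i j : Fin 3) (x : S2) :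
    comp2 (W : Tens 2) i j x = comp2 (W : Tens 2) j i x :=
  W.2.1 x i j

lemma STF.trace (W : STF) (x : S2) : ∑ i, comp2 (W : Tens 2) i i x = 0 := W.2.2 x

lemma comp2_stf (T : Tens 2) (i j : Fin 3) (x : S2) :
    comp2 (stf T : Tens 2) i j x = (comp2 T i j x + comp2 T j i x) / 2
      - (∑ l, comp2 T l l x) / 2 * proj x i j := rfl

lemma STF.ext_comp2 {S T : STF} (h : ∀ i j x, comp2 (S : Tens 2) i j x = comp2 (T : Tens 2) i j x) :
    S = T := Subtype.ext (NullGluing.ext_comp2 h)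

lemma stf_coe (W : STF) : stf (W : Tens 2) = W := by
  refine STF.ext_comp2 fun i j x => ?_
  rw [comp2_stf, STF.trace, STF.symm W j i]
  ring

/-- The symmetric tracefree part is the orthogonal projection. -/
lemma toDist_stf (T : Tens 2) (W : STF) : toDist (stf T : Tens 2) W = toDist T W := by
  rw [toDist_two_apply, toDist_two_apply]
  refine integral_congr_ae (Eventually.of_forall fun x => ?_)
  have h1 := fun i => sum_mul_comp2_right (W : Tens 2) x i
  have h2 := STF.trace W x
  have h3 := fun i j => STF.symm W i j x
  simp only [comp2_stf, proj, Fin.sum_univ_three] at *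
  simp
  have e0 := h1 0
  have e1 := h1 1
  have e2 := h1 2
  rw [h3 1 0] at e1 ⊢
  rw [h3 2 0, h3 2 1] at e2 ⊢
  linear_combination (comp2 T 0 0 x + comp2 T 1 1 x + comp2 T 2 2 x) / 2 *
    ((x : E3) 0 * e0 + (x : E3) 1 * e1 + (x : E3) 2 * e2 - h2)

lemma D2star_apply (V : Tens 1) : D2star V = -stf (cov 1 V) :=
  neg_one_smul ℝ (stf (cov 1 V))

/-- `D₂^*` is the adjoint of `D₂`. -/
lemma toDistS_D2star (V : Tens 1) (W : STF) : toDistS (D2star V) W = toDist V (D2 W) := by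
  have h1 : D2star V = (-1 : ℝ) • stf (cov 1 V) := rfl
  rw [h1, map_smul, LinearMap.smul_apply, toDistS_apply, toDist_stf, toDist_cov, smul_neg,
    neg_one_smul, neg_neg]
  rfl

lemma ddivS_toDistS (W : STF) : ddivS (toDistS W) = toDist (D2 W) := by
  ext V
  rw [toDist_comm, ← toDistS_D2star, toDistS_comm]
  rfl

lemma dD2s_toDist (V : Tens 1) : dD2s (toDist V) = toDistS (D2star V) := by
  ext W
  rw [toDistS_D2star]
  rfl

lemma comp2_D2star (V : Tens 1) (i j : Fin 3) (x : S2) :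
    comp2 (D2star V : Tens 2) i j x = -(1 / 2) * (pd (comp1 V j) x i + (x : E3) j * comp1 V i x
      + pd (comp1 V i) x j + (x : E3) i * comp1 V j x - sval (div 0 V) x * proj x i j) := by
  rw [D2star_apply]
  change -comp2 (stf (cov 1 V) : Tens 2) i j x = _
  rw [comp2_stf]
  simp only [comp2_cov, Finset.sum_add_distrib, sum_mul_comp1, sval_div]
  ring

/-- The operator `D₂ D₂^*` on one-forms acts, up to a normal term, by the Laplacian of functions on
the ambient components. -/
lemma comp1_D2_D2star (V : Tens 1) (j : Fin 3) (x : S2) :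
    comp1 (D2 (D2star V)) j x = -(1 / 2) * (slap (comp1 V j) x + 2 * comp1 V j x
      + 2 * (x : E3) j * sval (div 0 V) x) := by
  change comp1 (div 1 (D2star V : Tens 2)) j x = _
  rw [comp1_div, STF.trace]
  have hV := smooth_comp1 V
  have hd : Smooth (sval (div 0 V)) := smooth_sval _
  have hx := Smooth.coord
  have h1 : ∀ i, pd (comp2 (D2star V : Tens 2) i j) x i = -(1 / 2) *
      (pd (fun y => pd (comp1 V j) y i) x i + (proj x i j * comp1 V i x
        + (x : E3) j * pd (comp1 V i) x i) + pd (fun y => pd (comp1 V i) y j) x i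
        + (proj x i i * comp1 V j x + (x : E3) i * pd (comp1 V j) x i)
        - (pd (sval (div 0 V)) x i * proj x i j - sval (div 0 V) x *
          (proj x i i * (x : E3) j + (x : E3) i * proj x i j))) := by
    intro i
    have e : comp2 (D2star V : Tens 2) i j = fun x => -(1 / 2) * (pd (comp1 V j) x i
      + (x : E3) j * comp1 V i x
      + pd (comp1 V i) x j + (x : E3) i * comp1 V j x - sval (div 0 V) x * proj x i j) := by
      ext y; rw [comp2_D2star]
    have s1 := (hV j).pd_comp i
    have s2 := (hx j).mul (hV i)
    have s3 := (hV i).pd_comp j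
    have s4 := (hx i).mul (hV j)
    have s5 := hd.mul (Smooth.proj i j)
    rw [e, pd_const_mul _ ((((s1.add s2).add s3).add s4).sub s5),
      pd_sub (((s1.add s2).add s3).add s4) s5,
      pd_add ((s1.add s2).add s3) s4, pd_add (s1.add s2) s3, pd_add s1 s2, pd_mul (hx j) (hV i),
      pd_mul (hx i) (hV j), pd_mul hd (Smooth.proj i j), pd_proj, pd_coord, pd_coord]
    ring
  -- the derivatives are commuted to produce the gradient of the divergence, which cancels the one
  -- from the trace part of `D₂^*`
  have h2 : ∀ i, pd (fun y => pd (comp1 V i) y j) x i = pd (fun y => pd (comp1 V i) y i) x j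
      + (x : E3) i * pd (comp1 V i) x j - (x : E3) j * pd (comp1 V i) x i := fun i => by
    linear_combination pd_comm (hV i) x i j
  have h3 : pd (sval (div 0 V)) x j = ∑ i, pd (fun y => pd (comp1 V i) y i) x j := by
    rw [show sval (div 0 V) = fun y => ∑ i, pd (comp1 V i) y i from funext (sval_div V)]
    exact pd_sum (fun i _ => (hV i).pd_comp i) x j
  -- the derivative of the tangentiality relation `∑ x_i V_i = 0`
  have h4 : ∑ i, (x : E3) i * pd (comp1 V i) x j = -comp1 V j x :=
    Smooth.sum_mul_pd_eq hV (sum_mul_comp1 V) x j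
  have h5 := sum_mul_pd' (hV j) x
  have h6 := sum_proj_self x
  have h7 := sum_proj_mul x j (fun i => comp1 V i x) (sum_mul_comp1 V x)
  have h8 := sum_proj_pd hd x j
  have h9 := sum_mul_proj x j
  have h10 := sval_div V x
  simp only [h1, h2, slap]
  simp only [Fin.sum_univ_three] at *
  linear_combination -(1 / 2) * (h7 + h4 + h6 * comp1 V j x + h5 - h8 - h3
    + sval (div 0 V) x * ((x : E3) j * h6 + h9))

lemma D2_D2star_cov (f : Tens 0) :
    D2 (D2star (cov 0 f)) = (-(1 / 2) : ℝ) • cov 0 (div 0 (cov 0 f) + (2 : ℝ) • f) := by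
  refine ext_comp1 fun j x => ?_
  rw [comp1_D2_D2star, comp1_smul, comp1_cov, sval_div_cov, comp1_cov,
    show comp1 (cov 0 f) j = fun y => pd (sval f) y j from funext (comp1_cov f j),
    slap_pd (smooth_sval f), show sval (div 0 (cov 0 f) + (2 : ℝ) • f)
      = fun y => slap (sval f) y + 2 * sval f y from funext fun y => by
        rw [sval_add, sval_smul, sval_div_cov],
    pd_add (smooth_sval f).slap ((Smooth.const 2).mul (smooth_sval f)),
    pd_const_mul _ (smooth_sval f)]
  ring

lemma D2_D2star_star_cov (f : Tens 0) :
    D2 (D2star (star (cov 0 f)))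
      = (-(1 / 2) : ℝ) • star (cov 0 (div 0 (cov 0 f) + (2 : ℝ) • f)) := by
  refine ext_comp1 fun j x => ?_
  rw [comp1_D2_D2star, comp1_smul, comp1_star_cov, div_star_cov, comp1_star_cov,
    show comp1 (star (cov 0 f)) j = rot j (sval f) from funext (comp1_star_cov f j),
    slap_rot (smooth_sval f), show sval (div 0 (cov 0 f) + (2 : ℝ) • f)
      = fun y => slap (sval f) y + 2 * sval f y from funext fun y => by
        rw [sval_add, sval_smul, sval_div_cov]]
  have h1 : rot j (fun y => slap (sval f) y + 2 * sval f y) x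
      = rot j (slap (sval f)) x + 2 * rot j (sval f) x := by
    simp only [rot, fun i => pd_add (smooth_sval f).slap ((Smooth.const 2).mul (smooth_sval f)) x i,
      fun i => pd_const_mul 2 (smooth_sval f) x i, mul_add, Finset.sum_add_distrib,
      mul_left_comm _ (2 : ℝ), ← Finset.mul_sum]
  rw [h1]
  change -(1 / 2) * (_ + _ + 2 * (x : E3) j * 0) = _
  ring

/-! ### Legendre polynomials -/

/-- The derivatives of the Legendre polynomials. -/
def legD (l m : ℕ) : Polynomial ℝ := Polynomial.derivative^[m] (legendre l)

lemma derivative_legD (l m : ℕ) : (legD l m).derivative = legD l (m + 1) := by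
  rw [legD, legD, Function.iterate_succ_apply']

open Polynomial in
/-- The `n`-fold derivative of the equation `(X² - 1) w' = 2 l X w` for `w = (X² - 1)^l`, once more
differentiated. For `n = l` this is Legendre's equation by the formula of Rodrigues. -/
lemma rodrigues_ode (l n : ℕ) :
    (X ^ 2 - 1) * derivative^[n + 2] ((X ^ 2 - 1 : ℝ[X]) ^ l)
      + C (2 * ((n : ℝ) + 1)) * X * derivative^[n + 1] ((X ^ 2 - 1 : ℝ[X]) ^ l)
      + C ((n : ℝ) * (n + 1)) * derivative^[n] ((X ^ 2 - 1 : ℝ[X]) ^ l)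
    = C (2 * (l : ℝ)) * (X * derivative^[n + 1] ((X ^ 2 - 1 : ℝ[X]) ^ l)
      + C ((n : ℝ) + 1) * derivative^[n] ((X ^ 2 - 1 : ℝ[X]) ^ l)) := by
  induction n with
  | zero =>
    have h0 : (X ^ 2 - 1) * derivative ((X ^ 2 - 1 : ℝ[X]) ^ l)
        = C (2 * (l : ℝ)) * (X * (X ^ 2 - 1 : ℝ[X]) ^ l) := by
      cases l with
      | zero => simp
      | succ k =>
        rw [derivative_pow_succ]
        simp only [derivative_sub, derivative_pow, derivative_X, derivative_one, map_mul, map_add,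
          map_natCast, map_ofNat, Nat.cast_add, Nat.cast_one, map_one]
        simp
        ring
    generalize (X ^ 2 - 1 : ℝ[X]) ^ l = w at h0 ⊢
    have h1 := congrArg derivative h0
    simp only [derivative_mul, derivative_sub, derivative_pow, derivative_X, derivative_one,
      derivative_C] at h1
    have hC : (C 2 : ℝ[X]) = 2 := rfl
    simp [hC] at h1 ⊢
    linear_combination h1
  | succ n ih =>
    have h1 := congrArg derivative ih
    simp only [derivative_mul, derivative_add, derivative_sub, derivative_X, derivative_one,
      derivative_C, ← Function.iterate_succ_apply' derivative, derivative_X_pow] at h1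
    simp only [map_add, map_mul, map_natCast, map_one, map_ofNat, Nat.cast_add, Nat.cast_one,
      Nat.succ_eq_add_one] at h1 ⊢
    simp at h1 ⊢
    linear_combination h1

/-- The differential equation of the associated Legendre functions. -/
lemma legD_ode (l m : ℕ) (z : ℝ) :
    (1 - z ^ 2) * (legD l (m + 2)).eval z - 2 * (m + 1) * z * (legD l (m + 1)).eval z
      + ((l : ℝ) * (l + 1) - m * (m + 1)) * (legD l m).eval z = 0 := by
  have h1 : ∀ k, legD l k = Polynomial.C (1 / (2 ^ l * (l.factorial : ℝ))) *
      Polynomial.derivative^[k + l] ((Polynomial.X ^ 2 - 1) ^ l) := by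
    intro k
    rw [legD, legendre, Polynomial.iterate_derivative_C_mul, Function.iterate_add_apply]
  have h2 := congrArg (Polynomial.eval z) (rodrigues_ode l (m + l))
  rw [h1, h1, h1, show m + 2 + l = m + l + 2 by ring, show m + 1 + l = m + l + 1 by ring]
  simp only [Polynomial.eval_mul, Polynomial.eval_add, Polynomial.eval_sub, Polynomial.eval_pow,
    Polynomial.eval_X, Polynomial.eval_one, Polynomial.eval_C, Nat.cast_add] at h2 ⊢
  linear_combination -(1 / (2 ^ l * (l.factorial : ℝ))) * h2

lemma legD_self (l : ℕ) :
    legD l l = Polynomial.C (((2 * l).factorial : ℝ) / (2 ^ l * (l.factorial : ℝ))) := by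
  rw [legD, legendre, Polynomial.iterate_derivative_C_mul, ← Function.iterate_add_apply]
  have hm : ((Polynomial.X ^ 2 - 1 : Polynomial ℝ)).Monic := by
    simpa using Polynomial.monic_X_pow_sub_C (1 : ℝ) (two_ne_zero)
  have hd : ((Polynomial.X ^ 2 - 1 : Polynomial ℝ) ^ l).natDegree = l + l := by
    rw [hm.natDegree_pow, show (Polynomial.X ^ 2 - 1 : Polynomial ℝ).natDegree = 2 by
      simpa using Polynomial.natDegree_X_pow_sub_C (n := 2) (r := (1 : ℝ))]
    ring
  have hc : ((Polynomial.X ^ 2 - 1 : Polynomial ℝ) ^ l).coeff (l + l) = 1 := by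
    rw [← hd]
    exact (hm.pow l).coeff_natDegree
  have h1 : Polynomial.derivative^[l + l] ((Polynomial.X ^ 2 - 1 : Polynomial ℝ) ^ l)
      = Polynomial.C (((2 * l).factorial : ℝ)) := by
    rw [Polynomial.eq_C_of_natDegree_le_zero
      ((Polynomial.natDegree_iterate_derivative _ _).trans (by rw [hd, Nat.sub_self])),
      Polynomial.coeff_iterate_derivative, zero_add, hc, Nat.descFactorial_self, two_mul]
    simp
  rw [h1, ← Polynomial.C_mul]
  congr 1
  ring

lemma one_sub_sq_mul_derivative_pow (m : ℕ) :
    (1 - Polynomial.X ^ 2) * Polynomial.derivative ((1 - Polynomial.X ^ 2 : Polynomial ℝ) ^ m)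
      = Polynomial.C (-2 * (m : ℝ)) * (Polynomial.X * (1 - Polynomial.X ^ 2) ^ m) := by
  have hC : (Polynomial.C 2 : Polynomial ℝ) = 2 := rfl
  cases m with
  | zero => simp
  | succ k =>
    rw [Polynomial.derivative_pow_succ]
    simp [hC]
    ring

/-! ### Integrals of functions of the height -/

/-- A polynomial in the height `x₃`. -/
def zpol (p : Polynomial ℝ) (x : S2) : ℝ := p.eval ((x : E3) 2)

lemma smooth_zpol (p : Polynomial ℝ) : Smooth (zpol p) :=
  Smooth.restrict (g := fun y : E3 => p.eval (y 2))
    ((Polynomial.contDiff_aeval p ∞).comp (by fun_prop : ContDiff ℝ ∞ fun y : E3 => y 2))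

lemma pd_zpol (p : Polynomial ℝ) (x : S2) (i : Fin 3) :
    pd (zpol p) x i = zpol p.derivative x * proj x i 2 := by
  have h1 : HasFDerivAt (fun y : E3 => p.eval (y 2))
      (p.derivative.eval ((x : E3) 2) • (EuclideanSpace.proj (𝕜 := ℝ) (ι := Fin 3) 2 : E3 →L[ℝ] ℝ))
      (x : E3) :=
    (p.hasDerivAt _).comp_hasFDerivAt (x : E3)
      (EuclideanSpace.proj (𝕜 := ℝ) (ι := Fin 3) 2 : E3 →L[ℝ] ℝ).hasFDerivAt
  have h2 := pd_restrict (G := fun y : E3 => p.eval (y 2)) x h1.differentiableAt i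
  have h3 : pd (zpol p) x i = _ := h2
  rw [h3, h1.fderiv]
  simp [zpol, mul_comm]

/-- The integral over the sphere of a polynomial in the height. -/
def zint (p : Polynomial ℝ) : ℝ := ∫ x, zpol p x ∂surf

lemma zint_add (p q : Polynomial ℝ) : zint (p + q) = zint p + zint q := by
  unfold zint
  rw [← integral_add (smooth_zpol p).integrable (smooth_zpol q).integrable]
  simp [zpol]

lemma zint_C_mul (c : ℝ) (p : Polynomial ℝ) : zint (Polynomial.C c * p) = c * zint p := by
  unfold zint
  rw [← integral_const_mul]
  simp [zpol]

/-- Integration by parts against the measure of the height: the divergence theorem for the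
tangential part of the vertical direction. -/
lemma zint_derivative (q : Polynomial ℝ) :
    zint ((1 - Polynomial.X ^ 2) * q.derivative) = 2 * zint (Polynomial.X * q) := by
  have h := integral_pd (smooth_zpol q) 2
  unfold zint
  rw [show (∫ x, zpol (Polynomial.X * q) x ∂surf) = ∫ x : S2, (x : E3) 2 * zpol q x ∂surf by
    simp [zpol], ← h]
  congr 1
  ext x
  rw [pd_zpol]
  simp [zpol, proj]
  ring

lemma zint_one_sub_sq_pow (l : ℕ) :
    zint ((1 - Polynomial.X ^ 2) ^ l) * ((2 * l + 1).factorial : ℝ)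
      = 4 * Real.pi * (2 ^ l * (l.factorial : ℝ)) ^ 2 := by
  induction l with
  | zero => simp [zint, zpol, surf_univ]
  | succ l ih =>
    -- integration by parts gives `(2 l + 3) I (l + 1) = 2 (l + 1) I l`
    have h1 := zint_derivative (Polynomial.X * (1 - Polynomial.X ^ 2) ^ l)
    have h2 : zint ((1 - Polynomial.X ^ 2) ^ (l + 1)) * (2 * l + 3)
        = 2 * (l + 1) * zint ((1 - Polynomial.X ^ 2) ^ l) := by
      have e1 : (1 - Polynomial.X ^ 2) * Polynomial.derivative
          (Polynomial.X * (1 - Polynomial.X ^ 2 : Polynomial ℝ) ^ l)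
          = Polynomial.C (2 * (l : ℝ) + 1) * (1 - Polynomial.X ^ 2) ^ (l + 1)
            + Polynomial.C (-2 * (l : ℝ)) * (1 - Polynomial.X ^ 2) ^ l := by
        have e := one_sub_sq_mul_derivative_pow l
        have hC : (Polynomial.C 2 : Polynomial ℝ) = 2 := rfl
        rw [Polynomial.derivative_mul, Polynomial.derivative_X]
        simp [hC] at e ⊢
        linear_combination Polynomial.X * e
      have e2 : Polynomial.X * (Polynomial.X * (1 - Polynomial.X ^ 2 : Polynomial ℝ) ^ l)
          = (1 - Polynomial.X ^ 2) ^ l + Polynomial.C (-1) * (1 - Polynomial.X ^ 2) ^ (l + 1) := by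
        simp
        ring
      rw [e1, e2, zint_add, zint_add, zint_C_mul, zint_C_mul, zint_C_mul] at h1
      linear_combination h1
    rw [show 2 * (l + 1) + 1 = (2 * l + 1) + 1 + 1 by ring, Nat.factorial_succ, Nat.factorial_succ,
      Nat.factorial_succ l]
    push_cast
    linear_combination (2 * (l : ℝ) + 2) * ((2 * l + 1).factorial : ℝ) * h2
      + 4 * ((l : ℝ) + 1) ^ 2 * ih

/-- The weighted square integral of an associated Legendre function. -/
def legN (l m : ℕ) : ℝ := zint ((1 - Polynomial.X ^ 2) ^ m * legD l m ^ 2)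

/-- Raising the order of the associated Legendre functions, from the differential equation and
integration by parts. -/
lemma legN_succ (l m : ℕ) :
    legN l (m + 1) = ((l : ℝ) * (l + 1) - m * (m + 1)) * legN l m := by
  have h1 := zint_derivative ((1 - Polynomial.X ^ 2) ^ m * legD l (m + 1) * legD l m)
  have e1 : (1 - Polynomial.X ^ 2) * Polynomial.derivative
      ((1 - Polynomial.X ^ 2) ^ m * legD l (m + 1) * legD l m)
      = Polynomial.C 2 * (Polynomial.X * ((1 - Polynomial.X ^ 2) ^ m * legD l (m + 1) * legD l m))
        + ((1 - Polynomial.X ^ 2) ^ (m + 1) * legD l (m + 1) ^ 2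
        + Polynomial.C (-((l : ℝ) * (l + 1) - m * (m + 1))) *
          ((1 - Polynomial.X ^ 2) ^ m * legD l m ^ 2)) := by
    refine Polynomial.funext fun z => ?_
    have e := congrArg (Polynomial.eval z) (one_sub_sq_mul_derivative_pow m)
    have h2 := legD_ode l m z
    rw [Polynomial.derivative_mul, Polynomial.derivative_mul, derivative_legD, derivative_legD]
    simp only [Polynomial.eval_mul, Polynomial.eval_add, Polynomial.eval_sub, Polynomial.eval_pow,
      Polynomial.eval_X, Polynomial.eval_one, Polynomial.eval_C] at e ⊢
    linear_combination (legD l (m + 1)).eval z * (legD l m).eval z * e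
      + (1 - z ^ 2) ^ m * (legD l m).eval z * h2
  rw [e1, zint_add, zint_add, zint_C_mul, zint_C_mul] at h1
  unfold legN
  linear_combination h1

/-- The norms of the associated Legendre functions. The recursion in the order connects `m` with `0`
and with `l`, and for `m = l` the derivative `legD l l` is constant. -/
lemma legN_eq (l m : ℕ) (hm : m ≤ l) :
    (2 * l + 1) * ((l - m).factorial : ℝ) * legN l m = 4 * Real.pi * ((l + m).factorial : ℝ) := by
  have h1 : ∀ m ≤ l, ((l - m).factorial : ℝ) * legN l m
      = ((l + m).factorial : ℝ) * legN l 0 := by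
    intro m
    induction m with
    | zero => intro _; simp
    | succ m ih =>
      intro hm
      have ih := ih (by omega)
      rw [legN_succ]
      obtain ⟨k, rfl⟩ : ∃ k, l = m + 1 + k := ⟨l - (m + 1), by omega⟩
      rw [show m + 1 + k - m = k + 1 by omega, Nat.factorial_succ] at ih
      rw [show m + 1 + k - (m + 1) = k by omega,
        show m + 1 + k + (m + 1) = (m + 1 + k + m) + 1 by ring, Nat.factorial_succ]
      push_cast at ih ⊢
      linear_combination (2 * (m : ℝ) + 2 + k) * ih
  -- the value for `m = 0` is found from the one for `m = l`
  have h2 := h1 l le_rfl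
  have h3 : legN l l * (2 ^ l * (l.factorial : ℝ)) ^ 2 = ((2 * l).factorial : ℝ) ^ 2 *
      zint ((1 - Polynomial.X ^ 2) ^ l) := by
    have hf : (2 ^ l * (l.factorial : ℝ)) ≠ 0 := by positivity
    rw [legN, legD_self, ← Polynomial.C_pow, mul_comm _ (Polynomial.C _), zint_C_mul]
    field_simp
  have h4 := zint_one_sub_sq_pow l
  have h5 : (2 * l + 1) * legN l 0 = 4 * Real.pi := by
    have hf : (2 ^ l * (l.factorial : ℝ)) ≠ 0 := by positivity
    have hg : ((2 * l).factorial : ℝ) ≠ 0 := by positivity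
    rw [Nat.factorial_succ] at h4
    push_cast at h4
    rw [Nat.sub_self, Nat.factorial_zero, Nat.cast_one, one_mul, ← two_mul] at h2
    rw [h2] at h3
    have h6 : ((2 * l).factorial : ℝ) * (2 ^ l * (l.factorial : ℝ)) ^ 2 *
        ((2 * l + 1) * legN l 0 - 4 * Real.pi) = 0 := by
      linear_combination (2 * (l : ℝ) + 1) * h3 + ((2 * l).factorial : ℝ) * h4
    have h7 := (mul_eq_zero.1 h6).resolve_left (by positivity)
    linarith
  linear_combination (2 * (l : ℝ) + 1) * h1 m hm + ((l + m).factorial : ℝ) * h5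

/-! ### Spherical harmonics -/

/-- The sectoral harmonic `Re (x₁ + i x₂)^m`. -/
def reH (m : ℕ) (x : S2) : ℝ := ((((x : E3) 0 : ℂ) + (x : E3) 1 * Complex.I) ^ m).re

/-- The sectoral harmonic `Im (x₁ + i x₂)^m`. -/
def imH (m : ℕ) (x : S2) : ℝ := ((((x : E3) 0 : ℂ) + (x : E3) 1 * Complex.I) ^ m).im

lemma reH_zero (x : S2) : reH 0 x = 1 := by simp [reH]

lemma imH_zero (x : S2) : imH 0 x = 0 := by simp [imH]

lemma reH_succ (m : ℕ) (x : S2) :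
    reH (m + 1) x = (x : E3) 0 * reH m x - (x : E3) 1 * imH m x := by
  simp [reH, imH, pow_succ]
  ring

lemma imH_succ (m : ℕ) (x : S2) :
    imH (m + 1) x = (x : E3) 0 * imH m x + (x : E3) 1 * reH m x := by
  simp [reH, imH, pow_succ]
  ring

lemma smooth_reH_imH (m : ℕ) : Smooth (reH m) ∧ Smooth (imH m) := by
  induction m with
  | zero =>
    rw [funext reH_zero, funext imH_zero]
    exact ⟨Smooth.const 1, Smooth.const 0⟩
  | succ m ih =>
    rw [funext (reH_succ m), funext (imH_succ m)]
    exact ⟨((Smooth.coord 0).mul ih.1).sub ((Smooth.coord 1).mul ih.2),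
      ((Smooth.coord 0).mul ih.2).add ((Smooth.coord 1).mul ih.1)⟩

lemma smooth_reH (m : ℕ) : Smooth (reH m) := (smooth_reH_imH m).1

lemma smooth_imH (m : ℕ) : Smooth (imH m) := (smooth_reH_imH m).2

lemma pd_reH_imH (m : ℕ) (x : S2) (i : Fin 3) :
    pd (reH (m + 1)) x i = (m + 1) * (proj x i 0 * reH m x - proj x i 1 * imH m x) ∧
    pd (imH (m + 1)) x i = (m + 1) * (proj x i 0 * imH m x + proj x i 1 * reH m x) := by
  have h0 := Smooth.coord 0
  have h1 := Smooth.coord 1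
  have key : ∀ m, pd (reH (m + 1)) x i = proj x i 0 * reH m x + (x : E3) 0 * pd (reH m) x i
        - (proj x i 1 * imH m x + (x : E3) 1 * pd (imH m) x i) ∧
      pd (imH (m + 1)) x i = proj x i 0 * imH m x + (x : E3) 0 * pd (imH m) x i
        + (proj x i 1 * reH m x + (x : E3) 1 * pd (reH m) x i) := by
    intro m
    have hr := smooth_reH m
    have hi := smooth_imH m
    rw [funext (reH_succ m), funext (imH_succ m), pd_sub (h0.mul hr) (h1.mul hi),
      pd_add (h0.mul hi) (h1.mul hr), pd_mul h0 hr, pd_mul h1 hi, pd_mul h0 hi, pd_mul h1 hr,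
      pd_coord, pd_coord]
    exact ⟨rfl, rfl⟩
  induction m with
  | zero =>
    rw [(key 0).1, (key 0).2, funext reH_zero, funext imH_zero, pd_const, pd_const]
    constructor <;> simp
  | succ m ih =>
    rw [(key (m + 1)).1, (key (m + 1)).2, ih.1, ih.2, reH_succ, imH_succ]
    push_cast
    constructor <;> ring

/-- The sectoral harmonics are eigenfunctions, by induction on the degree from
`(x₁ + i x₂)^(m + 1) = (x₁ + i x₂) (x₁ + i x₂)^m`. -/
lemma slap_reH_imH (m : ℕ) (x : S2) :
    slap (reH m) x = -((m : ℝ) * (m + 1)) * reH m x ∧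
    slap (imH m) x = -((m : ℝ) * (m + 1)) * imH m x := by
  induction m with
  | zero =>
    rw [funext reH_zero, funext imH_zero]
    simp [slap, pd_const]
  | succ m ih =>
    have hr := smooth_reH m
    have hi := smooth_imH m
    have h0 := Smooth.coord 0
    have h1 := Smooth.coord 1
    have e : pd (reH m) x 0 - pd (imH m) x 1 = -(m : ℝ) * reH (m + 1) x ∧
        pd (imH m) x 0 + pd (reH m) x 1 = -(m : ℝ) * imH (m + 1) x := by
      cases m with
      | zero =>
        rw [funext reH_zero, funext imH_zero]
        simp [pd_const]
      | succ k =>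
        rw [(pd_reH_imH k x 0).1, (pd_reH_imH k x 1).2, (pd_reH_imH k x 0).2, (pd_reH_imH k x 1).1,
          reH_succ (k + 1), imH_succ (k + 1), reH_succ, imH_succ]
        simp [proj]
        constructor <;> ring
    have s1 : slap (reH (m + 1)) x = (-2 * (x : E3) 0 * reH m x + 2 * pd (reH m) x 0
        + (x : E3) 0 * (-((m : ℝ) * (m + 1)) * reH m x)) - (-2 * (x : E3) 1 * imH m x
        + 2 * pd (imH m) x 1 + (x : E3) 1 * (-((m : ℝ) * (m + 1)) * imH m x)) := by
      rw [funext (reH_succ m), slap_sub (h0.mul hr) (h1.mul hi), slap_coord_mul hr,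
        slap_coord_mul hi, ih.1, ih.2]
    have s2 : slap (imH (m + 1)) x = (-2 * (x : E3) 0 * imH m x + 2 * pd (imH m) x 0
        + (x : E3) 0 * (-((m : ℝ) * (m + 1)) * imH m x)) + (-2 * (x : E3) 1 * reH m x
        + 2 * pd (reH m) x 1 + (x : E3) 1 * (-((m : ℝ) * (m + 1)) * reH m x)) := by
      rw [funext (imH_succ m), slap_add (h0.mul hi) (h1.mul hr), slap_coord_mul hr,
        slap_coord_mul hi, ih.1, ih.2]
    rw [s1, s2]
    have r1 := reH_succ m x
    have r2 := imH_succ m x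
    push_cast
    constructor
    · linear_combination 2 * e.1 + ((m : ℝ) * (m + 1) + 2) * r1
    · linear_combination 2 * e.2 + ((m : ℝ) * (m + 1) + 2) * r2

lemma pd_two_reH_imH (m : ℕ) (x : S2) :
    pd (reH m) x 2 = -(m : ℝ) * (x : E3) 2 * reH m x ∧
    pd (imH m) x 2 = -(m : ℝ) * (x : E3) 2 * imH m x := by
  cases m with
  | zero =>
    rw [funext reH_zero, funext imH_zero]
    simp [pd_const]
  | succ k =>
    rw [(pd_reH_imH k x 2).1, (pd_reH_imH k x 2).2, reH_succ, imH_succ]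
    simp [proj]
    constructor <;> ring

lemma rot_reH_imH (m : ℕ) (x : S2) :
    rot 2 (reH m) x = m * imH m x ∧ rot 2 (imH m) x = -(m : ℝ) * reH m x := by
  cases m with
  | zero =>
    rw [funext reH_zero, funext imH_zero]
    simp [rot_two, pd_const]
  | succ k =>
    simp only [rot_two, fun i => (pd_reH_imH k x i).1, fun i => (pd_reH_imH k x i).2, reH_succ,
      imH_succ]
    simp [proj]
    constructor <;> ring

lemma reH_sq_add_imH_sq (m : ℕ) (x : S2) :
    reH m x ^ 2 + imH m x ^ 2 = (1 - (x : E3) 2 ^ 2) ^ m := by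
  have hx := sum_mul_self x
  rw [Fin.sum_univ_three] at hx
  induction m with
  | zero => simp [reH_zero, imH_zero]
  | succ m ih =>
    rw [pow_succ (1 - (x : E3) 2 ^ 2), ← ih, reH_succ, imH_succ]
    linear_combination (reH m x ^ 2 + imH m x ^ 2) * hx

lemma slap_zpol (p : Polynomial ℝ) (x : S2) :
    slap (zpol p) x = (1 - (x : E3) 2 ^ 2) * zpol p.derivative.derivative x
      - 2 * (x : E3) 2 * zpol p.derivative x := by
  have h1 : ∀ i, pd (fun y => pd (zpol p) y i) x i
      = zpol p.derivative.derivative x * proj x i 2 * proj x i 2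
        - zpol p.derivative x * (proj x i i * (x : E3) 2 + (x : E3) i * proj x i 2) := by
    intro i
    rw [show (fun y => pd (zpol p) y i) = fun y => zpol p.derivative y * proj y i 2 from
      funext fun y => pd_zpol p y i, pd_mul (smooth_zpol _) (Smooth.proj i 2), pd_zpol, pd_proj]
    ring
  have hx := sum_mul_self x
  simp only [slap, h1]
  simp only [Fin.sum_univ_three, proj] at *
  simp
  linear_combination (zpol p.derivative.derivative x * (x : E3) 2 ^ 2
    + 2 * zpol p.derivative x * (x : E3) 2) * hx

lemma slap_legD_mul {l m : ℕ} {h : S2 → ℝ} (hh : Smooth h) (x : S2)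
    (h1 : slap h x = -((m : ℝ) * (m + 1)) * h x) (h2 : pd h x 2 = -(m : ℝ) * (x : E3) 2 * h x) :
    slap (fun y => zpol (legD l m) y * h y) x
      = -((l : ℝ) * (l + 1)) * (zpol (legD l m) x * h x) := by
  rw [slap_mul (smooth_zpol _) hh, slap_zpol, h1]
  simp only [pd_zpol, mul_assoc, ← Finset.mul_sum]
  rw [sum_proj_pd hh, h2, derivative_legD, derivative_legD]
  have h3 := legD_ode l m ((x : E3) 2)
  simp only [zpol]
  linear_combination h x * h3

/-- The azimuthal factor of the real spherical harmonics. -/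
def azim (m : ℤ) : S2 → ℝ := if 0 ≤ m then reH m.natAbs else imH m.natAbs

lemma smooth_azim (m : ℤ) : Smooth (azim m) := by
  unfold azim
  split_ifs
  exacts [smooth_reH _, smooth_imH _]

lemma sval_Y (l : ℕ) (m : ℤ) (x : S2) :
    sval (Y l m) x = shConst l m.natAbs * (zpol (legD l m.natAbs) x * azim m x) := by
  change shFun l m x = _
  unfold shFun azim reH imH zpol legD
  split_ifs <;> ring

lemma slap_Y (l : ℕ) (m : ℤ) (x : S2) :
    slap (sval (Y l m)) x = -((l : ℝ) * (l + 1)) * sval (Y l m) x := by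
  rw [funext (sval_Y l m), slap_const_mul _ ((smooth_zpol _).mul (smooth_azim m)),
    slap_legD_mul (smooth_azim m)]
  · ring
  · unfold azim
    split_ifs
    exacts [(slap_reH_imH _ x).1, (slap_reH_imH _ x).2]
  · unfold azim
    split_ifs
    exacts [(pd_two_reH_imH _ x).1, (pd_two_reH_imH _ x).2]

lemma rot_const_mul (c : ℝ) {h : S2 → ℝ} (hh : Smooth h) (i : Fin 3) (x : S2) :
    rot i (fun y => c * h y) x = c * rot i h x := by
  simp only [rot, pd_const_mul c hh, mul_left_comm _ c, ← Finset.mul_sum]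

lemma rot_zpol (p : Polynomial ℝ) (x : S2) : rot 2 (zpol p) x = 0 := by
  rw [rot_two, pd_zpol, pd_zpol]
  simp [proj]
  ring

/-- The rotation about the vertical axis exchanges the real harmonics of orders `m` and `-m`. -/
lemma rot_Y (l : ℕ) (m : ℤ) (x : S2) : rot 2 (sval (Y l m)) x = m * sval (Y l (-m)) x := by
  rw [funext (sval_Y l m), rot_const_mul _ ((smooth_zpol _).mul (smooth_azim m)),
    rot_mul (smooth_zpol _) (smooth_azim m), rot_zpol, sval_Y, Int.natAbs_neg]
  have h1 : rot 2 (azim m) x = m * azim (-m) x := by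
    unfold azim
    rcases lt_trichotomy m 0 with h | h | h
    · rw [if_neg (by omega), if_pos (by omega), (rot_reH_imH _ x).2, Int.natAbs_neg]
      rw [Nat.cast_natAbs, abs_of_neg h]
      simp
    · subst h
      simp [funext reH_zero, rot_two, pd_const]
    · rw [if_pos h.le, if_neg (by omega), (rot_reH_imH _ x).1, Int.natAbs_neg]
      rw [Nat.cast_natAbs, abs_of_pos h]
  rw [h1]
  ring

lemma integral_slap_symm {g h : S2 → ℝ} (hg : Smooth g) (hh : Smooth h) :
    ∫ x, slap g x * h x ∂surf = ∫ x, g x * slap h x ∂surf := by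
  have h1 := integral_pd_mul_pd hg hh
  have h2 := integral_pd_mul_pd hh hg
  simp only [mul_comm (pd h _ _)] at h2
  rw [h1] at h2
  simp only [mul_comm (h _)] at h2
  linarith

lemma toDist_Y_of_ne {l l' : ℕ} (hl : l ≠ l') (m m' : ℤ) : toDist (Y l m) (Y l' m') = 0 := by
  have h1 := integral_slap_symm (smooth_sval (Y l m)) (smooth_sval (Y l' m'))
  simp only [slap_Y, mul_assoc, mul_left_comm (sval (Y l m) _) (-_), integral_const_mul] at h1
  rw [toDist_zero_apply]
  have h2 : ((l' : ℝ) - l) * (l + l' + 1) * ∫ x, sval (Y l m) x * sval (Y l' m') x ∂surf = 0 := by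
    linear_combination h1
  have h3 : ((l' : ℝ) - l) ≠ 0 := sub_ne_zero.2 (by exact_mod_cast hl.symm)
  exact (mul_eq_zero.1 h2).resolve_left (mul_ne_zero h3 (by positivity))

/-- Rotations are antisymmetric with respect to the `L²` product. -/
lemma rot_Y_pairing (l : ℕ) (m m' : ℤ) :
    (m : ℝ) * toDist (Y l (-m)) (Y l m') = -((m' : ℝ) * toDist (Y l m) (Y l (-m'))) := by
  have h1 := integral_rot_mul (smooth_sval (Y l m)) (smooth_sval (Y l m')) 2
  simp only [rot_Y, mul_assoc, mul_left_comm (sval (Y l m) _) (m' : ℝ), integral_const_mul] at h1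
  rw [toDist_zero_apply, toDist_zero_apply, h1]

/-- Applied twice, the antisymmetry of rotations gives `(m² - m'²) ⟨Y l m, Y l m'⟩ = 0`; for
`m' = -m` it is used once. -/
lemma toDist_Y_of_ne' (l : ℕ) {m m' : ℤ} (hm : m ≠ m') : toDist (Y l m) (Y l m') = 0 := by
  have h1 := rot_Y_pairing l (-m) m'
  have h2 := rot_Y_pairing l m (-m')
  rw [neg_neg] at h1 h2
  push_cast at h1 h2
  rcases eq_or_ne m' (-m) with h | h
  · subst h
    have h3 := rot_Y_pairing l m m
    rw [toDist_comm] at h3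
    have hm0 : (m : ℝ) ≠ 0 := by
      intro h0
      have : m = 0 := by exact_mod_cast h0
      omega
    have h4 : (m : ℝ) * toDist (Y l m) (Y l (-m)) = 0 := by linarith
    exact (mul_eq_zero.1 h4).resolve_left hm0
  · have h3 : ((m : ℝ) - m') * (m + m') * toDist (Y l m) (Y l m') = 0 := by
      linear_combination -(m : ℝ) * h1 + (m' : ℝ) * h2
    refine (mul_eq_zero.1 h3).resolve_left (mul_ne_zero ?_ ?_)
    · exact sub_ne_zero.2 (by exact_mod_cast hm)
    · intro h0
      have : m + m' = 0 := by exact_mod_cast h0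
      omega

/-- The harmonics of orders `m` and `-m` have the same norm, and the sum of their squares is a
function of the height. -/
lemma toDist_Y_self {l : ℕ} {m : ℤ} (hm : m.natAbs ≤ l) : toDist (Y l m) (Y l m) = 1 := by
  have hN := legN_eq l m.natAbs hm
  have hc : shConst l m.natAbs ^ 2 = (if m = 0 then 1 else 2) * ((2 * l + 1) / (4 * Real.pi) *
      (((l - m.natAbs).factorial : ℝ) / ((l + m.natAbs).factorial : ℝ))) := by
    unfold shConst
    rw [mul_pow, Real.sq_sqrt (by positivity)]
    simp only [Int.natAbs_eq_zero]
    split_ifs <;> simp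
  have hcN : shConst l m.natAbs ^ 2 * legN l m.natAbs = if m = 0 then 1 else 2 := by
    rw [hc]
    have := Real.pi_pos
    field_simp
    linear_combination hN
  have hsum : ∀ k : ℕ,
      ∫ x, (zpol (legD l k) x * reH k x) ^ 2 + (zpol (legD l k) x * imH k x) ^ 2 ∂surf
      = legN l k := by
    intro k
    unfold legN zint
    congr 1
    ext x
    rw [mul_pow, mul_pow, ← mul_add, reH_sq_add_imH_sq]
    simp [zpol]
    ring
  rcases eq_or_ne m 0 with h | h
  · subst h
    rw [if_pos rfl, Int.natAbs_zero, ← hsum, ← integral_const_mul] at hcN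
    rw [toDist_zero_apply, ← hcN]
    congr 1
    ext x
    simp [sval_Y, azim, imH_zero]
    ring
  · have h1 := rot_Y_pairing l (-m) m
    rw [neg_neg] at h1
    have h2 : toDist (Y l m) (Y l m) = toDist (Y l (-m)) (Y l (-m)) := by
      have hm0 : (m : ℝ) ≠ 0 := by exact_mod_cast h
      push_cast at h1
      exact mul_left_cancel₀ hm0 (by linarith)
    have h3 : toDist (Y l m) (Y l m) + toDist (Y l (-m)) (Y l (-m)) = 2 := by
      rw [if_neg h] at hcN
      rw [← hcN, ← hsum, toDist_zero_apply, toDist_zero_apply,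
        ← integral_add ((smooth_sval _).mul (smooth_sval _)).integrable
          ((smooth_sval _).mul (smooth_sval _)).integrable, ← integral_const_mul]
      congr 1
      ext x
      simp only [sval_Y, Int.natAbs_neg, azim]
      rcases lt_or_gt_of_ne h with h | h
      · rw [if_neg (by omega), if_pos (by omega)]
        ring
      · rw [if_pos (by omega), if_neg (by omega)]
        ring
    linarith

lemma mem_ms {l : ℕ} {m : ℤ} : m ∈ ms l ↔ m.natAbs ≤ l := by
  rw [ms, Finset.mem_Icc]
  omega

/-! ### Vector and tensor harmonics -/

/-- Minus the eigenvalue of the Laplacian on the spherical harmonics of degree `l`. -/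
def lam (l : ℕ) : ℝ := (l : ℝ) * (l + 1)

/-- The eigenvalue of `D₂ D₂^*` on the vector harmonics of degree `l`. -/
def mu (l : ℕ) : ℝ := (1 / 2 : ℝ) * l * (l + 1) - 1

lemma lam_pos {l : ℕ} (hl : 1 ≤ l) : 0 < lam l := by
  have : (1 : ℝ) ≤ l := by exact_mod_cast hl
  unfold lam
  positivity

lemma mu_pos {l : ℕ} (hl : 2 ≤ l) : 0 < mu l := by
  have : (2 : ℝ) ≤ l := by exact_mod_cast hl
  unfold mu
  nlinarith

lemma div_cov_Y (l : ℕ) (m : ℤ) : div 0 (cov 0 (Y l m)) = (-lam l) • Y l m :=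
  ext_sval fun x => by rw [sval_div_cov, slap_Y, sval_smul, lam]

lemma vecE_eq (l : ℕ) (m : ℤ) : vecE l m = (-(√(lam l))⁻¹) • cov 0 (Y l m) := by
  unfold vecE D1star lam
  rw [map_zero, map_zero, add_zero, smul_neg]
  exact (neg_smul _ _).symm

lemma vecH_eq (l : ℕ) (m : ℤ) : vecH l m = (√(lam l))⁻¹ • star (cov 0 (Y l m)) := by
  unfold vecH D1star lam
  rw [map_zero, neg_zero, zero_add]

lemma tenE_eq (l : ℕ) (m : ℤ) : tenE l m = (√(mu l))⁻¹ • D2star (vecE l m) := rfl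

lemma tenH_eq (l : ℕ) (m : ℤ) : tenH l m = (√(mu l))⁻¹ • D2star (vecH l m) := rfl

lemma div_vecE (l : ℕ) (m : ℤ) : div 0 (vecE l m) = √(lam l) • Y l m := by
  rw [vecE_eq, map_smul, div_cov_Y, smul_smul]
  congr 1
  rw [neg_mul_neg, mul_comm, ← div_eq_mul_inv, Real.div_sqrt]

lemma div_vecH (l : ℕ) (m : ℤ) : div 0 (vecH l m) = 0 := by
  rw [vecH_eq, map_smul, div_star_cov, smul_zero]

lemma eigen_aux (l : ℕ) (m : ℤ) :
    div 0 (cov 0 (Y l m)) + (2 : ℝ) • Y l m = (-2 * mu l) • Y l m := by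
  rw [div_cov_Y, ← add_smul]
  congr 1
  unfold lam mu
  ring

lemma D2_D2star_vecE (l : ℕ) (m : ℤ) : D2 (D2star (vecE l m)) = mu l • vecE l m := by
  rw [vecE_eq, map_smul, map_smul, D2_D2star_cov, eigen_aux, map_smul, smul_smul, smul_smul,
    smul_smul]
  congr 1
  ring

lemma D2_D2star_vecH (l : ℕ) (m : ℤ) : D2 (D2star (vecH l m)) = mu l • vecH l m := by
  rw [vecH_eq, map_smul, map_smul, D2_D2star_star_cov, eigen_aux, map_smul, map_smul, smul_smul,
    smul_smul, smul_smul]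
  congr 1
  ring

lemma D2_tenE (l : ℕ) (m : ℤ) : D2 (tenE l m) = √(mu l) • vecE l m := by
  rw [tenE_eq, map_smul, D2_D2star_vecE, smul_smul, mul_comm, ← div_eq_mul_inv, Real.div_sqrt]

lemma D2_tenH (l : ℕ) (m : ℤ) : D2 (tenH l m) = √(mu l) • vecH l m := by
  rw [tenH_eq, map_smul, D2_D2star_vecH, smul_smul, mul_comm, ← div_eq_mul_inv, Real.div_sqrt]

lemma D2star_D2_tenE {l : ℕ} (hl : 2 ≤ l) (m : ℤ) : D2star (D2 (tenE l m)) = mu l • tenE l m := by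
  have h := mu_pos hl
  rw [D2_tenE, map_smul, tenE_eq, smul_smul]
  congr 1
  rw [← div_eq_mul_inv, Real.div_sqrt]

lemma toDist_vecE_left (l : ℕ) (m : ℤ) (V : Tens 1) :
    toDist (vecE l m) V = (√(lam l))⁻¹ * toDist (Y l m) (div 0 V) := by
  rw [vecE_eq, map_smul, LinearMap.smul_apply, toDist_cov, smul_eq_mul]
  ring

lemma toDist_vecE {l : ℕ} (hl : 1 ≤ l) (l' : ℕ) (m m' : ℤ) :
    toDist (vecE l m) (vecE l' m') = toDist (Y l m) (Y l' m') := by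
  rw [toDist_vecE_left, div_vecE, map_smul, smul_eq_mul, ← mul_assoc]
  rcases eq_or_ne l l' with h | h
  · subst h
    rw [inv_mul_cancel₀ (Real.sqrt_pos.2 (lam_pos hl)).ne', one_mul]
  · rw [toDist_Y_of_ne h, mul_zero]

lemma toDist_vecE_vecH (l l' : ℕ) (m m' : ℤ) : toDist (vecE l m) (vecH l' m') = 0 := by
  rw [toDist_vecE_left, div_vecH, map_zero, mul_zero]

lemma toDist_star_star_cov (f g : Tens 0) :
    toDist (star (cov 0 f)) (star (cov 0 g)) = toDist (cov 0 f) (cov 0 g) := by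
  rw [toDist_one_apply, toDist_one_apply]
  congr 1
  ext x
  simp only [comp1_star_cov, comp1_cov]
  exact sum_rot_mul_rot (smooth_sval f) (smooth_sval g) x

lemma toDist_vecH {l : ℕ} (hl : 1 ≤ l) (l' : ℕ) (m m' : ℤ) :
    toDist (vecH l m) (vecH l' m') = toDist (Y l m) (Y l' m') := by
  rw [← toDist_vecE hl l', vecE_eq, vecE_eq, vecH_eq, vecH_eq]
  simp only [map_smul, LinearMap.smul_apply, toDist_star_star_cov, smul_eq_mul]
  ring

lemma toDistS_tenE_left (l : ℕ) (m : ℤ) (W : STF) :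
    toDistS (tenE l m) W = (√(mu l))⁻¹ * toDist (vecE l m) (D2 W) := by
  rw [tenE_eq, map_smul, LinearMap.smul_apply, toDistS_D2star, smul_eq_mul]

lemma toDistS_tenH_left (l : ℕ) (m : ℤ) (W : STF) :
    toDistS (tenH l m) W = (√(mu l))⁻¹ * toDist (vecH l m) (D2 W) := by
  rw [tenH_eq, map_smul, LinearMap.smul_apply, toDistS_D2star, smul_eq_mul]

lemma toDistS_tenE {l : ℕ} (hl : 2 ≤ l) (l' : ℕ) (m m' : ℤ) :
    toDistS (tenE l m) (tenE l' m') = toDist (Y l m) (Y l' m') := by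
  rw [toDistS_tenE_left, D2_tenE, map_smul, smul_eq_mul, ← mul_assoc,
    toDist_vecE (by omega)]
  rcases eq_or_ne l l' with h | h
  · subst h
    rw [inv_mul_cancel₀ (Real.sqrt_pos.2 (mu_pos hl)).ne', one_mul]
  · rw [toDist_Y_of_ne h, mul_zero]

lemma toDistS_tenH {l : ℕ} (hl : 2 ≤ l) (l' : ℕ) (m m' : ℤ) :
    toDistS (tenH l m) (tenH l' m') = toDist (Y l m) (Y l' m') := by
  rw [toDistS_tenH_left, D2_tenH, map_smul, smul_eq_mul, ← mul_assoc,
    toDist_vecH (by omega)]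
  rcases eq_or_ne l l' with h | h
  · subst h
    rw [inv_mul_cancel₀ (Real.sqrt_pos.2 (mu_pos hl)).ne', one_mul]
  · rw [toDist_Y_of_ne h, mul_zero]

lemma toDistS_tenE_tenH (l l' : ℕ) (m m' : ℤ) : toDistS (tenE l m) (tenH l' m') = 0 := by
  rw [toDistS_tenE_left, D2_tenH, map_smul, toDist_vecE_vecH, smul_zero, mul_zero]

lemma toDistS_tenH_tenE (l l' : ℕ) (m m' : ℤ) : toDistS (tenH l m) (tenE l' m') = 0 := by
  rw [toDistS_comm, toDistS_tenE_tenH]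

lemma toDist_Y {l : ℕ} {m m' : ℤ} (hm : m ∈ ms l) :
    toDist (Y l m) (Y l m') = if m = m' then 1 else 0 := by
  split_ifs with h
  · rw [← h, toDist_Y_self (mem_ms.1 hm)]
  · exact toDist_Y_of_ne' l h

/-! ### The charge with `l = 2` -/

lemma mode2_mem (W : DistSTF) : mode2 2 W ∈ Submodule.span ℝ
    {W : DistSTF | ∃ m ∈ ms 2, W = toDistS (tenE 2 m) ∨ W = toDistS (tenH 2 m)} := by
  refine Submodule.sum_mem _ fun m hm => Submodule.add_mem _ ?_ ?_
  · exact Submodule.smul_mem _ _ (Submodule.subset_span ⟨m, hm, Or.inl rfl⟩)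
  · exact Submodule.smul_mem _ _ (Submodule.subset_span ⟨m, hm, Or.inr rfl⟩)

lemma mode2_add (l : ℕ) (V W : DistSTF) : mode2 l (V + W) = mode2 l V + mode2 l W := by
  simp only [mode2, LinearMap.add_apply, add_smul, ← Finset.sum_add_distrib]
  exact Finset.sum_congr rfl fun m _ => by abel

lemma mode2_smul (l : ℕ) (c : ℝ) (W : DistSTF) : mode2 l (c • W) = c • mode2 l W := by
  simp only [mode2, LinearMap.smul_apply, smul_eq_mul, Finset.smul_sum, smul_add, smul_smul]

lemma mode2_zero (l : ℕ) : mode2 l 0 = 0 := by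
  simp [mode2]

lemma mode2_tenE {m : ℤ} (hm : m ∈ ms 2) : mode2 2 (toDistS (tenE 2 m)) = toDistS (tenE 2 m) := by
  simp only [mode2, toDistS_tenE le_rfl, toDistS_tenE_tenH, toDist_Y hm, zero_smul, add_zero,
    ite_smul, one_smul]
  rw [Finset.sum_ite_eq, if_pos hm]

lemma mode2_tenH {m : ℤ} (hm : m ∈ ms 2) : mode2 2 (toDistS (tenH 2 m)) = toDistS (tenH 2 m) := by
  simp only [mode2, toDistS_tenH le_rfl, toDistS_tenH_tenE, toDist_Y hm, zero_smul, zero_add,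
    ite_smul, one_smul]
  rw [Finset.sum_ite_eq, if_pos hm]

lemma mode2_of_mem {W : DistSTF} (hW : W ∈ Submodule.span ℝ
    {W : DistSTF | ∃ m ∈ ms 2, W = toDistS (tenE 2 m) ∨ W = toDistS (tenH 2 m)}) :
    mode2 2 W = W := by
  induction hW using Submodule.span_induction with
  | mem W h =>
    obtain ⟨m, hm, rfl | rfl⟩ := h
    exacts [mode2_tenE hm, mode2_tenH hm]
  | zero => exact mode2_zero 2
  | add V W _ _ h1 h2 => rw [mode2_add, h1, h2]
  | smul c W _ h => rw [mode2_smul, h]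

lemma range_chargeDbalbTwo : Set.range (chargeDbalbTwo 2) =
    (Submodule.span ℝ {W : DistSTF | ∃ m ∈ ms 2, W = toDistS (tenE 2 m) ∨
      W = toDistS (tenH 2 m)} : Set DistSTF) := by
  ext W
  constructor
  · rintro ⟨X, rfl⟩
    exact mode2_mem _
  · intro hW
    -- the only nonzero component is `D_ α_`, which enters the charge with the factor `1 / 2`
    refine ⟨⟨0, 0, 0, 0, 0, 0, 0, 0, 0, 0, 0, 0, 0, 0, 0, 0, 0, (2 : ℝ) • W⟩, ?_⟩
    have h0 : dD2s (ddivS (0 : DistSTF)) = 0 := rfl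
    simp only [chargeDbalbTwo, h0, smul_zero, sub_zero, add_zero, smul_smul]
    rw [show (1 / 2 * 2 : ℝ) = 1 by norm_num, one_smul]
    exact mode2_of_mem hW

/-- There are five electric and five magnetic modes with `l = 2`, and they are orthonormal. -/
lemma finrank_span_tensor_modes : Module.finrank ℝ (Submodule.span ℝ {W : DistSTF | ∃ m ∈ ms 2,
    W = toDistS (tenE 2 m) ∨ W = toDistS (tenH 2 m)}) = 10 := by
  let b : (ms 2) ⊕ (ms 2) → DistSTF :=
    Sum.elim (fun m => toDistS (tenE 2 m)) (fun m => toDistS (tenH 2 m))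
  have hb : {W : DistSTF | ∃ m ∈ ms 2, W = toDistS (tenE 2 m) ∨ W = toDistS (tenH 2 m)}
      = Set.range b := by
    ext W
    simp only [Set.mem_ofPred_eq, Set.mem_range, Sum.exists, Subtype.exists, b, Sum.elim_inl,
      Sum.elim_inr]
    constructor
    · rintro ⟨m, hm, rfl | rfl⟩
      exacts [Or.inl ⟨m, hm, rfl⟩, Or.inr ⟨m, hm, rfl⟩]
    · rintro (⟨m, hm, rfl⟩ | ⟨m, hm, rfl⟩)
      exacts [⟨m, hm, Or.inl rfl⟩, ⟨m, hm, Or.inr rfl⟩]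
  have hli : LinearIndependent ℝ b := by
    rw [Fintype.linearIndependent_iff]
    intro g hg
    rw [Fintype.sum_sum_type] at hg
    have key : ∀ W : STF, ∑ m : ms 2, g (Sum.inl m) * toDistS (tenE 2 m) W
        + ∑ m : ms 2, g (Sum.inr m) * toDistS (tenH 2 m) W = 0 := by
      intro W
      have := congrArg (fun T : DistSTF => T W) hg
      simpa [b, LinearMap.sum_apply] using this
    rintro (m | m)
    · have := key (tenE 2 m)
      simp only [toDistS_tenE le_rfl, toDistS_tenH_tenE,
        fun (i : ms 2) m' => toDist_Y (m' := m') i.2] at this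
      simpa [Subtype.coe_inj] using this
    · have := key (tenH 2 m)
      simp only [toDistS_tenH le_rfl, toDistS_tenE_tenH,
        fun (i : ms 2) m' => toDist_Y (m' := m') i.2] at this
      simpa [Subtype.coe_inj] using this
  rw [hb, finrank_span_eq_card hli]
  simp only [Fintype.card_sum, Fintype.card_coe]
  rfl

/-- Linearised perturbations have vanishing `α_` and `D_ α_`, since Minkowski space is flat. -/
lemma chargeDbalbTwo_linPert (f : Fin 5 → GenField 0) (q₁ q₂ : GenField 0) :
    chargeDbalbTwo 2 (linPert 2 f q₁ q₂) = 0 := by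
  have h0 : dD2s (ddivS (0 : DistSTF)) = 0 := rfl
  simp [chargeDbalbTwo, linPert, h0, mode2_zero]

/-! ### Square integrable generalised fields -/

/-- The projection of a `k`-tensor at a point to its tangential part. -/
def tproj (x : S2) {k : ℕ} (t : (Fin k → Fin 3) → ℝ) (a : Fin k → Fin 3) : ℝ :=
  ∑ b, (∏ j, proj x (b j) (a j)) * t b

lemma tproj_tangential (x : S2) {k : ℕ} (t : (Fin k → Fin 3) → ℝ) (a : Fin k → Fin 3) (j : Fin k) :
    ∑ i, (x : E3) i * tproj x t (Function.update a j i) = 0 := by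
  simp only [tproj, Finset.mul_sum]
  rw [Finset.sum_comm]
  refine Finset.sum_eq_zero fun b _ => ?_
  have h1 : ∀ i : Fin 3, (∏ l, proj x (b l) (Function.update a j i l))
      = proj x i (b j) * ∏ l ∈ Finset.univ.erase j, proj x (b l) (a l) := by
    intro i
    rw [← Finset.mul_prod_erase _ _ (Finset.mem_univ j)]
    congr 1
    · simp [proj_comm x i]
    · refine Finset.prod_congr rfl fun l hl => ?_
      rw [Function.update_of_ne]
      simpa using Finset.ne_of_mem_erase hl
  simp only [h1, ← mul_assoc, ← Finset.sum_mul, sum_mul_proj, zero_mul]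

lemma sum_tproj_mul (x : S2) {k : ℕ} (t s : (Fin k → Fin 3) → ℝ)
    (hs : ∀ a j, ∑ i, (x : E3) i * s (Function.update a j i) = 0) :
    ∑ a, tproj x t a * s a = ∑ a, t a * s a := by
  simp only [tproj, Finset.sum_mul]
  rw [Finset.sum_comm]
  refine Finset.sum_congr rfl fun b _ => ?_
  rw [← sum_prod_proj_mul x s hs b, Finset.mul_sum]
  refine Finset.sum_congr rfl fun a _ => ?_
  simp only [proj_comm x (a _)]
  ring

lemma sum_tproj_sq_le (x : S2) {k : ℕ} (t : (Fin k → Fin 3) → ℝ) :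
    ∑ a, tproj x t a ^ 2 ≤ ∑ a, t a ^ 2 := by
  have h1 := sum_tproj_mul x t (tproj x t) (tproj_tangential x t)
  have h2 : 0 ≤ ∑ a, (t a - tproj x t a) ^ 2 := Finset.sum_nonneg fun a _ => sq_nonneg _
  have h3 : ∑ a, (t a - tproj x t a) ^ 2
      = ∑ a, t a ^ 2 - 2 * ∑ a, t a * tproj x t a + ∑ a, tproj x t a * tproj x t a := by
    rw [Finset.mul_sum, ← Finset.sum_sub_distrib, ← Finset.sum_add_distrib]
    exact Finset.sum_congr rfl fun a _ => by ring
  simp only [sq (tproj x t _)]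
  linarith

/-- The Hilbert space of square integrable fields of `k`-tensors of the ambient space. -/
abbrev L2Field (k : ℕ) := Lp (EuclideanSpace ℝ (Fin k → Fin 3)) 2 surf

lemma memLp_tens {k : ℕ} (Φ : Tens k) : MemLp
    (fun x => (WithLp.toLp 2 ((Φ : Field k) x) : EuclideanSpace ℝ (Fin k → Fin 3))) 2 surf := by
  have h : Continuous
      (fun x => (WithLp.toLp 2 ((Φ : Field k) x) : EuclideanSpace ℝ (Fin k → Fin 3))) :=
    (PiLp.continuous_toLp 2 _).comp (Smooth.continuous Φ.2.1)
  exact h.memLp_of_hasCompactSupport (HasCompactSupport.of_compactSpace _)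

/-- Smooth fields as square integrable ones. -/
def toL2 (k : ℕ) : Tens k →ₗ[ℝ] L2Field k where
  toFun Φ := (memLp_tens Φ).toLp _
  map_add' Φ Ψ := MemLp.toLp_add (memLp_tens Φ) (memLp_tens Ψ)
  map_smul' c Φ := MemLp.toLp_const_smul c (memLp_tens Φ)

lemma inner_toL2 {k : ℕ} (s : L2Field k) (Φ : Tens k) :
    inner ℝ s (toL2 k Φ) = ∫ x, ∑ a, s x a * (Φ : Field k) x a ∂surf := by
  rw [L2.inner_def]
  refine integral_congr_ae ?_
  filter_upwards [(memLp_tens Φ).coeFn_toLp] with x hx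
  change inner ℝ (s x) ((memLp_tens Φ).toLp _ x) = _
  rw [hx]
  simp [PiLp.inner_apply, mul_comm]

lemma norm_toL2_sq {k : ℕ} (Φ : Tens k) : ‖toL2 k Φ‖ ^ 2 = toDist Φ Φ := by
  rw [← real_inner_self_eq_norm_sq, inner_toL2, toDist_apply]
  refine integral_congr_ae ?_
  filter_upwards [(memLp_tens Φ).coeFn_toLp] with x hx
  have h : toL2 k Φ x = WithLp.toLp 2 ((Φ : Field k) x) := hx
  simp only [h]

/-- A functional bounded with respect to the `L²` norm is represented by a square integrable
tangential field: the extension and representation theorems give a field of ambient tensors, whose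
tangential part acts in the same way. -/
lemma l2sq_le_of_bound {k : ℕ} (T : GenField k) {M : ℝ} (hM : 0 ≤ M)
    (hT : ∀ Φ, T Φ ^ 2 ≤ M * toDist Φ Φ) : l2sq T ≤ ENNReal.ofReal M := by
  have hker : LinearMap.ker (toL2 k) ≤ LinearMap.ker T := by
    intro Φ hΦ
    rw [LinearMap.mem_ker] at hΦ ⊢
    have h1 := hT Φ
    rw [← norm_toL2_sq, hΦ, norm_zero] at h1
    nlinarith [sq_nonneg (T Φ)]
  have hT' : ∀ Φ, ‖T Φ‖ ≤ √M * ‖toL2 k Φ‖ := by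
    intro Φ
    rw [Real.norm_eq_abs, ← Real.sqrt_sq (norm_nonneg (toL2 k Φ)), ← Real.sqrt_mul hM,
      ← Real.sqrt_sq_eq_abs]
    refine Real.sqrt_le_sqrt ?_
    rw [norm_toL2_sq]
    exact hT Φ
  -- `T` descends to a bounded functional on the image of the smooth fields in the Hilbert space
  let f₀ : LinearMap.range (toL2 k) →ₗ[ℝ] ℝ :=
    (LinearMap.ker (toL2 k)).liftQ T hker ∘ₗ (toL2 k).quotKerEquivRange.symm.toLinearMap
  have hf₀ : ∀ Φ, f₀ ⟨toL2 k Φ, LinearMap.mem_range_self _ Φ⟩ = T Φ := by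
    intro Φ
    have h1 : (toL2 k).quotKerEquivRange.symm ⟨toL2 k Φ, LinearMap.mem_range_self _ Φ⟩
        = (LinearMap.ker (toL2 k)).mkQ Φ := by
      rw [LinearEquiv.symm_apply_eq]
      rfl
    simp [f₀, h1]
  let f : StrongDual ℝ (LinearMap.range (toL2 k)) := f₀.mkContinuous (√M) (by
    rintro ⟨_, Φ, rfl⟩
    rw [hf₀]
    exact hT' Φ)
  obtain ⟨g, hg, hgn⟩ := exists_extension_norm_eq (LinearMap.range (toL2 k)) f
  have hgM : ‖g‖ ≤ √M := by
    rw [hgn]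
    exact LinearMap.mkContinuous_norm_le _ (Real.sqrt_nonneg _) _
  -- Riesz representation
  set s : L2Field k := (InnerProductSpace.toDual ℝ (L2Field k)).symm g
  have hs : ∀ Φ : Tens k, ∫ x, ∑ a, s x a * (Φ : Field k) x a ∂surf = T Φ := by
    intro Φ
    rw [← inner_toL2, InnerProductSpace.toDual_symm_apply]
    have := hg ⟨toL2 k Φ, LinearMap.mem_range_self _ Φ⟩
    rw [← hf₀ Φ]
    exact this
  have hsn : ‖s‖ ≤ √M := by
    rw [LinearIsometryEquiv.norm_map]
    exact hgM
  have hsm : ∀ b, MemLp (fun x => s x b) 2 surf := fun b =>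
    (EuclideanSpace.proj (𝕜 := ℝ) b : EuclideanSpace ℝ (Fin k → Fin 3) →L[ℝ] ℝ).comp_memLp'
      (Lp.memLp s)
  -- the tangential projection of `s` acts in the same way on tangential fields, and its norm is not
  -- larger
  have hrep : Represents (fun x => tproj x (s x)) T := by
    refine ⟨fun x a j => tproj_tangential x _ a j, fun a => ?_, fun Φ => ?_⟩
    · unfold tproj
      refine memLp_finsetSum _ fun b _ => ?_
      have hp : Smooth (fun x => ∏ j, proj x (b j) (a j)) := Smooth.prod fun j _ => Smooth.proj _ _
      exact (hsm b).mul (hp.continuous.memLp_of_hasCompactSupport (p := ⊤)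
        (HasCompactSupport.of_compactSpace _))
    · rw [← hs]
      congr 1
      ext x
      exact (sum_tproj_mul x _ _ (fun a j => Φ.2.2 x a j)).symm
  have hle : ∫⁻ x, ∑ a, ENNReal.ofReal (tproj x (s x) a ^ 2) ∂surf ≤ ENNReal.ofReal M := by
    calc ∫⁻ x, ∑ a, ENNReal.ofReal (tproj x (s x) a ^ 2) ∂surf
        ≤ ∫⁻ x, ENNReal.ofReal (‖s x‖ ^ 2) ∂surf := by
          refine lintegral_mono fun x => ?_
          rw [← ENNReal.ofReal_sum_of_nonneg fun a _ => sq_nonneg _]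
          refine ENNReal.ofReal_le_ofReal ((sum_tproj_sq_le x _).trans ?_)
          rw [EuclideanSpace.norm_sq_eq]
          simp
      _ = ENNReal.ofReal (‖s‖ ^ 2) := by
          rw [← ofReal_integral_eq_lintegral_ofReal (Lp.memLp s).integrable_norm_pow'
            (Eventually.of_forall fun x => sq_nonneg _)]
          congr 1
          rw [← real_inner_self_eq_norm_sq, L2.inner_def]
          simp
      _ ≤ ENNReal.ofReal M := by
          refine ENNReal.ofReal_le_ofReal ?_
          rw [← Real.sq_sqrt hM]
          exact pow_le_pow_left₀ (norm_nonneg _) hsn 2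
  exact iInf₂_le_of_le _ hrep hle

/-- The Cauchy-Schwarz inequality for a functional with a square integrable representative. -/
lemma Represents.sq_le {k : ℕ} {S : Field k} {T : GenField k} (h : Represents S T) (Φ : Tens k) :
    ENNReal.ofReal (T Φ ^ 2)
      ≤ (∫⁻ x, ∑ a, ENNReal.ofReal (S x a ^ 2) ∂surf) * ENNReal.ofReal (toDist Φ Φ) := by
  obtain ⟨-, hS, hT⟩ := h
  have hΦ : ∀ a, MemLp (fun x => (Φ : Field k) x a) 2 surf := fun a =>
    (Tens.smooth_apply Φ a).continuous.memLp_of_hasCompactSupport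
      (HasCompactSupport.of_compactSpace _)
  have i1 : Integrable (fun x => ∑ a, S x a ^ 2) surf :=
    integrable_finsetSum _ fun a _ => (hS a).integrable_sq
  have i2 : Integrable (fun x => ∑ a, S x a * (Φ : Field k) x a) surf :=
    integrable_finsetSum _ fun a _ => (hS a).integrable_mul (hΦ a)
  have i3 := integrable_pair Φ Φ
  have e1 : ∫⁻ x, ∑ a, ENNReal.ofReal (S x a ^ 2) ∂surf
      = ENNReal.ofReal (∫ x, ∑ a, S x a ^ 2 ∂surf) := by
    rw [ofReal_integral_eq_lintegral_ofReal i1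
      (Eventually.of_forall fun x => Finset.sum_nonneg fun a _ => sq_nonneg _)]
    exact lintegral_congr fun x => (ENNReal.ofReal_sum_of_nonneg fun a _ => sq_nonneg _).symm
  rw [e1, ← ENNReal.ofReal_mul (integral_nonneg fun x => Finset.sum_nonneg fun a _ => sq_nonneg _)]
  refine ENNReal.ofReal_le_ofReal ?_
  -- Cauchy-Schwarz, from the non-negativity of the quadratic polynomial `t ↦ ∫ |S + t Φ|²`
  have hq : ∀ t : ℝ, 0 ≤ toDist Φ Φ * (t * t) + 2 * T Φ * t + ∫ x, ∑ a, S x a ^ 2 ∂surf := by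
    intro t
    have h1 : 0 ≤ ∫ x, ∑ a, (S x a + t * (Φ : Field k) x a) ^ 2 ∂surf :=
      integral_nonneg fun x => Finset.sum_nonneg fun a _ => sq_nonneg _
    have h2 : ∀ x, ∑ a, (S x a + t * (Φ : Field k) x a) ^ 2
        = t * t * (∑ a, (Φ : Field k) x a * (Φ : Field k) x a)
          + 2 * t * (∑ a, S x a * (Φ : Field k) x a) + ∑ a, S x a ^ 2 := by
      intro x
      rw [Finset.mul_sum, Finset.mul_sum, ← Finset.sum_add_distrib, ← Finset.sum_add_distrib]
      exact Finset.sum_congr rfl fun a _ => by ring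
    simp only [h2] at h1
    have j1 := i3.const_mul (t * t)
    have j2 := i2.const_mul (2 * t)
    have j3 : Integrable (fun x => t * t * (∑ a, (Φ : Field k) x a * (Φ : Field k) x a)
      + 2 * t * (∑ a, S x a * (Φ : Field k) x a)) surf := j1.add j2
    rw [integral_add j3 i1, integral_add j1 j2, integral_const_mul, integral_const_mul,
      ← hT, ← toDist_apply] at h1
    linarith
  have := discrim_le_zero hq
  unfold discrim at this
  linarith

/-- As `l2sq` is an infimum over representatives, this bound holds for the infimum as well. -/
lemma sq_le_l2sq_mul {k : ℕ} {T : GenField k} (hT : l2sq T < ⊤) (Φ : Tens k) :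
    T Φ ^ 2 ≤ (l2sq T).toReal * toDist Φ Φ := by
  have hΦ : 0 ≤ toDist Φ Φ := by rw [← norm_toL2_sq]; positivity
  suffices h : ENNReal.ofReal (T Φ ^ 2) ≤ l2sq T * ENNReal.ofReal (toDist Φ Φ) by
    rw [← ENNReal.ofReal_toReal hT.ne, ← ENNReal.ofReal_mul ENNReal.toReal_nonneg] at h
    exact (ENNReal.ofReal_le_ofReal_iff (by positivity)).1 h
  rcases hΦ.eq_or_lt with h0 | h0
  · simp only [l2sq, iInf_lt_iff] at hT
    obtain ⟨S, hS, hfin⟩ := hT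
    have := hS.sq_le Φ
    rw [← h0, ENNReal.ofReal_zero, mul_zero] at this ⊢
    exact this
  · have hne : ENNReal.ofReal (toDist Φ Φ) ≠ 0 := by simpa using h0
    rw [← ENNReal.div_le_iff hne ENNReal.ofReal_ne_top]
    refine le_iInf₂ fun S hS => ?_
    rw [ENNReal.div_le_iff hne ENNReal.ofReal_ne_top]
    exact hS.sq_le Φ

lemma l2sq_smul_le {k : ℕ} (c : ℝ) (T : GenField k) :
    l2sq (c • T) ≤ ENNReal.ofReal (c ^ 2) * l2sq T := by
  rcases eq_or_ne c 0 with rfl | hc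
  · have := l2sq_le_of_bound ((0 : ℝ) • T) le_rfl (by simp)
    simpa using this
  · have hc2 : 0 < c ^ 2 := by positivity
    by_cases hT : l2sq T < ⊤
    · rw [← ENNReal.ofReal_toReal hT.ne, ← ENNReal.ofReal_mul hc2.le]
      refine l2sq_le_of_bound _ (by positivity) fun Φ => ?_
      have := sq_le_l2sq_mul hT Φ
      rw [LinearMap.smul_apply, smul_eq_mul, mul_pow, mul_assoc]
      exact mul_le_mul_of_nonneg_left this hc2.le
    · rw [not_lt_top_iff.1 hT, ENNReal.mul_top (by simpa using hc)]
      exact le_top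

/-! ### The remaining charges of a linearised perturbation -/

/-- The contributions of the trace of the ingoing null expansion and of `η` cancel. -/
lemma chargeDbalbField_linPert (f : Fin 5 → GenField 0) (q₁ q₂ : GenField 0) :
    chargeDbalbField 2 (linPert 2 f q₁ q₂) = dD2s (dD1s (f 3) 0) := by
  ext W
  simp [chargeDbalbField, linPert, dD2s, dD1s, ddivS, dcov]
  ring

/-- All contributions cancel except for `Δ (Δ + 2)` applied to `f 0`: those of `q₁` to the Gauss
curvature by the formula for `D₂ D₂^*` on gradients, and those of `f 1` directly. -/
lemma chargeTrchib_linPert (f : Fin 5 → GenField 0) (q₁ q₂ Φ) :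
    chargeTrchib 2 (linPert 2 f q₁ q₂) Φ
      = -2 * f 0 (div 0 (cov 0 (div 0 (cov 0 Φ) + (2 : ℝ) • Φ))) := by
  have h1 : ddiv (ddivS (dD2s (dD1s q₁ q₂))) Φ
      = (1 / 2) * q₁ (div 0 (cov 0 (div 0 (cov 0 Φ) + (2 : ℝ) • Φ))) := by
    change -(q₁ (div 0 (D2 (D2star (cov 0 Φ)))) + q₂ (curl (D2 (D2star (cov 0 Φ))))) = _
    rw [D2_D2star_cov, map_smul, map_smul, map_smul, curl_cov, smul_zero, map_zero, smul_eq_mul]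
    ring
  have h2 : ∀ c : ℝ, ddiv (ddivS (c • dD2s (dD1s q₁ q₂))) Φ
      = c * ddiv (ddivS (dD2s (dD1s q₁ q₂))) Φ := fun c => by
    simp [ddiv, ddivS]
  simp only [chargeTrchib, linK, trOm, linPert, LinearMap.add_apply, LinearMap.sub_apply,
    LinearMap.smul_apply, h2, h1, smul_eq_mul]
  simp [lap, ddiv, dcov]
  ring

/-- The operator `Δ (Δ + 2)` annihilates the harmonics of degree at most one. -/
lemma chargeTrchib_linPert_Y (f : Fin 5 → GenField 0) (q₁ q₂) {l : ℕ} (hl : l ≤ 1) (m : ℤ) :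
    chargeTrchib 2 (linPert 2 f q₁ q₂) (Y l m) = 0 := by
  rw [chargeTrchib_linPert, eigen_aux, map_smul, map_smul, div_cov_Y]
  interval_cases l <;> norm_num [lam, mu]

lemma mode0_eq_zero {l : ℕ} {f : GenField 0} (h : ∀ m, f (Y l m) = 0) : mode0 l f = 0 :=
  Finset.sum_eq_zero fun m _ => by rw [h, zero_smul]

lemma lowPart_chargeTrchib_linPert (f : Fin 5 → GenField 0) (q₁ q₂) :
    lowPart 1 (chargeTrchib 2 (linPert 2 f q₁ q₂)) = 0 :=
  Finset.sum_eq_zero fun l hl => mode0_eq_zero fun m =>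
    chargeTrchib_linPert_Y f q₁ q₂ (by have := Finset.mem_range.1 hl; omega) m

lemma chargeEta_linPert (f : Fin 5 → GenField 0) (q₁ q₂) :
    chargeEta 2 (linPert 2 f q₁ q₂) = 0 := by
  have hd : ∀ m, dcov (toDist (Y 1 m)) = (-√(lam 1)) • toDist (vecE 1 m) := by
    intro m
    have h0 : √(lam 1) ≠ 0 := (Real.sqrt_pos.2 (lam_pos le_rfl)).ne'
    rw [dcov_toDist, vecE_eq, map_smul, smul_smul, neg_mul_neg, mul_inv_cancel₀ h0, one_smul]
  have hs : ∀ (s : Finset ℤ) (T : ℤ → GenField 0), dcov (∑ m ∈ s, T m) = ∑ m ∈ s, dcov (T m) := by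
    intro s T
    ext Φ
    simp [dcov, LinearMap.sum_apply]
  have hc : ∀ (c : ℝ) (T : GenField 0), dcov (c • T) = c • dcov T := by
    intro c T
    ext Φ
    simp [dcov]
  unfold chargeEta mode1 mode0
  rw [hs, Finset.smul_sum, Finset.smul_sum, ← Finset.sum_add_distrib]
  refine Finset.sum_eq_zero fun m _ => ?_
  rw [hc, hd]
  have e1 : (linPert 2 f q₁ q₂).eta (vecH 1 m) = 0 := by
    simp [linPert, dcov, div_vecH]
  have e2 : (linPert 2 f q₁ q₂).eta (vecE 1 m)
      = -√(lam 1) * (f 1 (Y 1 m) + (1 / 2) * f 0 (Y 1 m)) := by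
    simp [linPert, dcov, div_vecE]
    ring
  have e3 : trOm 2 (linPert 2 f q₁ q₂) (Y 1 m) = -f 1 (Y 1 m) - (1 / 2) * f 0 (Y 1 m) := by
    simp [trOm, linPert, lap, ddiv, dcov, div_cov_Y, lam]
    ring
  rw [e1, e2, e3, zero_smul, add_zero, smul_smul, smul_smul, smul_smul, ← add_smul]
  convert zero_smul ℝ _ using 2
  ring

/-- Since the charges of `η^{[1]}` and of `Ω tr χ_` with `l ≤ 1` vanish on linearised perturbations,
only the last perturbation function remains. -/
lemma chargeDbDbomb_linPert (f : Fin 5 → GenField 0) (q₁ q₂) :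
    chargeDbDbomb 2 (linPert 2 f q₁ q₂) = lowPart 1 ((1 / 2 : ℝ) • f 4) := by
  have h1 : lap (0 : GenField 0) = 0 := by ext; simp [lap, ddiv, dcov]
  have h2 : ddiv (0 : GenField 1) = 0 := by ext; simp [ddiv]
  rw [chargeDbDbomb, lowPart_chargeTrchib_linPert, chargeEta_linPert, h1, h2]
  simp [linPert]

lemma dD2s_dD1s_tenE (f : GenField 0) (l : ℕ) (m : ℤ) :
    dD2s (dD1s f 0) (tenE l m) = √(mu l) * √(lam l) * f (Y l m) := by
  simp [dD2s, dD1s, D2_tenE, div_vecE, mul_assoc]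

/-! ### Differential operators and Sobolev norms -/

/-- The derivative of a function along the rotation about the `i`-th axis, as an operator. -/
def rotT (i : Fin 3) : Tens 0 →ₗ[ℝ] Tens 0 where
  toFun u := ofFun (rot i (sval u)) ((smooth_sval u).rot i)
  map_add' u w := ext_sval fun x => by
    change rot i (fun y => sval u y + sval w y) x = rot i (sval u) x + rot i (sval w) x
    simp only [rot, pd_add (smooth_sval u) (smooth_sval w), mul_add, Finset.sum_add_distrib]
  map_smul' c u := ext_sval fun x => by
    change rot i (fun y => c * sval u y) x = c * rot i (sval u) x
    simp only [rot, pd_const_mul c (smooth_sval u), mul_left_comm _ c, Finset.mul_sum]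

lemma sval_rotT (i : Fin 3) (u : Tens 0) : sval (rotT i u) = rot i (sval u) := rfl

/-- The scalar differential operators of order at most `n`, built from smooth coefficients and
derivatives along rotations. -/
inductive DiffOp : ℕ → (Tens 0 → S2 → ℝ) → Prop
  | val : DiffOp 0 sval
  | add {n P Q} : DiffOp n P → DiffOp n Q → DiffOp n (fun u x => P u x + Q u x)
  | mul {n P a} : Smooth a → DiffOp n P → DiffOp n (fun u x => a x * P u x)
  | succ {n P} : DiffOp n P → DiffOp (n + 1) P
  | rot {n P} (i : Fin 3) : DiffOp n P → DiffOp (n + 1) (fun u => P (rotT i u))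

namespace DiffOp

lemma smooth {n : ℕ} {P : Tens 0 → S2 → ℝ} (h : DiffOp n P) (u : Tens 0) : Smooth (P u) := by
  induction h generalizing u with
  | val => exact smooth_sval u
  | add _ _ h1 h2 => exact (h1 u).add (h2 u)
  | mul ha _ h => exact ha.mul (h u)
  | succ _ h => exact h u
  | rot i _ h => exact h _

lemma zero (n : ℕ) : DiffOp n (fun _ _ => 0) := by
  induction n with
  | zero => simpa using DiffOp.val.mul (Smooth.const 0)
  | succ n ih => exact ih.succ

lemma sum {n : ℕ} {ι : Type*} {P : ι → Tens 0 → S2 → ℝ} (s : Finset ι)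
    (h : ∀ i, DiffOp n (P i)) : DiffOp n (fun u x => ∑ i ∈ s, P i u x) := by
  classical
  induction s using Finset.induction_on with
  | empty => simpa using zero n
  | insert i s hi ih => simpa only [Finset.sum_insert hi] using (h i).add ih

lemma rot_left {n : ℕ} {P : Tens 0 → S2 → ℝ} (h : DiffOp n P) (j : Fin 3) :
    DiffOp (n + 1) (fun u => NullGluing.rot j (P u)) := by
  induction h with
  | val => exact DiffOp.val.rot j
  | @add n P Q h1 h2 i1 i2 =>
    convert i1.add i2 using 3 with u x
    simp only [NullGluing.rot, pd_add (h1.smooth u) (h2.smooth u), mul_add,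
      Finset.sum_add_distrib]
  | @mul n P a ha h ih =>
    convert (h.succ.mul (ha.rot j)).add (ih.mul ha) using 3 with u x
    exact rot_mul ha (h.smooth u) j x
  | succ _ ih => exact ih.succ
  | rot i _ ih => exact ih.rot i

lemma pd {n : ℕ} {P : Tens 0 → S2 → ℝ} (h : DiffOp n P) (i : Fin 3) :
    DiffOp (n + 1) (fun u x => NullGluing.pd (P u) x i) := by
  convert DiffOp.sum Finset.univ fun j => (h.rot_left j).mul (Smooth.area j i) using 3 with u x
  exact pd_eq_rot (h.smooth u) x i

/-- The components of the covariant derivative of a differential operator. -/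
lemma cov {n k : ℕ} {P : Tens 0 →ₗ[ℝ] Tens k}
    (h : ∀ a, DiffOp n (fun u x => (P u : Field k) x a)) (a : Fin (k + 1) → Fin 3) :
    DiffOp (n + 1) (fun u x => (NullGluing.cov k (P u) : Field (k + 1)) x a) := by
  have e : ∀ u x, (NullGluing.cov k (P u) : Field (k + 1)) x a
      = ∑ c, (∏ j, proj x (a (Fin.succ j)) (c j))
        * NullGluing.pd (fun y => (P u : Field k) y c) x (a 0) := by
    intro u x
    have := covF_cons (P u) x (a 0) (Fin.tail a)
    rwa [Fin.cons_self_tail] at this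
  simp only [e]
  exact DiffOp.sum Finset.univ fun c => ((h c).pd (a 0)).mul
    (Smooth.prod fun j _ => Smooth.proj _ _)

end DiffOp

/-- The Sobolev inner product of order `n`, through derivatives along rotations. -/
def sob : ℕ → Tens 0 →ₗ[ℝ] GenField 0
  | 0 => toDist
  | n + 1 => sob n + ∑ i, (sob n).compl₁₂ (rotT i) (rotT i)

lemma sob_succ (n : ℕ) (u w : Tens 0) :
    sob (n + 1) u w = sob n u w + ∑ i, sob n (rotT i u) (rotT i w) := by
  simp [sob, LinearMap.sum_apply]

lemma sob_nonneg (n : ℕ) (u : Tens 0) : 0 ≤ sob n u u := by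
  induction n generalizing u with
  | zero =>
    change 0 ≤ toDist u u
    rw [← norm_toL2_sq]
    positivity
  | succ n ih =>
    rw [sob_succ]
    exact add_nonneg (ih u) (Finset.sum_nonneg fun i _ => ih _)

lemma sob_le_succ (n : ℕ) (u : Tens 0) : sob n u u ≤ sob (n + 1) u u := by
  rw [sob_succ]
  exact le_add_of_nonneg_right (Finset.sum_nonneg fun i _ => sob_nonneg n _)

lemma sob_mono {m n : ℕ} (h : m ≤ n) (u : Tens 0) : sob m u u ≤ sob n u u := by
  induction h with
  | refl => rfl
  | step _ ih => exact ih.trans (sob_le_succ _ u)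

/-- On an eigenfunction of the Laplacian the Sobolev inner products are multiples of the `L²` one,
since rotations commute with the Laplacian. -/
lemma sob_eigen (n : ℕ) {c : ℝ} {w : Tens 0} (hw : ∀ x, slap (sval w) x = -c * sval w x)
    (u : Tens 0) : sob n u w = (1 + c) ^ n * toDist u w := by
  induction n generalizing u w with
  | zero => simp [sob]
  | succ n ih =>
    have hr : ∀ i x, slap (sval (rotT i w)) x = -c * sval (rotT i w) x := by
      intro i x
      rw [sval_rotT, slap_rot (smooth_sval w), funext hw]
      simp only [rot, pd_const_mul (-c) (smooth_sval w), mul_left_comm _ (-c), Finset.mul_sum]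
    -- the sum over the rotations is the Dirichlet form
    have hs : ∑ i, toDist (rotT i u) (rotT i w) = c * toDist u w := by
      simp only [toDist_zero_apply, sval_rotT]
      rw [← integral_finsetSum _ fun i _ =>
        (((smooth_sval u).rot i).mul ((smooth_sval w).rot i)).integrable]
      simp only [sum_rot_mul_rot (smooth_sval u) (smooth_sval w)]
      rw [integral_pd_mul_pd (smooth_sval u) (smooth_sval w), ← integral_neg,
        ← integral_const_mul]
      simp only [hw]
      congr 1
      ext x
      ring
    rw [sob_succ, ih hw]
    simp only [ih (hr _)]
    rw [← Finset.mul_sum, hs]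
    ring

/-- A differential operator of order `n` is bounded with respect to the Sobolev product of
order `n`. -/
lemma DiffOp.integral_sq_le {n : ℕ} {P : Tens 0 → S2 → ℝ} (h : DiffOp n P) :
    ∃ C : ℝ, 0 ≤ C ∧ ∀ u, ∫ x, P u x ^ 2 ∂surf ≤ C * sob n u u := by
  induction h with
  | val =>
    refine ⟨1, zero_le_one, fun u => ?_⟩
    simp [sob, toDist_zero_apply, sq]
  | @add n P Q h1 h2 i1 i2 =>
    obtain ⟨C, hC, hP⟩ := i1
    obtain ⟨D, hD, hQ⟩ := i2
    refine ⟨2 * C + 2 * D, by positivity, fun u => ?_⟩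
    have j1 := ((h1.smooth u).mul (h1.smooth u)).integrable.const_mul 2
    have j2 := ((h2.smooth u).mul (h2.smooth u)).integrable.const_mul 2
    have j3 := (((h1.smooth u).add (h2.smooth u)).mul ((h1.smooth u).add (h2.smooth u))).integrable
    calc ∫ x, (P u x + Q u x) ^ 2 ∂surf
        ≤ ∫ x, (2 * (P u x * P u x) + 2 * (Q u x * Q u x)) ∂surf := by
          refine integral_mono (by simpa only [sq] using j3) (j1.add j2) fun x => ?_
          have := sq_nonneg (P u x - Q u x)
          change (P u x + Q u x) ^ 2 ≤ 2 * (P u x * P u x) + 2 * (Q u x * Q u x)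
          nlinarith
      _ = 2 * ∫ x, P u x ^ 2 ∂surf + 2 * ∫ x, Q u x ^ 2 ∂surf := by
          rw [integral_add j1 j2, integral_const_mul, integral_const_mul]
          simp only [sq]
      _ ≤ (2 * C + 2 * D) * sob n u u := by linarith [hP u, hQ u]
  | @mul n P a ha h ih =>
    obtain ⟨C, hC, hP⟩ := ih
    obtain ⟨B, hB⟩ := (isCompact_range ha.continuous).isBounded.exists_norm_le
    refine ⟨B ^ 2 * C, by positivity, fun u => ?_⟩
    have j1 := ((h.smooth u).mul (h.smooth u)).integrable.const_mul (B ^ 2)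
    have j3 := ((ha.mul (h.smooth u)).mul (ha.mul (h.smooth u))).integrable
    calc ∫ x, (a x * P u x) ^ 2 ∂surf
        ≤ ∫ x, B ^ 2 * (P u x * P u x) ∂surf := by
          refine integral_mono (by simpa only [sq] using j3) j1 fun x => ?_
          have h1 : |a x| ≤ B := hB _ (Set.mem_range_self x)
          have h2 : a x ^ 2 ≤ B ^ 2 := sq_le_sq' (abs_le.1 h1).1 (abs_le.1 h1).2
          change (a x * P u x) ^ 2 ≤ B ^ 2 * (P u x * P u x)
          nlinarith [sq_nonneg (P u x)]
      _ = B ^ 2 * ∫ x, P u x ^ 2 ∂surf := by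
          rw [integral_const_mul]
          simp only [sq]
      _ ≤ B ^ 2 * C * sob n u u := by
          rw [mul_assoc]
          exact mul_le_mul_of_nonneg_left (hP u) (sq_nonneg B)
  | @succ n P h ih =>
    obtain ⟨C, hC, hP⟩ := ih
    exact ⟨C, hC, fun u => (hP u).trans (mul_le_mul_of_nonneg_left (sob_le_succ n u) hC)⟩
  | @rot n P i h ih =>
    obtain ⟨C, hC, hP⟩ := ih
    refine ⟨C, hC, fun u => (hP _).trans (mul_le_mul_of_nonneg_left ?_ hC)⟩
    rw [sob_succ]
    have h1 := Finset.single_le_sum (f := fun i => sob n (rotT i u) (rotT i u))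
      (fun i _ => sob_nonneg n _) (Finset.mem_univ i)
    have h2 := sob_nonneg n u
    linarith

lemma toDist_self_le_sob {n k : ℕ} {P : Tens 0 →ₗ[ℝ] Tens k}
    (h : ∀ a, DiffOp n (fun u x => (P u : Field k) x a)) :
    ∃ C : ℝ, 0 ≤ C ∧ ∀ u, toDist (P u) (P u) ≤ C * sob n u u := by
  choose C hC hP using fun a => (h a).integral_sq_le
  refine ⟨∑ a, C a, Finset.sum_nonneg fun a _ => hC a, fun u => ?_⟩
  rw [toDist_apply, integral_finsetSum _ fun a _ =>
    (((h a).smooth u).mul ((h a).smooth u)).integrable, Finset.sum_mul]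
  refine Finset.sum_le_sum fun a _ => ?_
  simpa only [sq] using hP a u

lemma toDist_sq_le {k : ℕ} (S T : Tens k) : toDist S T ^ 2 ≤ toDist S S * toDist T T := by
  have h1 : toDist S T = inner ℝ (toL2 k S) (toL2 k T) := by
    rw [inner_toL2, toDist_apply]
    refine integral_congr_ae ?_
    filter_upwards [(memLp_tens S).coeFn_toLp] with x hx
    have h : toL2 k S x = WithLp.toLp 2 ((S : Field k) x) := hx
    simp only [h]
  rw [h1, ← norm_toL2_sq, ← norm_toL2_sq, ← mul_pow]
  exact sq_le_sq.2 ((abs_real_inner_le_norm _ _).trans (le_abs_self _))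

/-- The Sobolev norm of a weak limit of smooth fields `P (u i)`, where `P` is a differential
operator of order `n`, is bounded by a uniform bound for the Sobolev norms of the
functions `u i`. -/
lemma sobolevSq_le_of_tendsto (m : ℕ) : ∀ {k n : ℕ} (P : Tens 0 →ₗ[ℝ] Tens k)
    (_ : ∀ a, DiffOp n (fun u x => (P u : Field k) x a)),
    ∃ C : ℝ, 0 ≤ C ∧ ∀ (A : ℝ) (u : ℕ → Tens 0) (_ : ∀ i, sob (n + m) (u i) (u i) ≤ A)
      (G : GenField k) (_ : ∀ Φ, Tendsto (fun i => toDist (P (u i)) Φ) atTop (𝓝 (G Φ))),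
      sobolevSq m G ≤ ENNReal.ofReal (C * A) := by
  have key : ∀ {k n : ℕ} (P : Tens 0 →ₗ[ℝ] Tens k)
    (_ : ∀ a, DiffOp n (fun u x => (P u : Field k) x a)),
    ∃ C : ℝ, 0 ≤ C ∧ ∀ (A : ℝ) (u : ℕ → Tens 0) (_ : ∀ i, sob n (u i) (u i) ≤ A)
      (G : GenField k) (_ : ∀ Φ, Tendsto (fun i => toDist (P (u i)) Φ) atTop (𝓝 (G Φ))),
      l2sq G ≤ ENNReal.ofReal (C * A) := by
    intro k n P hP
    obtain ⟨C, hC, h⟩ := toDist_self_le_sob hP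
    refine ⟨C, hC, fun A u hu G hG => ?_⟩
    have hA : 0 ≤ A := (sob_nonneg n (u 0)).trans (hu 0)
    refine l2sq_le_of_bound G (by positivity) fun Φ => ?_
    refine le_of_tendsto ((hG Φ).pow 2) (Eventually.of_forall fun i => ?_)
    have hΦ : 0 ≤ toDist Φ Φ := by rw [← norm_toL2_sq]; positivity
    exact (toDist_sq_le _ _).trans (mul_le_mul_of_nonneg_right
      ((h _).trans (mul_le_mul_of_nonneg_left (hu i) hC)) hΦ)
  induction m with
  | zero => exact fun P hP => key P hP
  | succ m ih =>
    intro k n P hP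
    obtain ⟨C, hC, h⟩ := key P hP
    obtain ⟨D, hD, h'⟩ := ih (cov k ∘ₗ P) (DiffOp.cov hP)
    refine ⟨C + D, by positivity, fun A u hu G hG => ?_⟩
    have hA : 0 ≤ A := (sob_nonneg _ (u 0)).trans (hu 0)
    rw [add_mul, ENNReal.ofReal_add (by positivity) (by positivity)]
    refine add_le_add (h A u (fun i => (sob_mono (by omega) _).trans (hu i)) G hG)
      (h' A u (fun i => ?_) (dcov G) fun Φ => ?_)
    · rw [show n + 1 + m = n + (m + 1) by ring]
      exact hu i
    · simp only [LinearMap.comp_apply, toDist_cov]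
      exact (hG (div k Φ)).neg

/-! ### Coercivity of the second derivatives of tracefree tensors -/

lemma sum_mul_proj_right (x : S2) (i : Fin 3) : ∑ j, (x : E3) j * proj x i j = 0 := by
  simp only [proj_comm x i, sum_mul_proj]

lemma sum_proj_mul_proj (x : S2) (i j : Fin 3) : ∑ k, proj x i k * proj x j k = proj x i j := by
  have := sum_proj_mul x i (fun k => proj x j k) (sum_mul_proj_right x j)
  simp only [proj_comm x _ i] at this
  rw [this, proj_comm]

/-- The 3-tensor `γ_{ij} V_k`. -/
def metMul (V : Tens 1) : Tens 3 :=
  ⟨fun x a => proj x (a 0) (a 1) * comp1 V (a 2) x,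
    smooth_pi.2 fun a => (Smooth.proj _ _).mul (smooth_comp1 V _), fun x a j => by
      fin_cases j
      · simp [← mul_assoc, ← Finset.sum_mul, sum_mul_proj]
      · simp [← mul_assoc, ← Finset.sum_mul, sum_mul_proj_right]
      · simp [mul_left_comm _ (proj _ _ _), ← Finset.mul_sum, sum_mul_comp1]⟩

/-- The 4-tensor `W_{il} γ_{jk}`, with indices in the order `i j k l`. -/
def metIns (W : Tens 2) : Tens 4 :=
  ⟨fun x a => proj x (a 1) (a 2) * comp2 W (a 0) (a 3) x,
    smooth_pi.2 fun a => (Smooth.proj _ _).mul (smooth_comp2 W _ _), fun x a j => by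
      fin_cases j
      · simp [mul_left_comm _ (proj _ _ _), ← Finset.mul_sum, sum_mul_comp2_left]
      · simp [← mul_assoc, ← Finset.sum_mul, sum_mul_proj]
      · simp [← mul_assoc, ← Finset.sum_mul, sum_mul_proj_right]
      · simp [mul_left_comm _ (proj _ _ _), ← Finset.mul_sum, sum_mul_comp2_right]⟩

lemma sum_fin_zero_fun {M : Type*} [AddCommMonoid M] (F : (Fin 0 → Fin 3) → M) :
    ∑ a, F a = F ![] := by
  rw [Fintype.sum_unique]
  congr 1

lemma div_metMul (V : Tens 1) : div 2 (metMul V) = cov 1 V := by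
  refine ext_comp2 fun i j x => ?_
  rw [comp2_cov]
  change (div 2 (metMul V) : Field 2) x ![i, j] = _
  have e : ∀ (m d e : Fin 3), pd (fun y => (metMul V : Field 3) y (Fin.cons m ![d, e])) x m
      = -(proj x m m * (x : E3) d + (x : E3) m * proj x m d) * comp1 V e x
        + proj x m d * pd (comp1 V e) x m := by
    intro m d e
    rw [← pd_proj, ← pd_mul (Smooth.proj m d) (smooth_comp1 V e)]
    rfl
  rw [div_apply]
  simp only [sum_fin_two, e, Fin.prod_univ_two]
  have h1 : ∀ d e, ∑ m, (-(proj x m m * (x : E3) d + (x : E3) m * proj x m d) * comp1 V e x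
        + proj x m d * pd (comp1 V e) x m) = -2 * (x : E3) d * comp1 V e x
          + pd (comp1 V e) x d := by
    intro d e
    rw [Finset.sum_add_distrib, sum_proj_pd (smooth_comp1 V e), ← Finset.sum_mul,
      Finset.sum_neg_distrib, Finset.sum_add_distrib, ← Finset.sum_mul, sum_proj_self,
      sum_mul_proj]
    ring
  have h2 : ∀ e, ∑ d, proj x i d * (-2 * (x : E3) d * comp1 V e x + pd (comp1 V e) x d)
      = pd (comp1 V e) x i := by
    intro e
    have h3 := sum_proj_pd (smooth_comp1 V e) x i
    have h4 := sum_mul_proj_right x i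
    have h5 : ∀ d, proj x i d * (-2 * (x : E3) d * comp1 V e x + pd (comp1 V e) x d)
      = -2 * comp1 V e x * ((x : E3) d * proj x i d) + proj x d i * pd (comp1 V e) x d := by
      intro d; rw [proj_comm x d i]; ring
    simp only [h5, Finset.sum_add_distrib, ← Finset.mul_sum, h4, h3]
    ring
  have h6 := sum_proj_mul_left x j (fun e => pd (comp1 V e) x i)
  rw [Smooth.sum_mul_pd_eq (smooth_comp1 V) (sum_mul_comp1 V)] at h6
  calc _ = ∑ e, proj x j e * ∑ d, proj x i d * ∑ m,
        (-(proj x m m * (x : E3) d + (x : E3) m * proj x m d) * comp1 V e x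
        + proj x m d * pd (comp1 V e) x m) := by
        simp only [Fin.sum_univ_three, Matrix.cons_val_zero, Matrix.cons_val_one]
        ring
    _ = _ := by
        simp only [h1, h2, h6]
        ring

/-- The metric is parallel, so that it can be pulled out of the divergence; together with
`div_metMul` this gives `div div (W γ) = ∇ div W`. -/
lemma div_metIns (W : Tens 2) : div 3 (metIns W) = metMul (div 1 W) := by
  ext x a
  have e : ∀ (m b d e : Fin 3),
      pd (fun y => (metIns W : Field 4) y (Fin.cons m ![b, d, e])) x m
      = -(proj x m b * (x : E3) d + (x : E3) b * proj x m d) * comp2 W m e x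
        + proj x b d * pd (comp2 W m e) x m := by
    intro m b d e
    rw [← pd_proj, ← pd_mul (Smooth.proj b d) (smooth_comp2 W m e)]
    rfl
  have e' : ∀ (F : (Fin 3 → Fin 3) → ℝ), ∑ a, F a = ∑ b, ∑ d, ∑ e, F ![b, d, e] := by
    intro F
    rw [sum_fin_cons]
    refine Finset.sum_congr rfl fun b _ => ?_
    rw [sum_fin_two]
    rfl
  have h1 : comp1 (div 1 W) (a 2) x
      = ∑ m, ∑ e, proj x (a 2) e * pd (comp2 W m e) x m := by
    change (div 1 W : Field 1) x ![a 2] = _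
    rw [div_apply]
    refine Finset.sum_congr rfl fun m _ => ?_
    rw [sum_fin_cons]
    refine Finset.sum_congr rfl fun e _ => ?_
    rw [sum_fin_zero_fun, Fin.prod_univ_one]
    rfl
  change (div 3 (metIns W) : Field 3) x a = proj x (a 0) (a 1) * comp1 (div 1 W) (a 2) x
  rw [div_apply, h1, Finset.mul_sum]
  refine Finset.sum_congr rfl fun m _ => ?_
  simp only [e', e, Fin.prod_univ_three]
  have h4 : ∀ e, ∑ b, ∑ d, proj x (a 0) b * proj x (a 1) d *
      (-(proj x m b * (x : E3) d + (x : E3) b * proj x m d) * comp2 W m e x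
        + proj x b d * pd (comp2 W m e) x m) = proj x (a 0) (a 1) * pd (comp2 W m e) x m := by
    intro e
    have k1 := sum_mul_proj_right x (a 0)
    have k2 := sum_mul_proj_right x (a 1)
    have k3 : ∀ b, ∑ d, proj x (a 1) d * proj x b d = proj x b (a 1) := by
      intro b
      have := sum_proj_mul x (a 1) (fun d => proj x b d) (sum_mul_proj_right x b)
      simpa only [proj_comm x _ (a 1)] using this
    have k4 : ∑ b, proj x (a 0) b * proj x b (a 1) = proj x (a 0) (a 1) := by
      have := sum_proj_mul x (a 0) (fun b => proj x b (a 1)) (sum_mul_proj x (a 1))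
      simpa only [proj_comm x _ (a 0)] using this
    have k5 : ∀ b d, proj x (a 0) b * proj x (a 1) d *
      (-(proj x m b * (x : E3) d + (x : E3) b * proj x m d) * comp2 W m e x
        + proj x b d * pd (comp2 W m e) x m)
        = -(proj x (a 0) b * proj x m b * comp2 W m e x) * ((x : E3) d * proj x (a 1) d)
          + -((x : E3) b * proj x (a 0) b) * (proj x (a 1) d * proj x m d * comp2 W m e x)
          + pd (comp2 W m e) x m * (proj x (a 0) b * (proj x (a 1) d * proj x b d)) := by
      intro b d; ring
    simp only [k5, Finset.sum_add_distrib, ← Finset.mul_sum, k2, k3, k4, mul_zero,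
      ← Finset.sum_mul, Finset.sum_neg_distrib, k1]
    ring
  calc _ = ∑ e, proj x (a 2) e * ∑ b, ∑ d, proj x (a 0) b * proj x (a 1) d *
      (-(proj x m b * (x : E3) d + (x : E3) b * proj x m d) * comp2 W m e x
        + proj x b d * pd (comp2 W m e) x m) := by
        simp only [Finset.mul_sum]
        rw [Finset.sum_congr rfl fun b _ => Finset.sum_comm, Finset.sum_comm]
        refine Finset.sum_congr rfl fun e _ => Finset.sum_congr rfl fun b _ =>
          Finset.sum_congr rfl fun d _ => ?_
        simp only [Matrix.cons_val_zero, Matrix.cons_val_one, Matrix.cons_val]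
        ring
    _ = _ := by
        simp only [h4, Finset.mul_sum]
        exact Finset.sum_congr rfl fun e _ => by ring

lemma toDist_metIns (W : Tens 2) : toDist (metIns W) (metIns W) = 2 * toDist W W := by
  rw [toDist_apply, toDist_two_apply, ← integral_const_mul]
  congr 1
  ext x
  have h1 : ∑ j, ∑ k, proj x j k * proj x j k = 2 := by
    rw [← sum_proj_self x]
    exact Finset.sum_congr rfl fun j _ => sum_proj_mul_proj x j j
  simp only [sum_fin_cons, sum_fin_zero_fun]
  change ∑ i, ∑ j, ∑ k, ∑ l, (proj x j k * comp2 W i l x) * (proj x j k * comp2 W i l x) = _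
  calc _ = ∑ i, ∑ j, ∑ k, (proj x j k * proj x j k) * ∑ l, comp2 W i l x * comp2 W i l x := by
        simp only [Finset.mul_sum]
        exact Finset.sum_congr rfl fun i _ => Finset.sum_congr rfl fun j _ =>
          Finset.sum_congr rfl fun k _ => Finset.sum_congr rfl fun l _ => by ring
    _ = _ := by
        simp only [← Finset.sum_mul, h1]
        rw [Finset.mul_sum]

/-- The second covariant derivatives of a generalised tracefree tensor determine
`D₂^* D₂` of it. -/
lemma dcov_dcov_ofSTF (Q : DistSTF) (Ψ : STF) :
    dcov (dcov (ofSTF Q)) (metIns Ψ) = -Q (D2star (D2 Ψ)) := by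
  have h1 : dcov (dcov (ofSTF Q)) (metIns Ψ) = Q (stf (div 2 (div 3 (metIns Ψ)))) := by
    simp [dcov, ofSTF]
  have h2 : D2star (D2 Ψ) = (-1 : ℝ) • stf (cov 1 (div 1 (Ψ : Tens 2))) := rfl
  rw [h1, div_metIns, div_metMul, h2, map_smul]
  simp

lemma toDist_self_nonneg {k : ℕ} (S : Tens k) : 0 ≤ toDist S S := by
  rw [← norm_toL2_sq]
  positivity

/-- The index set of the modes. -/
abbrev Mode := (_ : ℕ) × ℤ

lemma toDist_Y_Y {p q : Mode} (hp : p.2 ∈ ms p.1) :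
    toDist (Y p.1 p.2) (Y q.1 q.2) = if p = q then 1 else 0 := by
  obtain ⟨l, m⟩ := p
  obtain ⟨l', m'⟩ := q
  rcases eq_or_ne l l' with rfl | h
  · rw [toDist_Y hp]
    simp
  · rw [toDist_Y_of_ne h, if_neg]
    simp [h]

lemma toDistS_tenE_tenE {p q : Mode} (hl : 2 ≤ p.1) (hp : p.2 ∈ ms p.1) :
    toDistS (tenE p.1 p.2) (tenE q.1 q.2) = if p = q then 1 else 0 := by
  rw [toDistS_tenE hl, toDist_Y_Y hp]

lemma toDist_sum_Y {s : Finset Mode} (hs : ∀ p ∈ s, p.2 ∈ ms p.1) (c : Mode → ℝ) {p : Mode}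
    (hp : p ∈ s) : toDist (∑ q ∈ s, c q • Y q.1 q.2) (Y p.1 p.2) = c p := by
  rw [toDist_comm, map_sum]
  simp only [map_smul, toDist_Y_Y (hs p hp), smul_eq_mul, mul_ite, mul_one, mul_zero]
  rw [Finset.sum_ite_eq, if_pos hp]

lemma toDistS_sum_tenE {s : Finset Mode} (hs : ∀ p ∈ s, 2 ≤ p.1 ∧ p.2 ∈ ms p.1) (c : Mode → ℝ) :
    toDistS (∑ p ∈ s, c p • tenE p.1 p.2) (∑ p ∈ s, c p • tenE p.1 p.2) = ∑ p ∈ s, c p ^ 2 := by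
  rw [map_sum]
  refine Finset.sum_congr rfl fun p hp => ?_
  rw [map_smul, toDistS_comm, map_sum]
  simp only [map_smul, toDistS_tenE_tenE (hs p hp).1 (hs p hp).2, smul_eq_mul, mul_ite, mul_one,
    mul_zero]
  rw [Finset.sum_ite_eq, if_pos hp, sq]

lemma le_of_sq_le_mul {B K : ℝ} (hB : 0 ≤ B) (hK : 0 ≤ K) (h : B ^ 2 ≤ K * B) : B ≤ K := by
  rcases hB.eq_or_lt with h0 | h0
  · rwa [← h0]
  · rw [sq] at h
    exact le_of_mul_le_mul_right h h0

lemma sum_toDist_Y_sq_le {s : Finset Mode} (hs : ∀ p ∈ s, p.2 ∈ ms p.1) (Φ : Tens 0) :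
    ∑ p ∈ s, toDist (Y p.1 p.2) Φ ^ 2 ≤ toDist Φ Φ := by
  -- the Cauchy-Schwarz inequality for `Φ` and its projection `u` to the modes in `s`
  set u : Tens 0 := ∑ p ∈ s, toDist (Y p.1 p.2) Φ • Y p.1 p.2 with hu
  have h1 : toDist u Φ = ∑ p ∈ s, toDist (Y p.1 p.2) Φ ^ 2 := by
    simp [hu, LinearMap.sum_apply, sq]
  have h2 : toDist u u = ∑ p ∈ s, toDist (Y p.1 p.2) Φ ^ 2 := by
    conv_lhs => arg 2; rw [hu]
    rw [map_sum]
    refine Finset.sum_congr rfl fun p hp => ?_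
    rw [map_smul, hu, toDist_sum_Y hs (fun p => toDist (Y p.1 p.2) Φ) hp, smul_eq_mul, sq]
  have h3 := toDist_sq_le u Φ
  rw [h2, h1, mul_comm] at h3
  exact le_of_sq_le_mul (Finset.sum_nonneg fun p _ => sq_nonneg _) (toDist_self_nonneg Φ) h3

/-- Bessel's inequality for the electric modes of a square integrable tensor. -/
lemma sum_tenE_sq_le {Q : DistSTF} (hQ : l2sq (ofSTF Q) < ⊤)
    {s : Finset Mode} (hs : ∀ p ∈ s, 2 ≤ p.1 ∧ p.2 ∈ ms p.1) :
    ∑ p ∈ s, Q (tenE p.1 p.2) ^ 2 ≤ (l2sq (ofSTF Q)).toReal := by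
  -- the functional is tested on the combination of modes with its own coefficients
  have h := sq_le_l2sq_mul hQ ((∑ p ∈ s, Q (tenE p.1 p.2) • tenE p.1 p.2 : STF) : Tens 2)
  have e : ofSTF Q ((∑ p ∈ s, Q (tenE p.1 p.2) • tenE p.1 p.2 : STF) : Tens 2)
      = ∑ p ∈ s, Q (tenE p.1 p.2) ^ 2 := by
    rw [ofSTF, LinearMap.comp_apply, stf_coe, map_sum]
    exact Finset.sum_congr rfl fun p _ => by rw [map_smul, smul_eq_mul, sq]
  rw [e, ← toDistS_apply, toDistS_sum_tenE hs] at h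
  exact le_of_sq_le_mul (Finset.sum_nonneg fun p _ => sq_nonneg _) ENNReal.toReal_nonneg h

/-- Bessel's inequality for the electric modes, weighted with the eigenvalues of `D₂^* D₂`. -/
lemma sum_mu_sq_le {Q : DistSTF} (hQ : l2sq (dcov (dcov (ofSTF Q))) < ⊤)
    {s : Finset Mode} (hs : ∀ p ∈ s, 2 ≤ p.1 ∧ p.2 ∈ ms p.1) :
    ∑ p ∈ s, (mu p.1 * Q (tenE p.1 p.2)) ^ 2
      ≤ 2 * (l2sq (dcov (dcov (ofSTF Q)))).toReal := by
  -- the test tensor is chosen such that `D₂^* D₂` contributes a second factor `μ`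
  set Ψ : STF := ∑ p ∈ s, (mu p.1 * Q (tenE p.1 p.2)) • tenE p.1 p.2 with hΨ
  have h := sq_le_l2sq_mul hQ (metIns Ψ)
  have e : Q (D2star (D2 Ψ)) = ∑ p ∈ s, (mu p.1 * Q (tenE p.1 p.2)) ^ 2 := by
    rw [hΨ, map_sum, map_sum, map_sum]
    refine Finset.sum_congr rfl fun p hp => ?_
    rw [map_smul, map_smul, map_smul, D2star_D2_tenE (hs p hp).1, map_smul, smul_eq_mul,
      smul_eq_mul]
    ring
  rw [dcov_dcov_ofSTF, e, toDist_metIns, ← toDistS_apply, hΨ, toDistS_sum_tenE hs, neg_sq] at h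
  refine le_of_sq_le_mul (Finset.sum_nonneg fun p _ => sq_nonneg _)
    (mul_nonneg zero_le_two ENNReal.toReal_nonneg) (h.trans_eq ?_)
  ring

/-! ### Functions with prescribed modes -/

/-- The modes of degree less than `N`. -/
def modes (N : ℕ) : Finset Mode := (Finset.range N).sigma ms

lemma mem_modes {N : ℕ} {p : Mode} : p ∈ modes N ↔ p.1 < N ∧ p.2 ∈ ms p.1 := by
  simp [modes]

/-- The function with coefficients `c` in the modes of degree less than `N`. -/
def partialSum (c : Mode → ℝ) (N : ℕ) : Tens 0 := ∑ p ∈ modes N, c p • Y p.1 p.2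

lemma sob_partialSum (c : Mode → ℝ) (n N : ℕ) :
    sob n (partialSum c N) (partialSum c N)
      = ∑ p ∈ modes N, (1 + lam p.1) ^ n * c p ^ 2 := by
  conv_lhs => arg 2; rw [partialSum]
  rw [map_sum]
  refine Finset.sum_congr rfl fun p hp => ?_
  rw [map_smul, sob_eigen n (c := lam p.1) (fun x => slap_Y _ _ x), partialSum,
    toDist_sum_Y (fun q hq => (mem_modes.1 hq).2) c hp, smul_eq_mul]
  ring

lemma toDist_partialSum (c : Mode → ℝ) (N : ℕ) (Φ : Tens 0) :
    toDist (partialSum c N) Φ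
      = ∑ l ∈ Finset.range N, ∑ m ∈ ms l, c ⟨l, m⟩ * toDist (Y l m) Φ := by
  rw [partialSum, modes, Finset.sum_sigma]
  simp [LinearMap.sum_apply]

/-- Series of harmonics with square summable coefficients converge weakly, by Bessel's inequality
for the test function. -/
lemma summable_modes {c : Mode → ℝ} {A : ℝ} (hc : ∀ N, ∑ p ∈ modes N, c p ^ 2 ≤ A) (Φ : Tens 0) :
    Summable fun l => ∑ m ∈ ms l, c ⟨l, m⟩ * toDist (Y l m) Φ := by
  refine Summable.of_norm (summable_of_sum_range_le (c := A + toDist Φ Φ)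
    (fun l => norm_nonneg _) fun N => ?_)
  calc ∑ l ∈ Finset.range N, ‖∑ m ∈ ms l, c ⟨l, m⟩ * toDist (Y l m) Φ‖
      ≤ ∑ l ∈ Finset.range N, ∑ m ∈ ms l, (c ⟨l, m⟩ ^ 2 + toDist (Y l m) Φ ^ 2) := by
        refine Finset.sum_le_sum fun l _ => (norm_sum_le _ _).trans
          (Finset.sum_le_sum fun m _ => ?_)
        rw [Real.norm_eq_abs, abs_mul, ← sq_abs (c _), ← sq_abs (toDist _ _)]
        nlinarith [sq_nonneg (|c ⟨l, m⟩| - |toDist (Y l m) Φ|), sq_nonneg (|c ⟨l, m⟩|),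
          sq_nonneg (|toDist (Y l m) Φ|)]
    _ = ∑ p ∈ modes N, c p ^ 2 + ∑ p ∈ modes N, toDist (Y p.1 p.2) Φ ^ 2 := by
        rw [← Finset.sum_add_distrib, modes, Finset.sum_sigma]
    _ ≤ A + toDist Φ Φ :=
        add_le_add (hc N) (sum_toDist_Y_sq_le (fun p hp => (mem_modes.1 hp).2) Φ)

/-- The generalised function with given square summable coefficients. -/
lemma exists_of_modes {c : Mode → ℝ} {A : ℝ} (hc : ∀ N, ∑ p ∈ modes N, c p ^ 2 ≤ A) :
    ∃ g : GenField 0, ∀ Φ,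
      HasSum (fun l => ∑ m ∈ ms l, c ⟨l, m⟩ * toDist (Y l m) Φ) (g Φ) := by
  refine ⟨{ toFun := fun Φ => ∑' l, ∑ m ∈ ms l, c ⟨l, m⟩ * toDist (Y l m) Φ
            map_add' := fun Φ Ψ => ?_
            map_smul' := fun a Φ => ?_ }, fun Φ => (summable_modes hc Φ).hasSum⟩
  · rw [← (summable_modes hc Φ).tsum_add (summable_modes hc Ψ)]
    simp [mul_add, Finset.sum_add_distrib]
  · rw [RingHom.id_apply, smul_eq_mul, ← tsum_mul_left]
    simp [mul_left_comm _ a, Finset.mul_sum]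

lemma apply_Y_of_modes {c : Mode → ℝ} {g : GenField 0} (hg : ∀ Φ,
    HasSum (fun l => ∑ m ∈ ms l, c ⟨l, m⟩ * toDist (Y l m) Φ) (g Φ)) {l : ℕ} {m : ℤ}
    (hm : m ∈ ms l) : g (Y l m) = c ⟨l, m⟩ := by
  refine (hg (Y l m)).unique ?_
  have h : (∑ m' ∈ ms l, c ⟨l, m'⟩ * toDist (Y l m') (Y l m)) = c ⟨l, m⟩ := by
    rw [Finset.sum_congr rfl fun m' hm' => by rw [toDist_Y hm']]
    simp [hm]
  rw [← h]
  refine hasSum_single l fun l' hl' => Finset.sum_eq_zero fun m' _ => ?_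
  rw [toDist_Y_of_ne hl', mul_zero]

/-- The Sobolev norms of a function are controlled by weighted sums of its coefficients. -/
lemma sobolevSq_le_of_modes (n : ℕ) : ∃ C : ℝ, 0 ≤ C ∧ ∀ (c : Mode → ℝ) (g : GenField 0)
    (_ : ∀ Φ, HasSum (fun l => ∑ m ∈ ms l, c ⟨l, m⟩ * toDist (Y l m) Φ) (g Φ)) (A : ℝ)
    (_ : ∀ N, ∑ p ∈ modes N, (1 + lam p.1) ^ n * c p ^ 2 ≤ A),
    sobolevSq n g ≤ ENNReal.ofReal (C * A) := by
  obtain ⟨C, hC, h⟩ := sobolevSq_le_of_tendsto n (k := 0) (n := 0) LinearMap.id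
    (fun a => by simpa only [LinearMap.id_apply, sval_eq] using DiffOp.val)
  refine ⟨C, hC, fun c g hg A hA => h A (partialSum c) (fun N => ?_) g fun Φ => ?_⟩
  · rw [zero_add, sob_partialSum]
    exact hA N
  · simp only [LinearMap.id_apply, toDist_partialSum]
    exact (hg Φ).tendsto_sum_nat

/-! ### Matching the charges -/

lemma l2sq_toDist_lt_top {k : ℕ} (S : Tens k) : l2sq (toDist S) < ⊤ :=
  (l2sq_le_of_bound _ (toDist_self_nonneg S) (toDist_sq_le S)).trans_lt ENNReal.ofReal_lt_top

lemma exists_lowPart_eq (n : ℕ) (f : GenField 0) : ∃ S : Tens 0, lowPart n f = toDist S :=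
  ⟨∑ l ∈ Finset.range (n + 1), ∑ m ∈ ms l, f (Y l m) • Y l m, by
    simp [lowPart, mode0]⟩

lemma lowPart_apply_Y (n : ℕ) (f : GenField 0) {l : ℕ} (hl : n < l) (m : ℤ) :
    lowPart n f (Y l m) = 0 := by
  simp only [lowPart, mode0, LinearMap.sum_apply, LinearMap.smul_apply]
  refine Finset.sum_eq_zero fun l' hl' => Finset.sum_eq_zero fun m' _ => ?_
  rw [toDist_Y_of_ne (by have := Finset.mem_range.1 hl'; omega), smul_zero]

lemma sobolevSq_smul_le (n : ℕ) : ∀ {k : ℕ} (c : ℝ) (T : GenField k),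
    sobolevSq n (c • T) ≤ ENNReal.ofReal (c ^ 2) * sobolevSq n T := by
  induction n with
  | zero => exact fun c T => l2sq_smul_le c T
  | succ n ih =>
    intro k c T
    have h : dcov (c • T) = c • dcov T := by
      ext Φ
      simp [dcov]
    change l2sq (c • T) + sobolevSq n (dcov (c • T))
      ≤ ENNReal.ofReal (c ^ 2) * (l2sq T + sobolevSq n (dcov T))
    rw [h, mul_add]
    exact add_le_add (l2sq_smul_le c T) (ih c _)

lemma sobolevNorm_smul_le (n : ℕ) {k : ℕ} (c : ℝ) (T : GenField k) :
    sobolevNorm n (c • T) ≤ ENNReal.ofReal |c| * sobolevNorm n T := by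
  have h := ENNReal.rpow_le_rpow (sobolevSq_smul_le n c T) (z := 1 / 2) (by norm_num)
  rwa [ENNReal.mul_rpow_of_nonneg _ _ (by norm_num),
    ENNReal.ofReal_rpow_of_nonneg (sq_nonneg c) (by norm_num), ← Real.sqrt_eq_rpow,
    Real.sqrt_sq_eq_abs] at h

lemma l2sq_le_sobolevSq_two {k : ℕ} (T : GenField k) : l2sq (dcov (dcov T)) ≤ sobolevSq 2 T := by
  change _ ≤ l2sq T + (l2sq (dcov T) + l2sq (dcov (dcov T)))
  exact le_add_left (le_add_left le_rfl)

/-- The coefficients of the modes `l ≥ 3` of `∂_u³ f` for which the charge is `Q`. -/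
def matchCoeff (Q : DistSTF) (p : Mode) : ℝ :=
  if 3 ≤ p.1 then Q (tenE p.1 p.2) / (√(mu p.1) * √(lam p.1)) else 0

lemma matchCoeff_sq (Q : DistSTF) {p : Mode} (hp : 3 ≤ p.1) :
    matchCoeff Q p ^ 2 = Q (tenE p.1 p.2) ^ 2 / (mu p.1 * lam p.1) := by
  rw [matchCoeff, if_pos hp, div_pow, mul_pow, Real.sq_sqrt (mu_pos (by omega)).le,
    Real.sq_sqrt (lam_pos (by omega)).le]

lemma lam_ge {l : ℕ} (hl : 3 ≤ l) : 12 ≤ lam l := by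
  have : (3 : ℝ) ≤ l := by exact_mod_cast hl
  unfold lam
  nlinarith

lemma mu_eq (l : ℕ) : mu l = lam l / 2 - 1 := by
  unfold mu lam
  ring

lemma sum_modes_le {F G : Mode → ℝ} (h : ∀ p : Mode, 3 ≤ p.1 → F p ≤ G p)
    (h0 : ∀ p : Mode, p.1 < 3 → F p = 0) (N : ℕ) :
    ∑ p ∈ modes N, F p ≤ ∑ p ∈ (modes N).filter (fun p => 3 ≤ p.1), G p := by
  rw [Finset.sum_filter]
  refine Finset.sum_le_sum fun p _ => ?_
  split_ifs with hp
  · exact h p hp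
  · exact (h0 p (by omega)).le

lemma sum_matchCoeff_sq_le {Q : DistSTF} (hQ : l2sq (ofSTF Q) < ⊤) (N : ℕ) :
    ∑ p ∈ modes N, matchCoeff Q p ^ 2 ≤ (l2sq (ofSTF Q)).toReal := by
  refine (sum_modes_le (G := fun p => Q (tenE p.1 p.2) ^ 2) (fun p hp => ?_) (fun p hp => ?_)
    N).trans (sum_tenE_sq_le hQ fun p hp => ?_)
  · have h1 := lam_ge hp
    have h2 := mu_eq p.1
    rw [matchCoeff_sq Q hp]
    exact div_le_self (sq_nonneg _) (by nlinarith)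
  · rw [matchCoeff, if_neg (by omega), zero_pow two_ne_zero]
  · rw [Finset.mem_filter, mem_modes] at hp
    exact ⟨by omega, hp.1.2⟩

/-- The weight of the fourth Sobolev norm, divided by `μ λ`, is of the order of `μ²`. -/
lemma sum_weight_matchCoeff_sq_le {Q : DistSTF} (hQ : l2sq (dcov (dcov (ofSTF Q))) < ⊤) (N : ℕ) :
    ∑ p ∈ modes N, (1 + lam p.1) ^ 4 * matchCoeff Q p ^ 2
      ≤ 40 * (l2sq (dcov (dcov (ofSTF Q)))).toReal := by
  have h := sum_mu_sq_le hQ (s := (modes N).filter (fun p => 3 ≤ p.1)) fun p hp => by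
    rw [Finset.mem_filter, mem_modes] at hp
    exact ⟨by omega, hp.1.2⟩
  refine (sum_modes_le (G := fun p => 20 * (mu p.1 * Q (tenE p.1 p.2)) ^ 2) (fun p hp => ?_)
    (fun p hp => ?_) N).trans ?_
  · have h1 := lam_ge hp
    have h2 := mu_eq p.1
    -- `μ = λ / 2 - 1` and `λ ≥ 12`, and the constant `20` exceeds `(13 / 12)⁴ (12 / 5)³`
    have hm : 5 / 12 * lam p.1 ≤ mu p.1 := by linarith
    have hl : 1 + lam p.1 ≤ 13 / 12 * lam p.1 := by linarith
    have hmp : 0 < mu p.1 := by linarith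
    rw [matchCoeff_sq Q hp, mul_div_assoc', div_le_iff₀ (by positivity)]
    have h3 : (1 + lam p.1) ^ 4 ≤ (13 / 12 * lam p.1) ^ 4 :=
      pow_le_pow_left₀ (by linarith) hl 4
    have h4 : (5 / 12 * lam p.1) ^ 3 ≤ mu p.1 ^ 3 := pow_le_pow_left₀ (by linarith) hm 3
    have h5 : (1 + lam p.1) ^ 4 ≤ 20 * mu p.1 ^ 3 * lam p.1 := by
      calc (1 + lam p.1) ^ 4 ≤ (13 / 12 * lam p.1) ^ 4 := h3
        _ ≤ 20 * (5 / 12 * lam p.1) ^ 3 * lam p.1 := by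
          have : 0 ≤ lam p.1 ^ 4 := by positivity
          nlinarith
        _ ≤ 20 * mu p.1 ^ 3 * lam p.1 := by gcongr
    calc (1 + lam p.1) ^ 4 * Q (tenE p.1 p.2) ^ 2
        ≤ 20 * mu p.1 ^ 3 * lam p.1 * Q (tenE p.1 p.2) ^ 2 :=
          mul_le_mul_of_nonneg_right h5 (sq_nonneg _)
      _ = _ := by ring
  · rw [matchCoeff, if_neg (by omega), zero_pow two_ne_zero, mul_zero]
  · rw [← Finset.mul_sum]
    linarith

/-- The charges of `D_ α_` with `l ≥ 3` and of `D_² ω_` are matched by the modes `l ≥ 3` of `∂_u³ f`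
and by `∂_u⁴ f`. -/
theorem exists_matching : ∃ C : ℝ≥0∞, C ≠ ⊤ ∧ ∀ (Q₁ : GenField 0) (Q₂ : DistSTF),
    lowPart 1 Q₁ = Q₁ → IsElectricHigh 3 Q₂ Q₂ → l2sq (ofSTF Q₂) < ⊤ →
    ∀ f₀ f₁ f₂ p q₁ q₂ : GenField 0, lowPart 2 p = p →
      ∃ f₃ f₄ g : GenField 0, f₃ = p + g ∧ IsHigh 3 f₃ g ∧ l2sq g < ⊤ ∧ l2sq f₄ < ⊤ ∧
        chargeDbDbomb 2 (linPert 2 ![f₀, f₁, f₂, f₃, f₄] q₁ q₂) = Q₁ ∧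
        IsElectricHigh 3 (chargeDbalbField 2 (linPert 2 ![f₀, f₁, f₂, f₃, f₄] q₁ q₂)) Q₂ ∧
        sobolevNorm 4 g + sobolevNorm 2 f₄ ≤
          C * (sobolevNorm 2 (ofSTF Q₂) + sobolevNorm 2 Q₁) := by
  obtain ⟨K₀, hK₀, h₀⟩ := sobolevSq_le_of_modes 0
  obtain ⟨K, hK, hK'⟩ := sobolevSq_le_of_modes 4
  set B : ℝ≥0∞ := ENNReal.ofReal (K * 40) ^ (1 / 2 : ℝ) with hB
  have hBt : B ≠ ⊤ := ENNReal.rpow_ne_top_of_nonneg (by norm_num) ENNReal.ofReal_ne_top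
  refine ⟨B + 2, ENNReal.add_ne_top.2 ⟨hBt, by simp⟩, ?_⟩
  intro Q₁ Q₂ hQ₁ hQ₂ hfin f₀ f₁ f₂ p q₁ q₂ hp
  obtain ⟨g, hg⟩ := exists_of_modes (sum_matchCoeff_sq_le hfin)
  have hgY : ∀ {l : ℕ} {m : ℤ}, m ∈ ms l → g (Y l m) = matchCoeff Q₂ ⟨l, m⟩ :=
    fun hm => apply_Y_of_modes hg hm
  have hpY : ∀ {l : ℕ} (m : ℤ), 3 ≤ l → p (Y l m) = 0 := fun m hl => by
    rw [← hp, lowPart_apply_Y 2 p (by omega)]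
  have hgl : l2sq g < ⊤ := (h₀ _ g hg (l2sq (ofSTF Q₂)).toReal fun N => by
    simpa using sum_matchCoeff_sq_le hfin N).trans_lt ENNReal.ofReal_lt_top
  obtain ⟨S, hS⟩ := exists_lowPart_eq 1 Q₁
  have hf₄ : l2sq ((2 : ℝ) • Q₁) < ⊤ := by
    rw [← hQ₁, hS, ← map_smul]
    exact l2sq_toDist_lt_top _
  -- on linearised perturbations the second charge is half of the last perturbation function
  refine ⟨p + g, (2 : ℝ) • Q₁, g, rfl, fun Φ => ?_, hgl, hf₄, ?_, fun Φ => ?_, ?_⟩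
  · convert hg Φ using 2 with l
    split_ifs with hl
    · simp only [mode0, LinearMap.sum_apply, LinearMap.smul_apply, smul_eq_mul]
      refine Finset.sum_congr rfl fun m hm => ?_
      rw [LinearMap.add_apply, hpY m hl, hgY hm, zero_add]
    · refine (Finset.sum_eq_zero fun m _ => ?_).symm
      rw [matchCoeff, if_neg hl, zero_mul]
  · rw [chargeDbDbomb_linPert]
    change lowPart 1 ((1 / 2 : ℝ) • (2 : ℝ) • Q₁) = Q₁
    rw [smul_smul]
    norm_num [hQ₁]
  · convert hQ₂ Φ using 2 with l
    split_ifs with hl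
    · refine Finset.sum_congr rfl fun m hm => ?_
      rw [chargeDbalbField_linPert, dD2s_dD1s_tenE]
      change √(mu l) * √(lam l) * (p (Y l m) + g (Y l m)) * _ = _
      have h1 := Real.sqrt_pos.2 (mu_pos (l := l) (by omega))
      have h2 := Real.sqrt_pos.2 (lam_pos (l := l) (by omega))
      rw [hpY m hl, hgY hm, zero_add, matchCoeff, if_pos hl]
      field_simp
    · rfl
  · have h4 : sobolevNorm 2 ((2 : ℝ) • Q₁) ≤ 2 * sobolevNorm 2 Q₁ := by
      simpa using sobolevNorm_smul_le 2 2 Q₁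
    have h3 : sobolevNorm 4 g ≤ (B + 2) * sobolevNorm 2 (ofSTF Q₂) := by
      -- if the norm of `Q₂` is infinite there is nothing to prove, as the constant is positive
      by_cases hT : l2sq (dcov (dcov (ofSTF Q₂))) < ⊤
      · have h5 := hK' _ g hg _ (sum_weight_matchCoeff_sq_le hT)
        rw [← mul_assoc, ENNReal.ofReal_mul (by positivity), ENNReal.ofReal_toReal hT.ne] at h5
        have h6 := ENNReal.rpow_le_rpow
          (h5.trans (mul_le_mul_right (l2sq_le_sobolevSq_two (ofSTF Q₂)) _))
          (z := 1 / 2) (by norm_num)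
        rw [ENNReal.mul_rpow_of_nonneg _ _ (by norm_num)] at h6
        exact h6.trans (mul_le_mul_left le_self_add _)
      · have h5 : sobolevNorm 2 (ofSTF Q₂) = ⊤ := by
          have h6 := l2sq_le_sobolevSq_two (ofSTF Q₂)
          rw [not_lt_top_iff.1 hT, top_le_iff] at h6
          rw [sobolevNorm, h6, ENNReal.top_rpow_of_pos (by norm_num)]
        rw [h5, ENNReal.mul_top (by simp)]
        exact le_top
    rw [mul_add]
    exact add_le_add h3 (h4.trans (mul_le_mul_left le_add_self _))

/-! ### Families of fields, smooth near the parameter zero -/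

/-- Joint smoothness of a family of maps on the sphere at the parameter `0` and the point `x`. -/
def JointSmooth {F : Type*} [NormedAddCommGroup F] [NormedSpace ℝ F] (T : ℝ → S2 → F)
    (x : S2) : Prop :=
  ContDiffAt ℝ ∞ (fun p : ℝ × E3 => T p.1 (dir p.2)) (0, (x : E3))

namespace JointSmooth

variable {F : Type*} [NormedAddCommGroup F] [NormedSpace ℝ F] {x : S2}

lemma of_smooth {T : S2 → F} (h : Smooth T) : JointSmooth (fun _ => T) x := by
  have h1 : ContDiffAt ℝ ∞ (fun y : E3 => T (dir y)) x :=
    (h x (S2.ne_zero x)).contDiffAt (isOpen_compl_singleton.mem_nhds (S2.ne_zero x))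
  exact ContDiffAt.comp ((0 : ℝ), (x : E3)) (f := Prod.snd) (g := fun y : E3 => T (dir y)) h1
    contDiffAt_snd

lemma param : JointSmooth (fun ε _ => ε) x := contDiffAt_fst

lemma const (c : F) : JointSmooth (fun _ _ => c) x := contDiffAt_const

lemma add {S T : ℝ → S2 → F} (hS : JointSmooth S x) (hT : JointSmooth T x) :
    JointSmooth (fun ε y => S ε y + T ε y) x := ContDiffAt.add hS hT

lemma sub {S T : ℝ → S2 → F} (hS : JointSmooth S x) (hT : JointSmooth T x) :
    JointSmooth (fun ε y => S ε y - T ε y) x := ContDiffAt.sub hS hT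

lemma mul {S T : ℝ → S2 → ℝ} (hS : JointSmooth S x) (hT : JointSmooth T x) :
    JointSmooth (fun ε y => S ε y * T ε y) x := ContDiffAt.mul hS hT

lemma pow {S : ℝ → S2 → ℝ} (hS : JointSmooth S x) (n : ℕ) :
    JointSmooth (fun ε y => S ε y ^ n) x := ContDiffAt.pow hS n

lemma sum {ι : Type*} {s : Finset ι} {S : ι → ℝ → S2 → F} (h : ∀ i ∈ s, JointSmooth (S i) x) :
    JointSmooth (fun ε y => ∑ i ∈ s, S i ε y) x := ContDiffAt.sum h

lemma prod {ι : Type*} {s : Finset ι} {S : ι → ℝ → S2 → ℝ} (h : ∀ i ∈ s, JointSmooth (S i) x) :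
    JointSmooth (fun ε y => ∏ i ∈ s, S i ε y) x := contDiffAt_prod h

lemma inv {S : ℝ → S2 → ℝ} (hS : JointSmooth S x) (h0 : S 0 x ≠ 0) :
    JointSmooth (fun ε y => (S ε y)⁻¹) x :=
  ContDiffAt.inv hS (by simpa only [dir_self] using h0)

lemma rpow {S : ℝ → S2 → ℝ} (hS : JointSmooth S x) (h0 : S 0 x ≠ 0) (r : ℝ) :
    JointSmooth (fun ε y => S ε y ^ r) x :=
  ContDiffAt.rpow_const_of_ne hS (by simpa only [dir_self] using h0)

lemma pi_iff {ι : Type*} [Fintype ι] {S : ℝ → S2 → ι → ℝ} :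
    JointSmooth S x ↔ ∀ i, JointSmooth (fun ε y => S ε y i) x := contDiffAt_pi

lemma pd {S : ℝ → S2 → F} (hS : JointSmooth S x) (i : Fin 3) :
    JointSmooth (fun ε y => NullGluing.pd (S ε) y i) x := by
  have hdir : ContDiffAt ℝ ∞ (fun p : ℝ × E3 => (dir p.2 : E3)) (0, (x : E3)) :=
    of_smooth (T := fun y : S2 => (y : E3)) (Smooth.restrict contDiff_id)
  have h1 : ContDiffAt ℝ ∞
      (Function.uncurry fun (p : ℝ × E3) (z : E3) => S p.1 (dir z))
      ((0, (x : E3)), (dir (x : E3) : E3)) := by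
    rw [dir_self]
    exact ContDiffAt.comp (((0 : ℝ), (x : E3)), (x : E3))
      (f := fun q : (ℝ × E3) × E3 => (q.1.1, q.2)) hS (by fun_prop)
  have h2 := ContDiffAt.fderiv (m := ∞) (f := fun (p : ℝ × E3) (z : E3) => S p.1 (dir z))
    (g := fun p : ℝ × E3 => (dir p.2 : E3)) (x₀ := ((0 : ℝ), (x : E3))) h1 hdir (by simp)
  exact h2.clm_apply contDiffAt_const

lemma covF {k : ℕ} {S : ℝ → Field k} (hS : JointSmooth S x) (a : Fin (k + 1) → Fin 3) :
    JointSmooth (fun ε y => NullGluing.covF (S ε) y a) x :=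
  sum fun b _ => (prod fun _ _ => of_smooth (Smooth.proj _ _)).mul (pi_iff.1 (hS.pd (a 0)) b)

lemma det {A : ℝ → S2 → Matrix (Fin 3) (Fin 3) ℝ}
    (h : ∀ i j, JointSmooth (fun ε y => A ε y i j) x) :
    JointSmooth (fun ε y => (A ε y).det) x := by
  simp only [Matrix.det_fin_three]
  exact ((((((((h 0 0).mul (h 1 1)).mul (h 2 2)).sub (((h 0 0).mul (h 1 2)).mul (h 2 1))).sub
    (((h 0 1).mul (h 1 0)).mul (h 2 2))).add (((h 0 1).mul (h 1 2)).mul (h 2 0))).add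
    (((h 0 2).mul (h 1 0)).mul (h 2 1))).sub (((h 0 2).mul (h 1 1)).mul (h 2 0)))

lemma matrix_inv {A : ℝ → S2 → Matrix (Fin 3) (Fin 3) ℝ}
    (h : ∀ i j, JointSmooth (fun ε y => A ε y i j) x) (h0 : (A 0 x).det ≠ 0) (i j : Fin 3) :
    JointSmooth (fun ε y => (A ε y)⁻¹ i j) x := by
  simp only [Matrix.inv_def, Ring.inverse_eq_inv', Matrix.smul_apply, smul_eq_mul,
    Matrix.adjugate_apply]
  refine ((det h).inv h0).mul (det fun k l => ?_)
  by_cases hk : k = j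
  · subst hk
    simpa only [Matrix.updateRow_self] using const _
  · simpa only [Matrix.updateRow_ne hk] using h k l

lemma fullMet {A : ℝ → S2 → Matrix (Fin 3) (Fin 3) ℝ}
    (h : ∀ i j, JointSmooth (fun ε y => A ε y i j) x) (i j : Fin 3) :
    JointSmooth (fun ε y => NullGluing.fullMet y (A ε y) i j) x :=
  (h i j).add ((of_smooth (Smooth.coord i)).mul (of_smooth (Smooth.coord j)))

lemma trG {A B : ℝ → S2 → Matrix (Fin 3) (Fin 3) ℝ}
    (hA : ∀ i j, JointSmooth (fun ε y => A ε y i j) x)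
    (hB : ∀ i j, JointSmooth (fun ε y => B ε y i j) x)
    (h0 : (NullGluing.fullMet x (A 0 x)).det ≠ 0) :
    JointSmooth (fun ε y => NullGluing.trG y (A ε y) (B ε y)) x :=
  sum fun i _ => sum fun j _ => (matrix_inv (fullMet hA) h0 i j).mul (hB i j)

lemma eventually_continuousAt {S : ℝ → S2 → F} (hS : JointSmooth S x) :
    ∀ᶠ p : ℝ × S2 in 𝓝 (0, x), ContinuousAt (fun q : ℝ × S2 => S q.1 q.2) p := by
  have h1 : ContDiffAt ℝ 1 (fun p : ℝ × E3 => S p.1 (dir p.2)) (0, (x : E3)) :=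
    ContDiffAt.of_le hS (by exact_mod_cast le_top)
  have h2 : Continuous fun p : ℝ × S2 => (p.1, (p.2 : E3)) := by fun_prop
  filter_upwards [h2.continuousAt.eventually (h1.eventually (by simp))] with p hp
  have h3 := ContinuousAt.comp (f := fun p : ℝ × S2 => (p.1, (p.2 : E3))) hp.continuousAt
    h2.continuousAt
  simpa only [Function.comp_def, dir_self] using h3

end JointSmooth

/-- The integrals of a family which is smooth near the parameter `0` are continuous at `0`: by
compactness the convergence is uniform. -/
lemma tendsto_integral_of_jointSmooth {S : ℝ → S2 → ℝ} (hS : ∀ x, JointSmooth S x) :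
    Tendsto (fun ε => ∫ x, S ε x ∂surf) (𝓝 0) (𝓝 (∫ x, S 0 x ∂surf)) := by
  have hc := (isCompact_univ (X := S2)).eventually_forall_of_forall_eventually (x₀ := (0 : ℝ))
    (P := fun ε x => ContinuousAt (fun q : ℝ × S2 => S q.1 q.2) (ε, x))
    fun x _ => (hS x).eventually_continuousAt
  have hcont : ∀ᶠ ε in 𝓝 (0 : ℝ), Continuous (S ε) := by
    filter_upwards [hc] with ε h
    exact continuous_iff_continuousAt.2 fun x =>
      (h x trivial).comp (f := fun y : S2 => (ε, y)) (by fun_prop)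
  have h0 : Continuous (S 0) := hcont.self_of_nhds
  -- a uniform bound, for dominated convergence
  have hunif : ∀ᶠ ε in 𝓝 (0 : ℝ), ∀ x ∈ (Set.univ : Set S2), ‖S ε x‖ ≤ ‖S 0 x‖ + 1 := by
    refine (isCompact_univ (X := S2)).eventually_forall_of_forall_eventually
      (P := fun ε x => ‖S ε x‖ ≤ ‖S 0 x‖ + 1) fun x _ => ?_
    have h1 : ContinuousAt (fun q : ℝ × S2 => S q.1 q.2) (0, x) :=
      (hS x).eventually_continuousAt.self_of_nhds
    have h2 : ContinuousAt (fun q : ℝ × S2 => ‖S 0 q.2‖ + 1 - ‖S q.1 q.2‖) (0, x) :=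
      ((h0.norm.comp continuous_snd).add continuous_const).continuousAt.sub h1.norm
    filter_upwards [h2.eventually (lt_mem_nhds (show (0 : ℝ) < ‖S 0 x‖ + 1 - ‖S 0 x‖ by simp))]
      with q hq
    linarith
  refine tendsto_integral_filter_of_dominated_convergence (fun x => ‖S 0 x‖ + 1) ?_ ?_ ?_ ?_
  · filter_upwards [hcont] with ε h
    exact h.aestronglyMeasurable
  · filter_upwards [hunif] with ε h
    exact Eventually.of_forall fun x => h x trivial
  · exact (h0.norm.add continuous_const).integrable_of_hasCompactSupport
      (HasCompactSupport.of_compactSpace _)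
  · refine Eventually.of_forall fun x => ?_
    exact ContinuousAt.comp (f := fun ε : ℝ => (ε, x)) (g := fun q : ℝ × S2 => S q.1 q.2) (x := 0)
      (hS x).eventually_continuousAt.self_of_nhds (by fun_prop)

/-! ### Tensor algebra with respect to multiples of the round metric -/

/-- The matrix of the round metric. -/
def roundM (x : S2) : Matrix (Fin 3) (Fin 3) ℝ := Matrix.of fun i j => proj x i j

lemma roundM_apply (x : S2) (i j : Fin 3) : roundM x i j = proj x i j := rfl

lemma det_fullMet_round (x : S2) (c : ℝ) : (fullMet x (c • roundM x)).det = c ^ 2 := by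
  have h := sum_mul_self x
  rw [Fin.sum_univ_three] at h
  simp only [Matrix.det_fin_three, fullMet, Matrix.add_apply, Matrix.smul_apply, roundM_apply,
    Matrix.vecMulVec_apply, proj, smul_eq_mul]
  simp
  linear_combination (-c ^ 3 + c ^ 2) * h

lemma inv_fullMet_round (x : S2) {c : ℝ} (hc : c ≠ 0) (i j : Fin 3) :
    (fullMet x (c • roundM x))⁻¹ i j = c⁻¹ * proj x i j + (x : E3) i * (x : E3) j := by
  have h : (fullMet x (c • roundM x))⁻¹ = Matrix.of fun i j =>
      c⁻¹ * proj x i j + (x : E3) i * (x : E3) j := by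
    refine Matrix.inv_eq_right_inv ?_
    ext i j
    have h1 : ∑ k, proj x i k * proj x k j = proj x i j := by
      have := sum_proj_mul x i (fun k => proj x k j) (sum_mul_proj x j)
      simpa only [proj_comm x _ i] using this
    have h2 := sum_mul_proj_right x i
    have h3 := sum_mul_proj x j
    have h4 := sum_mul_self x
    have e : ∀ k, fullMet x (c • roundM x) i k * (c⁻¹ * proj x k j + (x : E3) k * (x : E3) j)
        = (c * c⁻¹) * (proj x i k * proj x k j) + c * (x : E3) j * ((x : E3) k * proj x i k)
          + (c⁻¹ * (x : E3) i) * ((x : E3) k * proj x k j)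
          + (x : E3) i * (x : E3) j * ((x : E3) k * (x : E3) k) := by
      intro k
      simp only [fullMet, Matrix.add_apply, Matrix.smul_apply, roundM_apply,
        Matrix.vecMulVec_apply, smul_eq_mul]
      ring
    simp only [Matrix.mul_apply, Matrix.of_apply, e, Finset.sum_add_distrib, ← Finset.mul_sum,
      h1, h2, h3, h4, mul_inv_cancel₀ hc, mul_zero, one_mul, mul_one, add_zero]
    simp [proj, Matrix.one_apply]
  rw [h]
  rfl

lemma trG_round (x : S2) {c : ℝ} (hc : c ≠ 0) (h : Matrix (Fin 3) (Fin 3) ℝ) :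
    trG x (c • roundM x) h = c⁻¹ * (∑ i, ∑ j, proj x i j * h i j)
      + ∑ i, ∑ j, (x : E3) i * (x : E3) j * h i j := by
  simp only [trG, inv_fullMet_round x hc, Finset.mul_sum, ← Finset.sum_add_distrib]
  exact Finset.sum_congr rfl fun i _ => Finset.sum_congr rfl fun j _ => by ring

/-- For a tensor which is tangential in the second index the trace is the Cartesian one. -/
lemma trG_round_of_tangential (x : S2) {c : ℝ} (hc : c ≠ 0) {h : Matrix (Fin 3) (Fin 3) ℝ}
    (ht : ∀ i, ∑ j, (x : E3) j * h i j = 0) :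
    trG x (c • roundM x) h = c⁻¹ * ∑ i, h i i := by
  rw [trG_round x hc]
  have h1 : ∀ i, ∑ j, proj x i j * h i j = h i i := fun i => by
    rw [← sum_proj_mul x i (fun j => h i j) (ht i)]
    simp only [proj_comm x i]
  have h2 : ∀ i, ∑ j, (x : E3) i * (x : E3) j * h i j = 0 := fun i => by
    simp only [mul_assoc, ← Finset.mul_sum, ht, mul_zero]
  simp only [h1, h2, Finset.sum_const_zero, add_zero]

lemma conf_round (x : S2) (r : ℝ) : conf x (r ^ 2 • roundM x) = |r| := by
  rw [conf, det_fullMet_round, ← sq_abs r, ← pow_mul, ← Real.rpow_natCast,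
    ← Real.rpow_mul (abs_nonneg r)]
  norm_num

/-! ### The linearisation of the charges `U` and `V` -/

lemma covF_const_smul {k : ℕ} (c : ℝ) (T : Field k) (x : S2) (a : Fin (k + 1) → Fin 3) :
    covF (c • T) x a = c * covF T x a := by
  have h : ∀ i, pd (c • T) x i = c • pd T x i := by
    intro i
    have h1 : fderiv ℝ (fun y : E3 => (c • T) (dir y)) x
        = c • fderiv ℝ (fun y : E3 => T (dir y)) x := by
      exact congrFun (fderiv_const_smul_field c) _
    unfold pd
    rw [h1]
    rfl
  simp only [covF, h, Pi.smul_apply, smul_eq_mul, Finset.mul_sum]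
  exact Finset.sum_congr rfl fun b _ => by ring

lemma divG_const_smul (c : ℝ) (g T : Field 2) : divG g (c • T) = c • divG g T := by
  ext x a
  simp only [divG, covF_const_smul, Pi.smul_apply, smul_eq_mul, Finset.mul_sum]
  refine Finset.sum_congr rfl fun k _ => Finset.sum_congr rfl fun i _ => ?_
  simp only [mul_left_comm _ c, ← Finset.mul_sum]
  ring

lemma tensG_const_smul (c : ℝ) (g : Field 2) (V : Field 1) (x : S2) :
    tensG g (c • V) x = c • tensG g V x := by
  have h : covG g (c • V) x = c • covG g V x := by
    ext i j
    simp only [covG, covF_const_smul, Matrix.of_apply, Matrix.smul_apply, Pi.smul_apply,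
      smul_eq_mul, mul_left_comm _ c, ← Finset.mul_sum]
    ring
  have h2 : ∀ A B : Matrix (Fin 3) (Fin 3) ℝ, trG x A (c • B) = c * trG x A B := by
    intro A B
    simp [trG, Finset.mul_sum, mul_left_comm _ c]
  rw [tensG, h, h2, tensG, Matrix.transpose_smul, smul_sub, smul_add, smul_smul]

lemma fieldUV_const_smul (c : ℝ) (g a b : Field 2) (x : S2) :
    fieldUV g (c • a) (c • b) x = c • fieldUV g a b x := by
  have h : ∀ T : Field 2, mat (c • T) x = c • mat T x := fun T => rfl
  rw [fieldUV, divG_const_smul, tensG_const_smul, h, h, fieldUV]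
  module

lemma coeff_fieldUV_const_smul (c : ℝ) (g a b : Field 2) (Ψ : STF) :
    coeff (fieldUV g (c • a) (c • b)) Ψ = c * coeff (fieldUV g a b) Ψ := by
  simp only [coeff, ← integral_const_mul, fieldUV_const_smul, Finset.mul_sum, Matrix.smul_apply,
    smul_eq_mul, mul_assoc]

lemma mat_roundMet (r : ℝ) (x : S2) : mat (roundMet r) x = r ^ 2 • roundM x := by
  ext i j
  simp [mat, roundMet, roundM]

/-- All operations in the definition are smooth in the metric as long as its determinant does not
vanish, which holds near the round metric. -/
lemma jointSmooth_fieldUV (h : Tens 2) (a b : Tens 2) (x : S2) (i j : Fin 3) :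
    JointSmooth (fun ε y => fieldUV (roundMet 2 + ε • (h : Field 2)) (a : Field 2) (b : Field 2)
      y i j) x := by
  set g : ℝ → Field 2 := fun ε => roundMet 2 + ε • (h : Field 2) with hg
  have g1 : JointSmooth g x := by
    refine JointSmooth.pi_iff.2 fun c => ?_
    exact ((JointSmooth.const _).mul (.of_smooth (Smooth.proj _ _))).add
      (JointSmooth.param.mul (.of_smooth (Tens.smooth_apply h c)))
  have g2 : ∀ i j, JointSmooth (fun ε y => mat (g ε) y i j) x := fun i j =>
    JointSmooth.pi_iff.1 g1 ![i, j]
  have g0 : mat (g 0) x = (2 : ℝ) ^ 2 • roundM x := by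
    rw [hg]
    simp only [zero_smul, add_zero, mat_roundMet]
  have hd : (fullMet x (mat (g 0) x)).det = 16 := by
    rw [g0, det_fullMet_round]
    norm_num
  have hd0 : (fullMet x (mat (g 0) x)).det ≠ 0 := by
    rw [hd]
    norm_num
  have hinv : ∀ i j, JointSmooth (fun ε y => (fullMet y (mat (g ε) y))⁻¹ i j) x :=
    JointSmooth.matrix_inv (JointSmooth.fullMet g2) hd0
  have hconf : JointSmooth (fun ε y => conf y (mat (g ε) y)) x :=
    (JointSmooth.det (JointSmooth.fullMet g2)).rpow hd0 _
  have hconf0 : conf x (mat (g 0) x) ≠ 0 := by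
    rw [g0, conf_round]
    norm_num
  have hchr : ∀ l i j, JointSmooth (fun ε y => chr (g ε) y l i j) x := fun l i j =>
    (JointSmooth.const _).mul (.sum fun m _ => (hinv l m).mul
      (((g1.covF _).add (g1.covF _)).sub (g1.covF _)))
  have ha : ∀ c, JointSmooth (fun _ y => (a : Field 2) y c) x := fun c =>
    .of_smooth (Tens.smooth_apply a c)
  have hdiv : JointSmooth (fun ε => divG (g ε) (a : Field 2)) x := by
    refine JointSmooth.pi_iff.2 fun c => ?_
    exact .sum fun k _ => .sum fun i _ => (hinv k i).mul
      (((JointSmooth.covF (S := fun _ => (a : Field 2)) (.of_smooth a.2.1) _).sub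
        (.sum fun l _ => (hchr l k i).mul (ha _))).sub
        (.sum fun l _ => (hchr l k (c 0)).mul (ha _)))
  have hcov : ∀ i j, JointSmooth (fun ε y => covG (g ε) (divG (g ε) (a : Field 2)) y i j) x :=
    fun i j => (hdiv.covF _).sub
      (.sum fun l _ => (hchr l i j).mul (JointSmooth.pi_iff.1 hdiv _))
  have htens : JointSmooth (fun ε y => tensG (g ε) (divG (g ε) (a : Field 2)) y i j) x :=
    ((hcov i j).add (hcov j i)).sub ((JointSmooth.trG g2 hcov hd0).mul (g2 i j))
  exact ((hconf.inv hconf0).mul (.of_smooth (Tens.smooth_apply b _))).add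
    (((hconf.pow 2).inv (pow_ne_zero 2 hconf0)).mul ((ha _).add ((hconf.pow 2).mul htens)))

lemma covF_roundMet (r : ℝ) (x : S2) (l i j : Fin 3) : covF (roundMet r) x ![l, i, j] = 0 := by
  have hs : Smooth (roundMet r) := smooth_pi.2 fun a =>
    (Smooth.const (r ^ 2)).mul (Smooth.proj _ _)
  have h1 : ∀ b : Fin 2 → Fin 3, pd (roundMet r) x l b
      = r ^ 2 * -(proj x l (b 0) * (x : E3) (b 1) + (x : E3) (b 0) * proj x l (b 1)) := by
    intro b
    rw [← pd_apply hs, ← pd_proj, ← pd_const_mul _ (Smooth.proj _ _)]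
    rfl
  have hi := sum_mul_proj_right x i
  have hj := sum_mul_proj_right x j
  change ∑ b : Fin 2 → Fin 3, (∏ k : Fin 2, proj x (![l, i, j] k.succ) (b k))
    * pd (roundMet r) x l b = 0
  rw [sum_fin_two]
  simp only [h1, Fin.prod_univ_two]
  change ∑ p, ∑ q, proj x i p * proj x j q * (r ^ 2 * -(proj x l p * (x : E3) q
    + (x : E3) p * proj x l q)) = 0
  have e : ∀ p q, proj x i p * proj x j q * (r ^ 2 * -(proj x l p * (x : E3) q
      + (x : E3) p * proj x l q))
      = (-r ^ 2 * proj x i p * proj x l p) * ((x : E3) q * proj x j q)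
        + (-r ^ 2 * ((x : E3) p * proj x i p)) * (proj x j q * proj x l q) := by
    intro p q; ring
  simp only [e, Finset.sum_add_distrib, ← Finset.mul_sum, hj, ← Finset.sum_mul, hi]
  simp

lemma chr_roundMet (r : ℝ) (x : S2) (l i j : Fin 3) : chr (roundMet r) x l i j = 0 := by
  simp [chr, covF_roundMet]

lemma divG_roundMet (a : Tens 2) :
    divG (roundMet 2) (a : Field 2) = ((1 / 4 : ℝ) • (div 1 a : Tens 1) : Tens 1) := by
  ext x c
  have h4 : ((2 : ℝ) ^ 2) ≠ 0 := by norm_num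
  simp only [divG, chr_roundMet, zero_mul, Finset.sum_const_zero, sub_zero, mat_roundMet]
  have h := trG_round_of_tangential x h4
    (h := Matrix.of fun k i => covF (a : Field 2) x ![k, i, c 0])
    fun k => by
      have := (cov 2 a).2.2 x ![k, 0, c 0] 1
      have e : ∀ i, Function.update ![k, 0, c 0] 1 i = ![k, i, c 0] := by
        intro i; ext j; fin_cases j <;> rfl
      simp only [e] at this
      exact this
  rw [trG] at h
  simp only [Matrix.of_apply] at h
  rw [h]
  have e : ∀ i : Fin 3, (![i, i, c 0] : Fin 3 → Fin 3) = Fin.cons i (Fin.cons i c) := by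
    intro i; ext j; fin_cases j <;> rfl
  simp only [e]
  change _ = (1 / 4 : ℝ) * ∑ i, covF (a : Field 2) x (Fin.cons i (Fin.cons i c))
  norm_num

/-- At the round metric `∇ ⊗̂ V` is `-2 D₂^* V`. -/
lemma tensG_roundMet (V : Tens 1) (x : S2) (i j : Fin 3) :
    tensG (roundMet 2) (V : Field 1) x i j = -2 * comp2 (D2star V) i j x := by
  have h4 : ((2 : ℝ) ^ 2) ≠ 0 := by norm_num
  have h1 : covG (roundMet 2) (V : Field 1) x = Matrix.of fun i j => comp2 (cov 1 V) i j x := by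
    ext i j
    simp [covG, chr_roundMet]
    rfl
  rw [tensG, h1, mat_roundMet,
    trG_round_of_tangential x h4 (h := Matrix.of fun i j => comp2 (cov 1 V) i j x)
      fun i => sum_mul_comp2_right (cov 1 V) x i]
  have h2 : comp2 (D2star V) i j x = -comp2 (stf (cov 1 V)) i j x := by
    rw [D2star_apply]
    rfl
  rw [h2, comp2_stf]
  simp only [Matrix.sub_apply, Matrix.add_apply, Matrix.transpose_apply, Matrix.of_apply,
    Matrix.smul_apply, smul_eq_mul, roundM_apply]
  ring

lemma coeff_fieldUV_round (a b Ψ : STF) :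
    coeff (fieldUV (roundMet 2) ((a : Tens 2) : Field 2) ((b : Tens 2) : Field 2)) Ψ
      = toDistS ((1 / 2 : ℝ) • b + (1 / 4 : ℝ) • (a - (2 : ℝ) • D2star (D2 a))) Ψ := by
  rw [toDistS_apply, toDist_two_apply]
  refine integral_congr_ae (Eventually.of_forall fun x => Finset.sum_congr rfl fun i _ =>
    Finset.sum_congr rfl fun j _ => ?_)
  have h1 : tensG (roundMet 2) (divG (roundMet 2) ((a : Tens 2) : Field 2)) x i j
      = -2 * (1 / 4) * comp2 (D2star (D2 a)) i j x := by
    rw [divG_roundMet, tensG_roundMet, map_smul, mul_assoc]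
    rfl
  simp only [fieldUV, mat_roundMet, conf_round, Matrix.add_apply, Matrix.smul_apply, smul_eq_mul,
    h1]
  change (|(2 : ℝ)|⁻¹ * comp2 b i j x + (|(2 : ℝ)| ^ 2)⁻¹ * (comp2 a i j x
    + |(2 : ℝ)| ^ 2 * (-2 * (1 / 4) * comp2 (D2star (D2 a)) i j x))) * comp2 Ψ i j x
    = ((1 / 2) * comp2 b i j x + (1 / 4) * (comp2 a i j x
      - 2 * comp2 (D2star (D2 a)) i j x)) * comp2 Ψ i j x
  rw [abs_of_pos zero_lt_two]
  ring

lemma toDistS_sub (V W : STF) : toDistS (V - W) = toDistS V - toDistS W := by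
  have h : toDistS (V - W + W) = toDistS (V - W) + toDistS W := toDistS.map_add _ _
  rw [eq_sub_iff_add_eq, ← h]
  exact congrArg toDistS (sub_add_cancel V W)

/-- A coefficient is linear in the curvature components, so that its derivative at the round
metric is its value there. -/
lemma hasDerivAt_coeff_fieldUV (h : Tens 2) (a b Ψ : STF) :
    HasDerivAt (fun ε : ℝ => coeff (fieldUV (roundMet 2 + ε • (h : Field 2))
        (ε • ((a : Tens 2) : Field 2)) (ε • ((b : Tens 2) : Field 2))) Ψ)
      (toDistS ((1 / 2 : ℝ) • b + (1 / 4 : ℝ) • (a - (2 : ℝ) • D2star (D2 a))) Ψ) 0 := by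
  have h1 := tendsto_integral_of_jointSmooth (S := fun ε y => ∑ i, ∑ j,
    fieldUV (roundMet 2 + ε • (h : Field 2)) ((a : Tens 2) : Field 2) ((b : Tens 2) : Field 2) y i j
      * ((Ψ : Tens 2) : Field 2) y ![i, j]) fun x => .sum fun i _ => .sum fun j _ =>
        (jointSmooth_fieldUV h a b x i j).mul (.of_smooth (Tens.smooth_apply _ _))
  rw [← coeff_fieldUV_round, hasDerivAt_iff_tendsto_slope]
  have h2 : Tendsto (fun ε : ℝ => coeff (fieldUV (roundMet 2 + ε • (h : Field 2))
      ((a : Tens 2) : Field 2) ((b : Tens 2) : Field 2)) Ψ) (𝓝 0)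
      (𝓝 (coeff (fieldUV (roundMet 2) ((a : Tens 2) : Field 2) ((b : Tens 2) : Field 2)) Ψ)) := by
    simp only [zero_smul, add_zero] at h1
    exact h1
  refine (h2.mono_left nhdsWithin_le_nhds).congr' ?_
  filter_upwards [self_mem_nhdsWithin] with ε hε
  have hε' : ε ≠ 0 := hε
  rw [slope_def_field, coeff_fieldUV_const_smul, coeff_fieldUV_const_smul]
  field_simp
  ring

/-- The charge with `l = 2` is the projection of the tensor whose coefficients are the derivatives
of `U` and `V`. -/
theorem chargeDbalbTwo_eq (h : Tens 2) (a b : STF) (X : LinSphereData)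
    (ha : X.alb = toDistS a) (hb : X.Dbalb = toDistS b) :
    ∃ dU dV : ℤ → ℝ,
      (∀ m ∈ ms 2,
        HasDerivAt (fun ε : ℝ => chargeU m (roundMet 2 + ε • (h : Field 2))
          (ε • ((a : Tens 2) : Field 2)) (ε • ((b : Tens 2) : Field 2))) (dU m) 0 ∧
        HasDerivAt (fun ε : ℝ => chargeV m (roundMet 2 + ε • (h : Field 2))
          (ε • ((a : Tens 2) : Field 2)) (ε • ((b : Tens 2) : Field 2))) (dV m) 0) ∧
      chargeDbalbTwo 2 X =
        ∑ m ∈ ms 2, (dU m • toDistS (tenE 2 m) + dV m • toDistS (tenH 2 m)) := by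
  refine ⟨_, _, fun m _ => ⟨hasDerivAt_coeff_fieldUV h a b (tenE 2 m),
    hasDerivAt_coeff_fieldUV h a b (tenH 2 m)⟩, ?_⟩
  have e : (1 / (2 : ℝ)) • X.Dbalb + (1 / (2 : ℝ) ^ 2) • (X.alb - (2 : ℝ) • dD2s (ddivS X.alb))
      = toDistS ((1 / 2 : ℝ) • b + (1 / 4 : ℝ) • (a - (2 : ℝ) • D2star (D2 a))) := by
    rw [ha, hb, ddivS_toDistS, dD2s_toDist, map_add, map_smul, map_smul]
    congr 1
    rw [toDistS_sub, map_smul]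
    norm_num
  rw [chargeDbalbTwo, e]
  rfl

/-! ### Derivatives of families with respect to the parameter -/

/-- The derivative at the parameter `0` commutes with derivatives in the other variables. -/
lemma hasDerivAt_fderiv_swap {E F : Type*} [NormedAddCommGroup E] [NormedSpace ℝ E]
    [NormedAddCommGroup F] [NormedSpace ℝ F] {Φ : ℝ × E → F} {φ : E → F} {y : E}
    (hΦ : ContDiffAt ℝ ∞ Φ (0, y)) (hφ : ∀ᶠ z in 𝓝 y, HasDerivAt (fun ε => Φ (ε, z)) (φ z) 0)
    (v : E) :
    HasDerivAt (fun ε => fderiv ℝ (fun z => Φ (ε, z)) y v) (fderiv ℝ φ y v) 0 := by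
  have hd : ∀ᶠ p in 𝓝 ((0 : ℝ), y), DifferentiableAt ℝ Φ p := by
    have h1 : ContDiffAt ℝ 1 Φ (0, y) := hΦ.of_le (by exact_mod_cast le_top)
    filter_upwards [h1.eventually (by simp)] with p hp
    exact hp.differentiableAt (by simp)
  have hD : HasFDerivAt (fderiv ℝ Φ) (fderiv ℝ (fderiv ℝ Φ) (0, y)) (0, y) :=
    ((hΦ.fderiv_right (m := ∞) (by simp)).differentiableAt (by simp)).hasFDerivAt
  have hsymm : ∀ v w, fderiv ℝ (fderiv ℝ Φ) (0, y) v w = fderiv ℝ (fderiv ℝ Φ) (0, y) w v :=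
    fun v w => (hΦ.isSymmSndFDerivAt (by
      rw [minSmoothness_of_isRCLikeNormedField]
      exact WithTop.coe_le_coe.2 (le_top (a := (2 : ℕ∞))))).eq v w
  generalize fderiv ℝ (fderiv ℝ Φ) (0, y) = L at hD hsymm
  have hd' : ∀ᶠ p in 𝓝 ((0 : ℝ), y), HasFDerivAt Φ (fderiv ℝ Φ p) p := by
    filter_upwards [hd] with p hp
    exact hp.hasFDerivAt
  generalize fderiv ℝ Φ = D at hD hd'
  -- near the point, the derivative along `v` is `D (0, v)` and `φ` is `D (1, 0)`; both are
  -- differentiated by means of the second derivative `L` of `Φ`, which is symmetric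
  have h2 : (fun ε => fderiv ℝ (fun z => Φ (ε, z)) y v) =ᶠ[𝓝 0] fun ε => D (ε, y) (0, v) := by
    have hc : ContinuousAt (fun ε : ℝ => (ε, y)) 0 := by fun_prop
    filter_upwards [hc.eventually hd'] with ε hε
    have h3 : HasFDerivAt (fun z : E => (ε, z)) (ContinuousLinearMap.inr ℝ ℝ E) y :=
      hasFDerivAt_prodMk_right ε y
    have h5 : HasFDerivAt (fun z => Φ (ε, z)) ((D (ε, y)).comp (ContinuousLinearMap.inr ℝ ℝ E)) y :=
      HasFDerivAt.comp y hε h3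
    rw [h5.fderiv]
    rfl
  have h4 : φ =ᶠ[𝓝 y] fun z => D (0, z) (1, 0) := by
    have hc : ContinuousAt (fun z : E => ((0 : ℝ), z)) y := by fun_prop
    filter_upwards [hc.eventually hd', hφ] with z hz hz'
    have h3 : HasDerivAt (fun ε : ℝ => (ε, z)) ((1 : ℝ), (0 : E)) 0 :=
      (hasDerivAt_id (0 : ℝ)).prodMk (hasDerivAt_const (0 : ℝ) z)
    have h5 : HasDerivAt (fun ε => Φ (ε, z)) (D (0, z) (1, 0)) 0 :=
      HasFDerivAt.comp_hasDerivAt (0 : ℝ) hz h3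
    exact hz'.unique h5
  have h6 : fderiv ℝ φ y v = L (1, 0) (0, v) := by
    have h3 : HasFDerivAt (fun z : E => ((0 : ℝ), z)) (ContinuousLinearMap.inr ℝ ℝ E) y :=
      hasFDerivAt_prodMk_right 0 y
    have h5 : HasFDerivAt (fun z => D (0, z)) (L.comp (ContinuousLinearMap.inr ℝ ℝ E)) y :=
      HasFDerivAt.comp y hD h3
    have h7 := h5.clm_apply (hasFDerivAt_const ((1 : ℝ), (0 : E)) y)
    rw [h4.fderiv_eq, hsymm (1, 0) (0, v), h7.fderiv]
    simp
  rw [h6]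
  refine HasDerivAt.congr_of_eventuallyEq ?_ h2
  have h3 : HasDerivAt (fun ε : ℝ => (ε, y)) ((1 : ℝ), (0 : E)) 0 :=
    (hasDerivAt_id (0 : ℝ)).prodMk (hasDerivAt_const (0 : ℝ) y)
  have h5 : HasDerivAt (fun ε => D (ε, y)) (L (1, 0)) 0 := HasFDerivAt.comp_hasDerivAt (0 : ℝ) hD h3
  simpa using h5.clm_apply (hasDerivAt_const (0 : ℝ) ((0 : ℝ), v))

/-- The derivative in the parameter commutes with derivatives along the sphere. -/
lemma hasDerivAt_pd {F : Type*} [NormedAddCommGroup F] [NormedSpace ℝ F] {S : ℝ → S2 → F}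
    {S' : S2 → F} {x : S2} (hS : JointSmooth S x)
    (hS' : ∀ y, HasDerivAt (fun ε => S ε y) (S' y) 0) (i : Fin 3) :
    HasDerivAt (fun ε => pd (S ε) x i) (pd S' x i) 0 :=
  hasDerivAt_fderiv_swap (Φ := fun p : ℝ × E3 => S p.1 (dir p.2)) (φ := fun y => S' (dir y)) hS
    (Eventually.of_forall fun y => hS' (dir y)) _

lemma hasDerivAt_det_of_one {N : ℝ → Matrix (Fin 3) (Fin 3) ℝ} {N' : Matrix (Fin 3) (Fin 3) ℝ}
    (h : ∀ i j, HasDerivAt (fun ε => N ε i j) (N' i j) 0) (h0 : N 0 = 1) :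
    HasDerivAt (fun ε => (N ε).det) (∑ i, N' i i) 0 := by
  simp only [Matrix.det_fin_three]
  refine ((((((((h 0 0).fun_mul (h 1 1)).fun_mul (h 2 2)).fun_sub
    (((h 0 0).fun_mul (h 1 2)).fun_mul (h 2 1))).fun_sub
    (((h 0 1).fun_mul (h 1 0)).fun_mul (h 2 2))).fun_add
    (((h 0 1).fun_mul (h 1 2)).fun_mul (h 2 0))).fun_add
    (((h 0 2).fun_mul (h 1 0)).fun_mul (h 2 1))).fun_sub
    (((h 0 2).fun_mul (h 1 1)).fun_mul (h 2 0))).congr_deriv ?_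
  simp [h0, Fin.sum_univ_three]

/-- Jacobi's formula for the derivative of a determinant. -/
lemma hasDerivAt_det {M : ℝ → Matrix (Fin 3) (Fin 3) ℝ} {M' : Matrix (Fin 3) (Fin 3) ℝ}
    (h : ∀ i j, HasDerivAt (fun ε => M ε i j) (M' i j) 0) (h0 : (M 0).det ≠ 0) :
    HasDerivAt (fun ε => (M ε).det) ((M 0).det * ∑ i, ∑ j, (M 0)⁻¹ i j * M' j i) 0 := by
  have hu : IsUnit (M 0).det := isUnit_iff_ne_zero.2 h0
  -- multiplication by the inverse reduces to the derivative at the identity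
  have h1 : HasDerivAt (fun ε => ((M 0)⁻¹ * M ε).det) (∑ i, ((M 0)⁻¹ * M') i i) 0 := by
    refine hasDerivAt_det_of_one (fun i j => ?_) (Matrix.nonsing_inv_mul _ hu)
    simp only [Matrix.mul_apply]
    exact HasDerivAt.fun_sum fun k _ => (h k j).const_mul _
  have h2 := h1.const_mul (M 0).det
  simp only [Matrix.mul_apply] at h2
  refine h2.congr_of_eventuallyEq (Eventually.of_forall fun ε => ?_)
  simp only [← Matrix.det_mul, Matrix.mul_nonsing_inv_cancel_left _ _ hu]

/-- The derivative of the conformal factor at the round metric of radius `2`. -/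
lemma hasDerivAt_conf {x : S2} {G : ℝ → Matrix (Fin 3) (Fin 3) ℝ} {G' : Matrix (Fin 3) (Fin 3) ℝ}
    (h : ∀ i j, HasDerivAt (fun ε => G ε i j) (G' i j) 0) (h0 : G 0 = (2 : ℝ) ^ 2 • roundM x)
    (ht : ∀ i, ∑ j, (x : E3) j * G' j i = 0) :
    HasDerivAt (fun ε => conf x (G ε)) ((∑ i, G' i i) / 8) 0 := by
  have hM : ∀ i j, HasDerivAt (fun ε => fullMet x (G ε) i j) (G' i j) 0 := fun i j =>
    (h i j).add_const _
  have hd : (fullMet x (G 0)).det = 16 := by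
    rw [h0, det_fullMet_round]
    norm_num
  have h1 := hasDerivAt_det hM (by rw [hd]; norm_num)
  have h2 := h1.rpow_const (p := 1 / 4) (Or.inl (by rw [hd]; norm_num))
  have h4 : ((2 : ℝ) ^ 2) ≠ 0 := by norm_num
  have h3 : ∑ i, ∑ j, (fullMet x (G 0))⁻¹ i j * G' j i = 1 / 4 * ∑ i, G' i i := by
    have h5 := trG_round_of_tangential x h4 (h := G'.transpose) ht
    rw [trG, ← h0] at h5
    refine h5.trans ?_
    simp only [Matrix.transpose_apply]
    norm_num
  have h6 : (16 : ℝ) ^ (1 / 4 - 1 : ℝ) = 1 / 8 := by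
    rw [show (16 : ℝ) = 2 ^ (4 : ℝ) by norm_num, ← Real.rpow_mul (by norm_num)]
    norm_num
  rw [h3, hd, h6] at h2
  exact h2.congr_deriv (by ring)

/-- The derivative of the conformally rescaled metric at the round metric of radius `2`. -/
lemma hasDerivAt_conf_inv_smul {x : S2} {G : ℝ → Matrix (Fin 3) (Fin 3) ℝ}
    {G' : Matrix (Fin 3) (Fin 3) ℝ}
    (h : ∀ i j, HasDerivAt (fun ε => G ε i j) (G' i j) 0) (h0 : G 0 = (2 : ℝ) ^ 2 • roundM x)
    (ht : ∀ i, ∑ j, (x : E3) j * G' j i = 0) (i j : Fin 3) :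
    HasDerivAt (fun ε => ((conf x (G ε) ^ 2)⁻¹ • G ε) i j)
      ((1 / 4) * (G' i j - (∑ i, G' i i) / 2 * proj x i j)) 0 := by
  have hc : conf x (G 0) = 2 := by
    rw [h0, conf_round]
    norm_num
  have h1 := ((hasDerivAt_conf h h0 ht).fun_pow 2).fun_inv (by rw [hc]; norm_num)
  have h2 := h1.fun_mul (h i j)
  refine h2.congr_deriv ?_
  rw [hc, h0]
  simp only [Matrix.smul_apply, smul_eq_mul, roundM_apply]
  norm_num
  ring

/-! ### Angular perturbations -/

lemma SmoothFamily.jointSmooth {F : Type*} [NormedAddCommGroup F] [NormedSpace ℝ F]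
    {f : ℝ → S2 → F} (hf : SmoothFamily f) (x : S2) : JointSmooth f x :=
  (hf (0, (x : E3)) ⟨trivial, S2.ne_zero x⟩).contDiffAt
    ((isOpen_univ.prod isOpen_compl_singleton).mem_nhds ⟨trivial, S2.ne_zero x⟩)

lemma sum_proj_mul_pd_comp1 (V : Tens 1) (x : S2) (i j : Fin 3) :
    ∑ k, proj x j k * pd (comp1 V k) x i = comp2 (cov 1 V) i j x := by
  rw [sum_proj_mul_left, Smooth.sum_mul_pd_eq (smooth_comp1 V) (sum_mul_comp1 V), comp2_cov]
  ring

lemma pd_coe_apply (x : S2) (i k : Fin 3) : pd (fun y : S2 => (y : E3)) x i k = proj x i k := by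
  have hs : Smooth (fun y : S2 => (y : E3)) := Smooth.restrict contDiff_id
  have h := ((EuclideanSpace.proj (𝕜 := ℝ) (ι := Fin 3) k : E3 →L[ℝ] ℝ).hasFDerivAt.comp (x : E3)
    (hs.differentiableAt x).hasFDerivAt).fderiv
  rw [← pd_coord]
  exact (congrArg (fun L => L (EuclideanSpace.single i 1)) h).symm

/-- The derivative of the pulled back metrics is the Lie derivative of the round metric. -/
lemma hasDerivAt_pullMet {Θ : ℝ → S2 → S2} (hΘ : SmoothFamily (fun ε x => (Θ ε x : E3)))
    (h0 : ∀ x, Θ 0 x = x) {V : Tens 1}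
    (hV : ∀ x (i : Fin 3), HasDerivAt (fun ε => (Θ ε x : E3) i) (comp1 V i x) 0)
    (x : S2) (i j : Fin 3) :
    HasDerivAt (fun ε => pullMet (Θ ε) x i j)
      (4 * (comp2 (cov 1 V) i j x + comp2 (cov 1 V) j i x)) 0 := by
  set V' : S2 → E3 := fun y => WithLp.toLp 2 fun k => comp1 V k y with hV'
  have h1 : ∀ y, HasDerivAt (fun ε => (Θ ε y : E3)) (V' y) 0 := by
    intro y
    have h2 : HasDerivAt (fun ε => (Θ ε y : E3).ofLp) (fun k => comp1 V k y) 0 :=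
      hasDerivAt_pi.2 fun k => hV y k
    exact (PiLp.continuousLinearEquiv 2 ℝ
      (fun _ : Fin 3 => ℝ)).symm.toContinuousLinearMap.hasFDerivAt.comp_hasDerivAt (0 : ℝ) h2
  have hsV : Smooth V' := (PiLp.continuousLinearEquiv 2 ℝ
    (fun _ : Fin 3 => ℝ)).symm.contDiff.comp_contDiffOn (contDiffOn_pi.2 fun k => smooth_comp1 V k)
  have h3 : ∀ i k, HasDerivAt (fun ε => pd (fun y => (Θ ε y : E3)) x i k)
      (pd (comp1 V k) x i) 0 := by
    intro i k
    have h4 := hasDerivAt_pd (hΘ.jointSmooth x) h1 i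
    have h5 := (EuclideanSpace.proj (𝕜 := ℝ) (ι := Fin 3) k :
      E3 →L[ℝ] ℝ).hasFDerivAt.comp_hasDerivAt (0 : ℝ) h4
    have h6 := ((EuclideanSpace.proj (𝕜 := ℝ) (ι := Fin 3) k : E3 →L[ℝ] ℝ).hasFDerivAt.comp (x : E3)
      (hsV.differentiableAt x).hasFDerivAt).fderiv
    have h7 : pd (comp1 V k) x i = pd V' x i k :=
      congrArg (fun L => L (EuclideanSpace.single i 1)) h6
    rw [h7]
    exact h5
  have h8 : ∀ i k, pd (fun y => (Θ 0 y : E3)) x i k = proj x i k := by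
    intro i k
    simp only [h0, pd_coe_apply]
  have h9 := (HasDerivAt.fun_sum (u := Finset.univ)
    fun k _ => (h3 i k).fun_mul (h3 j k)).const_mul (4 : ℝ)
  refine h9.congr_deriv ?_
  simp only [h8, ← sum_proj_mul_pd_comp1, ← Finset.sum_add_distrib]
  congr 1
  exact Finset.sum_congr rfl fun k _ => by ring

/-- The conformal factor and the rescaled metric have as derivatives the trace and the tracefree
part of the Lie derivative of the metric along `V = -D₁^* (q₁, q₂)`. -/
theorem isAngularLin (q₁ q₂ : Tens 0) :
    IsAngularLin q₁ q₂ (linPert 2 0 (toDist q₁) (toDist q₂)) := by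
  intro Θ hΘ h0 hV
  set V : Tens 1 := (-1 : ℝ) • D1star q₁ q₂ with hVdef
  have hV' : ∀ x (i : Fin 3), HasDerivAt (fun ε => (Θ ε x : E3) i) (comp1 V i x) 0 := by
    intro x i
    convert hV x i using 1
    rw [hVdef, comp1_smul]
    change (-1 : ℝ) * (D1star q₁ q₂ : Field 1) x ![i] = -(D1star q₁ q₂ : Field 1) x ![i]
    ring
  have hG := fun x i j => hasDerivAt_pullMet hΘ h0 hV' x i j
  have hG0 : ∀ x, pullMet (Θ 0) x = (2 : ℝ) ^ 2 • roundM x := by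
    intro x
    ext i j
    simp only [pullMet, h0, Matrix.of_apply, pd_coe_apply, Matrix.smul_apply, roundM_apply,
      smul_eq_mul]
    rw [sum_proj_mul_proj]
    norm_num
  have ht : ∀ (x : S2) i, ∑ j, (x : E3) j * (Matrix.of fun i j =>
      4 * (comp2 (cov 1 V) i j x + comp2 (cov 1 V) j i x)) j i = 0 := by
    intro x i
    have h1 := sum_mul_comp2_left (cov 1 V) x i
    have h2 := sum_mul_comp2_right (cov 1 V) x i
    simp only [Matrix.of_apply, mul_add, Finset.sum_add_distrib, mul_left_comm _ (4 : ℝ),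
      ← Finset.mul_sum, h1, h2]
    norm_num
  have htr : ∀ x, ∑ i, comp2 (cov 1 V) i i x = sval (div 0 V) x := by
    intro x
    have h1 := sum_mul_comp1 V x
    rw [sval_div]
    simp only [comp2_cov, Finset.sum_add_distrib, h1, add_zero]
  have hdiv : div 0 V = div 0 (cov 0 q₁) := by
    rw [hVdef, map_smul, D1star, map_add, map_neg, div_star_cov, add_zero, smul_neg, neg_smul,
      one_smul, neg_neg]
  constructor
  · refine ⟨div 0 V, ?_, fun x a => ?_⟩
    · rw [hdiv, ← ddiv_toDist, ← dcov_toDist]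
      simp [linPert, lap]
    · refine (hasDerivAt_conf (hG x) (hG0 x) (ht x)).congr_deriv ?_
      simp only [← Finset.mul_sum, Finset.sum_add_distrib, htr]
      rw [sval_eq]
      ring
  · refine ⟨(2 : ℝ) • D2star (D1star q₁ q₂), ?_, fun x a => ?_⟩
    · rw [map_smul, ← dD2s_toDist, ← dD1s_toDist]
      rfl
    · refine (hasDerivAt_conf_inv_smul (hG x) (hG0 x) (ht x) (a 0) (a 1)).congr_deriv ?_
      have h1 : (2 : ℝ) • D2star (D1star q₁ q₂) = (2 : ℝ) • stf (cov 1 V) := by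
        rw [hVdef, map_smul, map_smul]
        rfl
      rw [h1, comp2_eq]
      change _ = 2 * comp2 (stf (cov 1 V)) (a 0) (a 1) x
      rw [comp2_stf]
      simp only [← Finset.mul_sum, Finset.sum_add_distrib, htr]
      ring

/-! ### Fields of vectors in Minkowski space -/

/-- The field of vectors in Minkowski space with given time and space components. -/
def vec4 (a : S2 → ℝ) (b : Fin 3 → S2 → ℝ) (y : S2) : M4 := Fin.cons (a y) fun k => b k y

lemma pd_vec4 {a : S2 → ℝ} {b : Fin 3 → S2 → ℝ} (ha : Smooth a) (hb : ∀ k, Smooth (b k)) (x : S2)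
    (i : Fin 3) : pd (vec4 a b) x i = Fin.cons (pd a x i) fun k => pd (b k) x i := by
  have hs : Smooth (vec4 a b) := smooth_pi.2 fun c => Fin.cases ha hb c
  ext c
  rw [← pd_apply hs]
  induction c using Fin.cases <;> rfl

lemma JointSmooth.vec4 {a : ℝ → S2 → ℝ} {b : Fin 3 → ℝ → S2 → ℝ} {x : S2} (ha : JointSmooth a x)
    (hb : ∀ k, JointSmooth (b k) x) :
    JointSmooth (fun ε => NullGluing.vec4 (a ε) (fun k => b k ε)) x :=
  JointSmooth.pi_iff.2 fun c => Fin.cases ha hb c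

lemma hasDerivAt_vec4 {a : ℝ → S2 → ℝ} {b : Fin 3 → ℝ → S2 → ℝ} {a' : S2 → ℝ}
    {b' : Fin 3 → S2 → ℝ} {y : S2} (ha : HasDerivAt (fun ε => a ε y) (a' y) 0)
    (hb : ∀ k, HasDerivAt (fun ε => b k ε y) (b' k y) 0) :
    HasDerivAt (fun ε => vec4 (a ε) (fun k => b k ε) y) (vec4 a' b' y) 0 :=
  hasDerivAt_pi.2 fun c => Fin.cases ha hb c

lemma mdot_eq (X Z : M4) : mdot X Z = -(X 0 * Z 0) + ∑ k : Fin 3, X k.succ * Z k.succ := by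
  simp [mdot, mink, Matrix.diagonal_apply, Fin.sum_univ_succ]

lemma mdot_cons (a c : ℝ) (b d : Fin 3 → ℝ) :
    mdot (Fin.cons a b : M4) (Fin.cons c d : M4) = -(a * c) + ∑ k, b k * d k := by
  simp [mdot_eq]

lemma hasDerivAt_mdot {X Z : ℝ → M4} {X' Z' : M4} (hX : HasDerivAt X X' 0)
    (hZ : HasDerivAt Z Z' 0) :
    HasDerivAt (fun ε => mdot (X ε) (Z ε)) (mdot X' (Z 0) + mdot (X 0) Z') 0 := by
  have h1 := hasDerivAt_pi.1 hX
  have h2 := hasDerivAt_pi.1 hZ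
  simp only [mdot_eq]
  refine ((h1 0).fun_mul (h2 0)).fun_neg.fun_add (HasDerivAt.fun_sum (u := Finset.univ)
    fun k _ => (h1 (Fin.succ k)).fun_mul (h2 (Fin.succ k))) |>.congr_deriv ?_
  simp only [Finset.sum_add_distrib]
  ring

/-! ### The curvature of Minkowski space -/

lemma christoffel_const (G : Matrix (Fin 4) (Fin 4) ℝ) (p : M4) (a b c : Fin 4) :
    christoffel (fun _ => G) p a b c = 0 := by
  simp [christoffel, pd4]

/-- The Christoffel symbols vanish, hence also the curvature. -/
lemma curv_eq_zero (p X₁ X₂ X₃ X₄ : M4) : curv p X₁ X₂ X₃ X₄ = 0 := by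
  simp [curv, riemann, christoffel_const, pd4]

/-! ### The geometry of a transversally perturbed sphere -/

section Transversal

variable {f : ℝ → S2 → ℝ} {f₀ f₁ : S2 → ℝ} (ε : ℝ) (x : S2)

lemma deriv_const_smul_family (u : ℝ) :
    deriv (fun s => (ε • f) s x) u = ε * deriv (fun s => f s x) u :=
  deriv_const_mul_field (v := fun s => f s x) ε

lemma lapse_eq (h₁ : ∀ x, deriv (fun s => f s x) 0 = f₁ x) :
    lapse (ε • f) 0 x = √(1 + ε * f₁ x) := by
  rw [lapse, deriv_const_smul_family, h₁]

lemma emb_eq (h₀ : ∀ x, f 0 x = f₀ x) : emb (ε • f) 0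
    = vec4 (fun y => 2 + ε * f₀ y) (fun k y => (2 - ε * f₀ y) * (y : E3) k) := by
  ext y c
  simp only [emb, vec4, Pi.smul_apply, smul_eq_mul, h₀, add_zero, sub_zero]

lemma frame_eq (h₀ : ∀ x, f 0 x = f₀ x) (hs₀ : Smooth f₀) (i : Fin 3) : frame (ε • f) 0 x i
    = Fin.cons (ε * pd f₀ x i)
      (fun k => -(ε * pd f₀ x i) * (x : E3) k + (2 - ε * f₀ x) * proj x i k) := by
  have h1 : Smooth fun y => ε * f₀ y := (Smooth.const ε).mul hs₀
  have h2 : Smooth fun y => 2 - ε * f₀ y := (Smooth.const 2).sub h1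
  rw [frame, emb_eq ε h₀, pd_vec4 ((Smooth.const 2).add h1) fun k => h2.mul (Smooth.coord k)]
  simp only [pd_add (Smooth.const 2) h1, pd_sub (Smooth.const 2) h1, pd_mul h2 (Smooth.coord _),
    pd_const, pd_const_mul ε hs₀, pd_coord, zero_add, zero_sub]

/-- The induced metric does not depend on the gradient of `f`: the frame is the one of the round
sphere of radius `2 - ε f₀`, up to a multiple of the null generator of the cone. -/
lemma met_eq (h₀ : ∀ x, f 0 x = f₀ x) (hs₀ : Smooth f₀) :
    met (ε • f) 0 x = (2 - ε * f₀ x) ^ 2 • roundM x := by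
  ext i j
  simp only [met, frame_eq ε x h₀ hs₀, Matrix.of_apply, mdot_cons, Matrix.smul_apply,
    roundM_apply, smul_eq_mul]
  have h1 := sum_mul_self x
  have h2 := sum_mul_proj_right x i
  have h3 := sum_mul_proj_right x j
  have h4 := sum_proj_mul_proj x i j
  have e : ∀ k, (-(ε * pd f₀ x i) * (x : E3) k + (2 - ε * f₀ x) * proj x i k)
      * (-(ε * pd f₀ x j) * (x : E3) k + (2 - ε * f₀ x) * proj x j k)
      = (ε * pd f₀ x i) * (ε * pd f₀ x j) * ((x : E3) k * (x : E3) k)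
        - (ε * pd f₀ x i) * (2 - ε * f₀ x) * ((x : E3) k * proj x j k)
        - (ε * pd f₀ x j) * (2 - ε * f₀ x) * ((x : E3) k * proj x i k)
        + (2 - ε * f₀ x) ^ 2 * (proj x i k * proj x j k) := fun k => by ring
  simp only [e, Finset.sum_add_distrib, Finset.sum_sub_distrib, ← Finset.mul_sum, h1, h2, h3, h4]
  ring

lemma sum_mul_frame (h₀ : ∀ x, f 0 x = f₀ x) (hs₀ : Smooth f₀) (A : M4) :
    ∑ j, (x : E3) j * mdot A (frame (ε • f) 0 x j) = 0 := by
  have h1 := sum_mul_pd' hs₀ x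
  have h2 := fun k => sum_mul_proj x k
  have h3 : ∀ j, (x : E3) j * mdot A (frame (ε • f) 0 x j)
      = -(A 0 * ε) * ((x : E3) j * pd f₀ x j) + ∑ k : Fin 3, (A k.succ *
        (-(ε * (x : E3) k)) * ((x : E3) j * pd f₀ x j)
          + A k.succ * (2 - ε * f₀ x) * ((x : E3) j * proj x j k)) := by
    intro j
    rw [mdot_eq, frame_eq ε x h₀ hs₀, mul_add, Finset.mul_sum]
    congr 1
    · simp only [Fin.cons_zero]
      ring
    · refine Finset.sum_congr rfl fun k _ => ?_
      simp only [Fin.cons_succ]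
      ring
  simp only [h3, Finset.sum_add_distrib]
  rw [← Finset.mul_sum, h1, Finset.sum_comm]
  simp only [← Finset.mul_sum, h1]
  rw [Finset.sum_comm]
  simp only [← Finset.mul_sum, h2]
  simp

lemma hasDerivAt_lapse (c : ℝ) : HasDerivAt (fun ε : ℝ => √(1 + ε * c)) (c / 2) 0 := by
  have h1 : HasDerivAt (fun ε : ℝ => 1 + ε * c) c 0 := by
    simpa using ((hasDerivAt_id (0 : ℝ)).mul_const c).const_add 1
  have h2 := h1.sqrt (by simp)
  refine h2.congr_deriv ?_
  simp

lemma hasDerivAt_lapse_inv (c : ℝ) :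
    HasDerivAt (fun ε : ℝ => (√(1 + ε * c))⁻¹) (-(c / 2)) 0 := by
  refine ((hasDerivAt_lapse c).fun_inv (by simp)).congr_deriv ?_
  simp

lemma jointSmooth_lapse (hs₁ : Smooth f₁) : JointSmooth (fun ε y => √(1 + ε * f₁ y)) x :=
  ContDiffAt.sqrt ((JointSmooth.const (x := x) (1 : ℝ)).add
    (JointSmooth.param.mul (.of_smooth hs₁))) (by simp)

lemma jointSmooth_lapse_inv (hs₁ : Smooth f₁) : JointSmooth (fun ε y => (√(1 + ε * f₁ y))⁻¹) x :=
  (jointSmooth_lapse x hs₁).inv (by simp)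

/-- The derivative of the normalised trace of a second fundamental form `A`, and of its tracefree
part, from the one of `A`. -/
lemma hasDerivAt_trG {r : ℝ} {A : ℝ → Matrix (Fin 3) (Fin 3) ℝ} {A' : Matrix (Fin 3) (Fin 3) ℝ}
    (hA : ∀ i j, HasDerivAt (fun ε => A ε i j) (A' i j) 0)
    (ht : ∀ ε i, ∑ j, (x : E3) j * A ε i j = 0) (c : ℝ) :
    HasDerivAt (fun ε => √(1 + ε * c) * trG x ((2 - ε * r) ^ 2 • roundM x) (A ε))
      ((c / 2 + r) / 4 * (∑ i, A 0 i i) + (∑ i, A' i i) / 4) 0 ∧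
    ∀ i j, HasDerivAt (fun ε => tfG x ((2 - ε * r) ^ 2 • roundM x) (A ε) i j)
      (A' i j - (∑ i, A' i i) / 2 * proj x i j) 0 := by
  have hr : HasDerivAt (fun ε : ℝ => 2 - ε * r) (-r) 0 := by
    simpa using ((hasDerivAt_id (0 : ℝ)).mul_const r).const_sub 2
  have hr0 : ∀ᶠ ε in 𝓝 (0 : ℝ), (2 - ε * r) ^ 2 ≠ 0 := by
    have : ContinuousAt (fun ε : ℝ => (2 - ε * r) ^ 2) 0 := by fun_prop
    exact this.eventually_ne (by norm_num)
  have hsum : HasDerivAt (fun ε => ∑ i, A ε i i) (∑ i, A' i i) 0 :=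
    HasDerivAt.fun_sum fun i _ => hA i i
  constructor
  · have h1 := (hasDerivAt_lapse c).fun_mul (((hr.fun_pow 2).fun_inv (by norm_num)).fun_mul hsum)
    refine (h1.congr_deriv ?_).congr_of_eventuallyEq ?_
    · norm_num
      ring
    · filter_upwards [hr0] with ε hε
      rw [trG_round_of_tangential x hε (ht ε)]
  · intro i j
    have h1 := (hA i j).fun_sub ((hsum.div_const 2).mul_const (proj x i j))
    refine h1.congr_of_eventuallyEq ?_
    filter_upwards [hr0] with ε hε
    simp only [tfG, Matrix.sub_apply, Matrix.smul_apply, roundM_apply, smul_eq_mul]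
    rw [trG_round_of_tangential x hε (ht ε)]
    have h2 := inv_mul_cancel₀ hε
    linear_combination (-((∑ i, A ε i i) / 2 * proj x i j)) * h2

end Transversal

/-! ### The null normals and the second fundamental forms -/

section Transversal

variable {f : ℝ → S2 → ℝ} {f₀ f₁ : S2 → ℝ}

/-- The square of the gradient which enters the outgoing null normal. -/
def gradSq (f₀ : S2 → ℝ) (ε : ℝ) (y : S2) : ℝ :=
  ∑ i, (ε * pd f₀ y i) ^ 2 / (2 - ε * f₀ y) ^ 2

lemma LoutN_eq (h₀ : ∀ x, f 0 x = f₀ x) (h₁ : ∀ x, deriv (fun s => f s x) 0 = f₁ x)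
    (hs₀ : Smooth f₀) (ε : ℝ) : LoutN (ε • f) 0
    = vec4 (fun y => (√(1 + ε * f₁ y))⁻¹ * (1 + gradSq f₀ ε y))
      (fun k y => (√(1 + ε * f₁ y))⁻¹ * ((y : E3) k - gradSq f₀ ε y * (y : E3) k
        + 2 / (2 - ε * f₀ y) * (ε * pd f₀ y k))) := by
  have hf : (ε • f) 0 = fun y => ε * f₀ y := funext fun y => by
    simp only [Pi.smul_apply, smul_eq_mul, h₀]
  ext y c
  rw [LoutN, lapse_eq ε y h₁, Lout]
  simp only [hf, pd_const_mul ε hs₀, sub_zero]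
  change (√(1 + ε * f₁ y))⁻¹ * _ = _
  induction c using Fin.cases with
  | zero => simp [vec4, gradSq]
  | succ k => simp [vec4, gradSq, sub_eq_add_neg]

lemma LbarN_eq (h₁ : ∀ x, HasDerivAt (fun s => f s x) (f₁ x) 0) (ε : ℝ) : LbarN (ε • f) 0
    = vec4 (fun y => (√(1 + ε * f₁ y))⁻¹ * (1 + ε * f₁ y))
      (fun k y => (√(1 + ε * f₁ y))⁻¹ * (-(1 + ε * f₁ y) * (y : E3) k)) := by
  ext y c
  have h2 : HasDerivAt (fun s => emb (ε • f) s y)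
      (vec4 (fun y => 1 + ε * f₁ y) (fun k y => -(1 + ε * f₁ y) * (y : E3) k) y) 0 := by
    refine hasDerivAt_pi.2 fun c => ?_
    induction c using Fin.cases with
    | zero => exact ((hasDerivAt_id (0 : ℝ)).const_add 2).fun_add ((h₁ y).const_mul ε)
    | succ k =>
      refine (((hasDerivAt_id (0 : ℝ)).const_sub 2).fun_sub
        ((h₁ y).const_mul ε)).mul_const ((y : E3) k) |>.congr_deriv ?_
      simp only [vec4, Fin.cons_succ]
      ring
  rw [LbarN, lapse_eq ε y fun x => (h₁ x).deriv, Lbar, h2.deriv]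
  change (√(1 + ε * f₁ y))⁻¹ * _ = _
  induction c using Fin.cases <;> rfl

lemma hasDerivAt_two_sub (c : ℝ) : HasDerivAt (fun ε : ℝ => 2 - ε * c) (-c) 0 := by
  simpa using ((hasDerivAt_id (0 : ℝ)).mul_const c).const_sub 2

lemma hasDerivAt_mul_self (c : ℝ) : HasDerivAt (fun ε : ℝ => ε * c) c 0 := by
  simpa using (hasDerivAt_id (0 : ℝ)).mul_const c

lemma gradSq_zero (y : S2) : gradSq f₀ 0 y = 0 := by
  simp [gradSq]

lemma hasDerivAt_gradSq (y : S2) : HasDerivAt (fun ε : ℝ => gradSq f₀ ε y) 0 0 := by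
  refine (HasDerivAt.fun_sum (u := Finset.univ) fun i _ =>
    ((hasDerivAt_mul_self (pd f₀ y i)).fun_pow 2).fun_div
      ((hasDerivAt_two_sub (f₀ y)).fun_pow 2) (by norm_num)).congr_deriv ?_
  simp

lemma jointSmooth_gradSq (hs₀ : Smooth f₀) (x : S2) : JointSmooth (gradSq f₀) x :=
  .sum fun i _ => by
    simp only [div_eq_mul_inv]
    exact ((JointSmooth.param.mul (.of_smooth (hs₀.pd_comp i))).pow 2).mul
      ((((JointSmooth.const 2).sub (JointSmooth.param.mul (.of_smooth hs₀))).pow 2).inv (by simp))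

lemma jointSmooth_LoutN (h₀ : ∀ x, f 0 x = f₀ x) (h₁ : ∀ x, deriv (fun s => f s x) 0 = f₁ x)
    (hs₀ : Smooth f₀) (hs₁ : Smooth f₁) (x : S2) :
    JointSmooth (fun ε : ℝ => LoutN (ε • f) 0) x := by
  simp only [LoutN_eq h₀ h₁ hs₀]
  refine .vec4 ((jointSmooth_lapse_inv x hs₁).mul ((JointSmooth.const 1).add
    (jointSmooth_gradSq hs₀ x))) fun k => (jointSmooth_lapse_inv x hs₁).mul ?_
  simp only [div_eq_mul_inv]
  exact ((JointSmooth.of_smooth (Smooth.coord k)).sub ((jointSmooth_gradSq hs₀ x).mul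
    (.of_smooth (Smooth.coord k)))).add (((JointSmooth.const 2).mul
      (((JointSmooth.const 2).sub (JointSmooth.param.mul (.of_smooth hs₀))).inv (by simp))).mul
        (JointSmooth.param.mul (.of_smooth (hs₀.pd_comp k))))

lemma jointSmooth_LbarN (h₁ : ∀ x, HasDerivAt (fun s => f s x) (f₁ x) 0) (hs₁ : Smooth f₁)
    (x : S2) : JointSmooth (fun ε : ℝ => LbarN (ε • f) 0) x := by
  have h2 : JointSmooth (fun ε y => 1 + ε * f₁ y) x :=
    (JointSmooth.const 1).add (JointSmooth.param.mul (.of_smooth hs₁))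
  simp only [LbarN_eq h₁, neg_mul_comm]
  exact .vec4 ((jointSmooth_lapse_inv x hs₁).mul h2) fun k =>
    (jointSmooth_lapse_inv x hs₁).mul (h2.mul (.of_smooth (Smooth.coord k).neg))

lemma hasDerivAt_frame (h₀ : ∀ x, f 0 x = f₀ x) (hs₀ : Smooth f₀) (x : S2) (i : Fin 3) :
    HasDerivAt (fun ε : ℝ => frame (ε • f) 0 x i)
      (Fin.cons (pd f₀ x i) fun k => -(pd f₀ x i * (x : E3) k + f₀ x * proj x i k)) 0 := by
  simp only [frame_eq _ x h₀ hs₀]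
  refine hasDerivAt_pi.2 fun c => ?_
  induction c using Fin.cases with
  | zero => exact hasDerivAt_mul_self _
  | succ k =>
    refine ((hasDerivAt_mul_self (pd f₀ x i)).fun_neg.mul_const ((x : E3) k)).fun_add
      ((hasDerivAt_two_sub (f₀ x)).mul_const (proj x i k)) |>.congr_deriv ?_
    simp only [Fin.cons_succ]
    ring

lemma frame_zero (h₀ : ∀ x, f 0 x = f₀ x) (hs₀ : Smooth f₀) (x : S2) (i : Fin 3) :
    frame ((0 : ℝ) • f) 0 x i = Fin.cons 0 fun k => 2 * proj x i k := by
  rw [frame_eq 0 x h₀ hs₀]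
  simp

lemma pd_LoutN_zero (h₀ : ∀ x, f 0 x = f₀ x) (h₁ : ∀ x, deriv (fun s => f s x) 0 = f₁ x)
    (hs₀ : Smooth f₀) (x : S2) (i : Fin 3) :
    pd (LoutN ((0 : ℝ) • f) 0) x i = Fin.cons 0 fun k => proj x i k := by
  have h : LoutN ((0 : ℝ) • f) 0 = vec4 (fun _ => 1) (fun k y => (y : E3) k) := by
    rw [LoutN_eq h₀ h₁ hs₀]
    simp [gradSq_zero]
  rw [h, pd_vec4 (Smooth.const 1) Smooth.coord]
  simp only [pd_const, pd_coord]

lemma LbarN_zero (h₁ : ∀ x, HasDerivAt (fun s => f s x) (f₁ x) 0) :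
    LbarN ((0 : ℝ) • f) 0 = vec4 (fun _ => 1) (fun k y => -(y : E3) k) := by
  rw [LbarN_eq h₁]
  simp

lemma hasDerivAt_pd_LoutN (h₀ : ∀ x, f 0 x = f₀ x) (h₁ : ∀ x, deriv (fun s => f s x) 0 = f₁ x)
    (hs₀ : Smooth f₀) (hs₁ : Smooth f₁) (x : S2) (i : Fin 3) :
    HasDerivAt (fun ε : ℝ => pd (LoutN (ε • f) 0) x i)
      (Fin.cons (-(1 / 2) * pd f₁ x i) fun k => -(1 / 2) * (pd f₁ x i * (x : E3) k
        + f₁ x * proj x i k) + pd (fun y => pd f₀ y k) x i) 0 := by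
  have h2 : ∀ y, HasDerivAt (fun ε : ℝ => LoutN (ε • f) 0 y)
      (vec4 (fun y => -(1 / 2) * f₁ y) (fun k y => -(1 / 2) * (f₁ y * (y : E3) k) + pd f₀ y k) y)
      0 := by
    intro y
    simp only [LoutN_eq h₀ h₁ hs₀]
    refine hasDerivAt_vec4
      (a := fun ε y => (√(1 + ε * f₁ y))⁻¹ * (1 + gradSq f₀ ε y))
      (b := fun k ε y => (√(1 + ε * f₁ y))⁻¹ * ((y : E3) k - gradSq f₀ ε y * (y : E3) k
        + 2 / (2 - ε * f₀ y) * (ε * pd f₀ y k))) ?_ fun k => ?_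
    · refine ((hasDerivAt_lapse_inv (f₁ y)).fun_mul
        ((hasDerivAt_gradSq y).const_add 1)).congr_deriv ?_
      simp [gradSq_zero]
      ring
    · have h3 := ((hasDerivAt_gradSq (f₀ := f₀) y).mul_const ((y : E3) k)).const_sub ((y : E3) k)
      have h4 := ((hasDerivAt_const (0 : ℝ) (2 : ℝ)).fun_div (hasDerivAt_two_sub (f₀ y))
        (by norm_num)).fun_mul (hasDerivAt_mul_self (pd f₀ y k))
      refine ((hasDerivAt_lapse_inv (f₁ y)).fun_mul (h3.fun_add h4)).congr_deriv ?_
      simp [gradSq_zero]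
      ring
  have h5 := hasDerivAt_pd (jointSmooth_LoutN h₀ h₁ hs₀ hs₁ x) h2 i
  have h6 : ∀ k : Fin 3, Smooth fun y : S2 => f₁ y * (y : E3) k := fun k => hs₁.mul (Smooth.coord k)
  rw [pd_vec4 ((Smooth.const _).mul hs₁) fun k => ((Smooth.const _).mul (h6 k)).add
    (hs₀.pd_comp k)] at h5
  simpa only [pd_add ((Smooth.const _).mul (h6 _)) (hs₀.pd_comp _), pd_const_mul _ hs₁,
    pd_const_mul _ (h6 _), pd_mul hs₁ (Smooth.coord _), pd_coord] using h5

lemma hasDerivAt_LbarN (h₁ : ∀ x, HasDerivAt (fun s => f s x) (f₁ x) 0) (y : S2) :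
    HasDerivAt (fun ε : ℝ => LbarN (ε • f) 0 y)
      (vec4 (fun y => 1 / 2 * f₁ y) (fun k y => -(1 / 2) * (f₁ y * (y : E3) k)) y) 0 := by
  simp only [LbarN_eq h₁]
  have h2 : HasDerivAt (fun ε : ℝ => 1 + ε * f₁ y) (f₁ y) 0 :=
    (hasDerivAt_mul_self (f₁ y)).const_add 1
  refine hasDerivAt_vec4 (a := fun ε y => (√(1 + ε * f₁ y))⁻¹ * (1 + ε * f₁ y))
      (b := fun k ε y => (√(1 + ε * f₁ y))⁻¹ * (-(1 + ε * f₁ y) * (y : E3) k)) ?_ fun k => ?_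
  · refine ((hasDerivAt_lapse_inv (f₁ y)).fun_mul h2).congr_deriv ?_
    simp
    ring
  · refine ((hasDerivAt_lapse_inv (f₁ y)).fun_mul
      (h2.fun_neg.mul_const ((y : E3) k))).congr_deriv ?_
    simp
    ring

lemma hasDerivAt_pd_LbarN (h₁ : ∀ x, HasDerivAt (fun s => f s x) (f₁ x) 0) (hs₁ : Smooth f₁)
    (x : S2) (i : Fin 3) :
    HasDerivAt (fun ε : ℝ => pd (LbarN (ε • f) 0) x i)
      (Fin.cons (1 / 2 * pd f₁ x i) fun k => -(1 / 2) * (pd f₁ x i * (x : E3) k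
        + f₁ x * proj x i k)) 0 := by
  have h5 := hasDerivAt_pd (jointSmooth_LbarN h₁ hs₁ x) (hasDerivAt_LbarN h₁) i
  have h6 : ∀ k : Fin 3, Smooth fun y : S2 => f₁ y * (y : E3) k := fun k => hs₁.mul (Smooth.coord k)
  rw [pd_vec4 ((Smooth.const _).mul hs₁) fun k => (Smooth.const _).mul (h6 k)] at h5
  simpa only [pd_const_mul _ hs₁, pd_const_mul _ (h6 _), pd_mul hs₁ (Smooth.coord _),
    pd_coord] using h5

lemma pd_LbarN_zero (h₁ : ∀ x, HasDerivAt (fun s => f s x) (f₁ x) 0) (x : S2) (i : Fin 3) :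
    pd (LbarN ((0 : ℝ) • f) 0) x i = Fin.cons 0 fun k => -proj x i k := by
  rw [LbarN_zero h₁, pd_vec4 (Smooth.const 1) fun k => (Smooth.coord k).neg]
  simp only [pd_const, pd_neg, pd_coord]

/-- The tangential part of the second ambient derivatives is the Hessian. -/
lemma sum_proj_mul_pd_pd (F : Tens 0) (x : S2) (i j : Fin 3) :
    ∑ k, proj x j k * pd (fun y => pd (sval F) y k) x i = comp2 (cov 1 (cov 0 F)) i j x := by
  rw [← sum_proj_mul_pd_comp1]
  simp only [funext (comp1_cov F _)]

lemma hasDerivAt_chi {F₀ : Tens 0} (h₀ : ∀ x, f 0 x = sval F₀ x)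
    (h₁ : ∀ x, deriv (fun s => f s x) 0 = f₁ x) (hs₁ : Smooth f₁) (x : S2) (i j : Fin 3) :
    HasDerivAt (fun ε : ℝ => chi (ε • f) 0 x i j)
      (2 * comp2 (cov 1 (cov 0 F₀)) i j x - (f₁ x + sval F₀ x) * proj x i j) 0 := by
  have hs₀ := smooth_sval F₀
  refine (hasDerivAt_mdot (hasDerivAt_pd_LoutN h₀ h₁ hs₀ hs₁ x i)
    (hasDerivAt_frame h₀ hs₀ x j)).congr_deriv ?_
  rw [frame_zero h₀ hs₀, pd_LoutN_zero h₀ h₁ hs₀, mdot_cons, mdot_cons, ← sum_proj_mul_pd_pd]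
  have h2 := sum_mul_proj_right x i
  have h3 := sum_mul_proj_right x j
  have h4 := sum_proj_mul_proj x i j
  have e1 : ∀ k, (-(1 / 2) * (pd f₁ x i * (x : E3) k + f₁ x * proj x i k)
      + pd (fun y => pd (sval F₀) y k) x i) * (2 * proj x j k)
      = -(pd f₁ x i) * ((x : E3) k * proj x j k) - f₁ x * (proj x i k * proj x j k)
        + 2 * (proj x j k * pd (fun y => pd (sval F₀) y k) x i) := fun k => by ring
  have e2 : ∀ k, proj x i k * -(pd (sval F₀) x j * (x : E3) k + sval F₀ x * proj x j k)
      = -(pd (sval F₀) x j) * ((x : E3) k * proj x i k)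
        - sval F₀ x * (proj x i k * proj x j k) := fun k => by ring
  simp only [e1, e2, Finset.sum_add_distrib, Finset.sum_sub_distrib, ← Finset.mul_sum, h2, h3, h4]
  ring

lemma chi_zero (h₀ : ∀ x, f 0 x = f₀ x) (h₁ : ∀ x, deriv (fun s => f s x) 0 = f₁ x)
    (hs₀ : Smooth f₀) (x : S2) (i j : Fin 3) : chi ((0 : ℝ) • f) 0 x i j = 2 * proj x i j := by
  rw [chi, Matrix.of_apply, frame_zero h₀ hs₀, pd_LoutN_zero h₀ h₁ hs₀, mdot_cons,
    ← sum_proj_mul_proj x i j, Finset.mul_sum]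
  simp only [mul_left_comm _ (2 : ℝ)]
  ring

lemma hasDerivAt_chib (h₀ : ∀ x, f 0 x = f₀ x) (hs₀ : Smooth f₀)
    (h₁ : ∀ x, HasDerivAt (fun s => f s x) (f₁ x) 0) (hs₁ : Smooth f₁) (x : S2) (i j : Fin 3) :
    HasDerivAt (fun ε : ℝ => chib (ε • f) 0 x i j) ((f₀ x - f₁ x) * proj x i j) 0 := by
  refine (hasDerivAt_mdot (hasDerivAt_pd_LbarN h₁ hs₁ x i)
    (hasDerivAt_frame h₀ hs₀ x j)).congr_deriv ?_
  rw [frame_zero h₀ hs₀, pd_LbarN_zero h₁, mdot_cons, mdot_cons]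
  have h2 := sum_mul_proj_right x i
  have h3 := sum_mul_proj_right x j
  have h4 := sum_proj_mul_proj x i j
  have e1 : ∀ k, -(1 / 2) * (pd f₁ x i * (x : E3) k + f₁ x * proj x i k) * (2 * proj x j k)
      = -(pd f₁ x i) * ((x : E3) k * proj x j k) - f₁ x * (proj x i k * proj x j k) :=
    fun k => by ring
  have e2 : ∀ k, -proj x i k * -(pd f₀ x j * (x : E3) k + f₀ x * proj x j k)
      = pd f₀ x j * ((x : E3) k * proj x i k)
        + f₀ x * (proj x i k * proj x j k) := fun k => by ring
  simp only [e1, e2, Finset.sum_add_distrib, Finset.sum_sub_distrib, ← Finset.mul_sum, h2, h3, h4]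
  ring

lemma chib_zero (h₀ : ∀ x, f 0 x = f₀ x) (hs₀ : Smooth f₀)
    (h₁ : ∀ x, HasDerivAt (fun s => f s x) (f₁ x) 0) (x : S2) (i j : Fin 3) :
    chib ((0 : ℝ) • f) 0 x i j = -2 * proj x i j := by
  rw [chib, Matrix.of_apply, frame_zero h₀ hs₀, pd_LbarN_zero h₁, mdot_cons,
    ← sum_proj_mul_proj x i j, Finset.mul_sum, mul_zero, neg_zero, zero_add]
  exact Finset.sum_congr rfl fun k _ => by ring

lemma hasDerivAt_etaForm (h₀ : ∀ x, f 0 x = f₀ x) (hs₀ : Smooth f₀)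
    (h₁ : ∀ x, HasDerivAt (fun s => f s x) (f₁ x) 0) (hs₁ : Smooth f₁) (x : S2) (i : Fin 3) :
    HasDerivAt (fun ε : ℝ => etaForm (ε • f) 0 x i) (pd f₁ x i + 1 / 2 * pd f₀ x i) 0 := by
  have h₁' : ∀ x, deriv (fun s => f s x) 0 = f₁ x := fun x => (h₁ x).deriv
  have hlog : HasDerivAt (fun ε : ℝ => pd (fun y => Real.log (lapse (ε • f) 0 y)) x i)
      (1 / 2 * pd f₁ x i) 0 := by
    have hl : ∀ ε : ℝ, (fun y => Real.log (lapse (ε • f) 0 y))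
        = fun y => Real.log (√(1 + ε * f₁ y)) := fun ε => funext fun y => by
      rw [lapse_eq ε y h₁']
    simp only [hl]
    have h2 := hasDerivAt_pd (S := fun ε y => Real.log (√(1 + ε * f₁ y)))
      (S' := fun y => 1 / 2 * f₁ y) (x := x)
      (ContDiffAt.log (jointSmooth_lapse x hs₁) (by simp)) (fun y => by
        refine ((hasDerivAt_lapse (f₁ y)).log (by simp)).congr_deriv ?_
        simp
        ring) i
    rwa [pd_const_mul _ hs₁] at h2
  refine (((hasDerivAt_mdot (hasDerivAt_pd_LoutN h₀ h₁' hs₀ hs₁ x i)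
    (hasDerivAt_LbarN h₁ x)).const_mul (1 / 2 : ℝ)).fun_add hlog).congr_deriv ?_
  rw [LbarN_zero h₁, pd_LoutN_zero h₀ h₁' hs₀, vec4, vec4, mdot_cons, mdot_cons]
  have h2 := sum_mul_proj_right x i
  have h3 : ∑ k, (x : E3) k * pd (fun y => pd f₀ y k) x i = -pd f₀ x i :=
    Smooth.sum_mul_pd_eq (fun k => hs₀.pd_comp k) (fun y => sum_mul_pd' hs₀ y) x i
  have h4 := sum_mul_self x
  have e1 : ∀ k, (-(1 / 2) * (pd f₁ x i * (x : E3) k + f₁ x * proj x i k)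
      + pd (fun y => pd f₀ y k) x i) * -(x : E3) k
      = 1 / 2 * pd f₁ x i * ((x : E3) k * (x : E3) k) + 1 / 2 * f₁ x * ((x : E3) k * proj x i k)
        - (x : E3) k * pd (fun y => pd f₀ y k) x i := fun k => by ring
  have e2 : ∀ k, proj x i k * (-(1 / 2) * (f₁ x * (x : E3) k))
      = -(1 / 2) * f₁ x * ((x : E3) k * proj x i k) := fun k => by ring
  simp only [e1, e2, Finset.sum_add_distrib, Finset.sum_sub_distrib, ← Finset.mul_sum, h2, h3, h4]
  ring

end Transversal

/-! ### Transversal perturbations -/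

/-- Derivatives in `ε` and iterated derivatives in `s` commute at `ε = 0`. -/
lemma hasDerivAt_iteratedDeriv (n : ℕ) : ∀ {H : ℝ × ℝ → ℝ} {h : ℝ → ℝ}
    (_ : ∀ s, ContDiffAt ℝ ∞ H (0, s)) (_ : ∀ s, HasDerivAt (fun ε => H (ε, s)) (h s) 0) (s : ℝ),
    HasDerivAt (fun ε => iteratedDeriv n (fun s => H (ε, s)) s) (iteratedDeriv n h s) 0 := by
  induction n with
  | zero => exact fun _ hh s => by simpa only [iteratedDeriv_zero] using hh s
  | succ n ih =>
    intro H h hH hh s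
    simp only [iteratedDeriv_succ']
    refine ih (H := fun p => deriv (fun s => H (p.1, s)) p.2) (fun s => ?_) (fun s => ?_) s
    · have h1 := ContDiffAt.fderiv (m := ∞) (f := fun (p : ℝ × ℝ) (z : ℝ) => H (p.1, z))
        (g := Prod.snd) (x₀ := ((0 : ℝ), s))
        (ContDiffAt.comp (((0 : ℝ), s), s) (f := fun q : (ℝ × ℝ) × ℝ => (q.1.1, q.2)) (hH s)
          (by fun_prop)) contDiffAt_snd (by simp)
      exact h1.clm_apply contDiffAt_const
    · exact hasDerivAt_fderiv_swap (hH s) (Eventually.of_forall hh) 1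

lemma SmoothFamily.contDiff {f : ℝ → S2 → ℝ} (hf : SmoothFamily f) (x : S2) :
    ContDiff ℝ ∞ fun s => f s x := by
  refine contDiff_iff_contDiffAt.2 fun s => ?_
  have h1 : ContDiffAt ℝ ∞ (fun p : ℝ × E3 => f p.1 (dir p.2)) (s, (x : E3)) :=
    (hf (s, (x : E3)) ⟨trivial, S2.ne_zero x⟩).contDiffAt
      ((isOpen_univ.prod isOpen_compl_singleton).mem_nhds ⟨trivial, S2.ne_zero x⟩)
  have h2 := ContDiffAt.comp s (f := fun s : ℝ => (s, (x : E3))) h1 (by fun_prop)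
  simpa only [Function.comp_def, dir_self] using h2

lemma hasDerivAt_logLapse {f : ℝ → S2 → ℝ} (hf : SmoothFamily f) (x : S2) (n : ℕ) :
    HasDerivAt (fun ε : ℝ => logLapse (ε • f) 0 x n)
      (1 / 2 * iteratedDeriv (n + 1) (fun s => f s x) 0) 0 := by
  set g : ℝ → ℝ := deriv fun s => f s x with hg
  have hgs : ContDiff ℝ ∞ g := ((contDiff_infty_iff_deriv (𝕜 := ℝ)).1 (hf.contDiff x)).2
  have h1 : ∀ ε : ℝ, (fun s => Real.log (lapse (ε • f) s x))
      = fun s => Real.log √(1 + ε * g s) := fun ε => funext fun s => by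
    rw [lapse, deriv_const_smul_family]
  have h2 := hasDerivAt_iteratedDeriv n (H := fun p => Real.log √(1 + p.1 * g p.2))
    (h := fun s => 1 / 2 * g s) (fun s => by
      have h3 : ContDiffAt ℝ ∞ (fun p : ℝ × ℝ => 1 + p.1 * g p.2) (0, s) :=
        contDiffAt_const.add (contDiffAt_fst.mul
          (hgs.contDiffAt.comp ((0 : ℝ), s) (f := Prod.snd) contDiffAt_snd))
      exact ContDiffAt.log (ContDiffAt.sqrt h3 (by simp)) (by simp)) (fun s => by
      refine ((hasDerivAt_lapse (g s)).log (by simp)).congr_deriv ?_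
      simp
      ring) 0
  simp only [logLapse, h1]
  refine h2.congr_deriv ?_
  rw [iteratedDeriv_const_mul_field, iteratedDeriv_succ']

lemma LinearisesTo.of_hasDerivAt {G : ℝ → S2 → ℝ} {T : GenField 0} (S : Tens 0)
    (hT : toDist S = T) (h : ∀ x, HasDerivAt (fun ε => G ε x) (sval S x) 0) :
    LinearisesTo (fun ε x _ => G ε x) T :=
  ⟨S, hT, fun x a => by rw [sval_eq]; exact h x⟩

lemma LinearisesToS.of_hasDerivAt {G : ℝ → S2 → Matrix (Fin 3) (Fin 3) ℝ} {T : DistSTF} (S : STF)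
    (hT : toDistS S = T) (h : ∀ x i j, HasDerivAt (fun ε => G ε x i j) (comp2 S i j x) 0) :
    LinearisesToS (fun ε => ofMat (G ε)) T :=
  ⟨S, hT, fun x a => by rw [comp2_eq]; exact h x (a 0) (a 1)⟩

lemma LinearisesToS.zero {G : ℝ → S2 → Matrix (Fin 3) (Fin 3) ℝ}
    (h : ∀ ε x i j, G ε x i j = 0) : LinearisesToS (fun ε => ofMat (G ε)) 0 :=
  .of_hasDerivAt 0 (map_zero toDistS) fun x i j => by
    simp only [h]
    exact hasDerivAt_const _ _

lemma comp2_hessian_comm (F : Tens 0) (i j : Fin 3) (x : S2) :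
    comp2 (cov 1 (cov 0 F)) i j x = comp2 (cov 1 (cov 0 F)) j i x := by
  have h := pd_comm (smooth_sval F) x i j
  simp only [comp2_cov, funext (comp1_cov F _)]
  linarith

lemma sum_hessian (F : Tens 0) (x : S2) :
    ∑ i, comp2 (cov 1 (cov 0 F)) i i x = sval (div 0 (cov 0 F)) x := by
  have h1 := sum_mul_comp1 (cov 0 F) x
  rw [sval_div]
  simp only [comp2_cov, Finset.sum_add_distrib, h1, add_zero]

/-- The exact form of the induced metric reduces traces and tracefree parts to the Cartesian trace.
The data then are differentiated one by one. -/
theorem isTransversalLin {f : ℝ → S2 → ℝ} (hf : SmoothFamily f) {F : Fin 5 → Tens 0}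
    (hF : ∀ n x a, (F n : Field 0) x a = iteratedDeriv n (fun s => f s x) 0) :
    IsTransversalLin f (linPert 2 (fun n => toDist (F n)) 0 0) := by
  have hFv : ∀ (n : Fin 5) x, iteratedDeriv n (fun s => f s x) 0 = sval (F n) x := fun n x =>
    (hF n x ![]).symm
  have h₀ : ∀ x, f 0 x = sval (F 0) x := fun x => by
    rw [← hFv]
    simp
  have h₁ : ∀ x, HasDerivAt (fun s => f s x) (sval (F 1) x) 0 := fun x => by
    have h2 : deriv (fun s => f s x) 0 = sval (F 1) x := by
      rw [← hFv]
      simp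
    rw [← h2]
    exact ((hf.contDiff x).differentiable (by simp)).differentiableAt.hasDerivAt
  have h₁' : ∀ x, deriv (fun s => f s x) 0 = sval (F 1) x := fun x => (h₁ x).deriv
  have hs₀ := smooth_sval (F 0)
  have hs₁ := smooth_sval (F 1)
  have hmet := fun (ε : ℝ) x => met_eq ε x h₀ hs₀
  have hr : ∀ x, ∀ᶠ ε in 𝓝 (0 : ℝ), 0 < 2 - ε * sval (F 0) x := fun x => by
    have : ContinuousAt (fun ε : ℝ => 2 - ε * sval (F 0) x) 0 := by fun_prop
    exact this.eventually (lt_mem_nhds (by norm_num))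
  have hchi := fun x => hasDerivAt_trG x (r := sval (F 0) x)
    (A' := Matrix.of fun i j => 2 * comp2 (cov 1 (cov 0 (F 0))) i j x
      - (sval (F 1) x + sval (F 0) x) * proj x i j)
    (fun i j => hasDerivAt_chi h₀ h₁' hs₁ x i j) (fun ε i => sum_mul_frame ε x h₀ hs₀ _)
    (sval (F 1) x)
  have hchib := fun x => hasDerivAt_trG x (r := sval (F 0) x)
    (A' := Matrix.of fun i j => (sval (F 0) x - sval (F 1) x) * proj x i j)
    (fun i j => hasDerivAt_chib h₀ hs₀ h₁ hs₁ x i j) (fun ε i => sum_mul_frame ε x h₀ hs₀ _)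
    (sval (F 1) x)
  simp only [Matrix.of_apply, chi_zero h₀ h₁' hs₀, Finset.sum_sub_distrib, ← Finset.mul_sum,
    sum_hessian, sum_proj_self] at hchi
  simp only [Matrix.of_apply, chib_zero h₀ hs₀ h₁, ← Finset.mul_sum, sum_proj_self] at hchib
  have hA : ∀ (ε : ℝ) x i j, alphab (ε • f) 0 x i j = 0 := fun ε x i j => curv_eq_zero _ _ _ _ _
  refine ⟨?_, ?_, ?_, ?_, ?_, ?_, ?_, ?_, ?_, ?_, ?_, ?_, ?_, ?_⟩
  · refine .of_hasDerivAt ((1 / 2 : ℝ) • F 1) (map_smul _ _ _) fun x => ?_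
    simp only [lapse_eq _ x h₁']
    exact (hasDerivAt_lapse _).congr_deriv (by rw [sval_smul]; ring)
  · refine .of_hasDerivAt ((-1 : ℝ) • F 0) ?_ fun x => ?_
    · rw [map_smul]
      ext Φ
      simp [linPert, lap, ddiv, dcov]
    · refine ((hasDerivAt_two_sub (sval (F 0) x)).congr_deriv ?_).congr_of_eventuallyEq ?_
      · rw [sval_smul, neg_one_mul]
      · filter_upwards [hr x] with ε hε
        rw [hmet, conf_round, abs_of_pos hε]
  · refine .of_hasDerivAt 0 ?_ fun x i j => ?_
    · rw [map_zero]
      ext Φ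
      simp [linPert, dD2s, dD1s]
    · refine (hasDerivAt_const (0 : ℝ) (proj x i j)).congr_of_eventuallyEq ?_
      filter_upwards [hr x] with ε hε
      rw [hmet, conf_round, sq_abs, smul_smul, inv_mul_cancel₀ (by positivity), one_smul,
        roundM_apply]
  · refine .of_hasDerivAt ((1 / 2 : ℝ) • (div 0 (cov 0 (F 0)) + F 0)) ?_ fun x => ?_
    · rw [map_smul, map_add, ← ddiv_toDist, ← dcov_toDist]
      simp only [linPert, lap]
      norm_num
    · simp only [lapse_eq _ x h₁', hmet]
      refine (hchi x).1.congr_deriv ?_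
      rw [sval_smul, sval_add]
      ring
  · refine .of_hasDerivAt ((-2 : ℝ) • D2star (cov 0 (F 0))) ?_ fun x i j => ?_
    · rw [map_smul, ← dD2s_toDist, ← dcov_toDist]
      rfl
    · simp only [hmet]
      refine ((hchi x).2 i j).congr_deriv ?_
      have h2 : comp2 ((-2 : ℝ) • D2star (cov 0 (F 0)) : STF) i j x
          = 2 * comp2 (stf (cov 1 (cov 0 (F 0)))) i j x := by
        change -2 * (-1 * comp2 (stf (cov 1 (cov 0 (F 0)))) i j x) = _
        ring
      rw [h2, comp2_stf, sum_hessian, comp2_hessian_comm (F 0) j i]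
      ring
  · refine .of_hasDerivAt ((-2 : ℝ) • ((1 / 2 : ℝ) • F 1 + (1 / 4 : ℝ) • F 0)) ?_ fun x => ?_
    · rw [map_smul, map_add, map_smul, map_smul]
      simp only [linPert]
      norm_num
    · simp only [lapse_eq _ x h₁', hmet]
      refine (hchib x).1.congr_deriv ?_
      rw [sval_smul, sval_add, sval_smul, sval_smul]
      ring
  · refine .of_hasDerivAt 0 (map_zero toDistS) fun x i j => ?_
    simp only [hmet]
    refine ((hchib x).2 i j).congr_deriv ?_
    change _ = (0 : ℝ)
    ring
  · refine ⟨(2 : ℝ) • cov 0 ((1 / 2 : ℝ) • F 1 + (1 / 4 : ℝ) • F 0), ?_, fun x a => ?_⟩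
    · rw [map_smul, ← dcov_toDist, map_add, map_smul, map_smul]
      simp only [linPert]
      norm_num
    · refine (hasDerivAt_etaForm h₀ hs₀ h₁ hs₁ x (a 0)).congr_deriv ?_
      rw [comp1_eq, comp1_smul, map_add, comp1_add, map_smul, map_smul, comp1_smul, comp1_smul,
        comp1_cov, comp1_cov]
      ring
  · refine .of_hasDerivAt ((1 / 2 : ℝ) • F 2) (map_smul _ _ _) fun x => ?_
    refine (hasDerivAt_logLapse hf x 1).congr_deriv ?_
    rw [sval_smul, ← hFv]
    rfl
  · refine .of_hasDerivAt ((1 / 2 : ℝ) • F 3) (map_smul _ _ _) fun x => ?_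
    refine (hasDerivAt_logLapse hf x 2).congr_deriv ?_
    rw [sval_smul, ← hFv]
    rfl
  · refine .of_hasDerivAt ((1 / 2 : ℝ) • F 4) (map_smul _ _ _) fun x => ?_
    refine (hasDerivAt_logLapse hf x 3).congr_deriv ?_
    rw [sval_smul, ← hFv]
    rfl
  · exact .zero fun ε x i j => curv_eq_zero _ _ _ _ _
  · exact .zero hA
  · refine .zero fun ε x i j => ?_
    have h2 : (Matrix.of fun i j => deriv (fun s => alphab (ε • f) s x i j) 0) = 0 := by
      ext i j
      have h3 : (fun s => alphab (ε • f) s x i j) = fun _ => 0 :=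
        funext fun s => curv_eq_zero _ _ _ _ _
      rw [Matrix.of_apply, h3]
      simp
    rw [Dalphab, h2]
    simp [tfG, trG]

end

end NullGluing

theorem mainTheorem3 :
    -- the `l = 2` charge of `D_ α_` vanishes on all linearised perturbations
    (∀ (f : Fin 5 → GenField 0) (q₁ q₂ : GenField 0), chargeDbalbTwo 2 (linPert 2 f q₁ q₂) = 0) ∧
    -- its values form the 10-dimensional space of electric and magnetic modes with `l = 2`
    (Set.range (chargeDbalbTwo 2) =
        (Submodule.span ℝ {W : DistSTF | ∃ m ∈ ms 2, W = toDistS (tenE 2 m) ∨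
          W = toDistS (tenH 2 m)} : Set DistSTF) ∧
      Module.finrank ℝ (Submodule.span ℝ {W : DistSTF | ∃ m ∈ ms 2, W = toDistS (tenE 2 m) ∨
          W = toDistS (tenH 2 m)}) = 10) ∧
    -- its electric and magnetic coefficients are the linearisations of `U` and `V`
    (∀ (h : Tens 2) (a b : STF) (X : LinSphereData),
      (∀ x i j, (h : Field 2) x ![i, j] = (h : Field 2) x ![j, i]) →
      X.alb = toDistS a → X.Dbalb = toDistS b →
      ∃ dU dV : ℤ → ℝ,
        (∀ m ∈ ms 2,
          HasDerivAt (fun ε : ℝ => chargeU m (roundMet 2 + ε • (h : Field 2))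
            (ε • ((a : Tens 2) : Field 2)) (ε • ((b : Tens 2) : Field 2))) (dU m) 0 ∧
          HasDerivAt (fun ε : ℝ => chargeV m (roundMet 2 + ε • (h : Field 2))
            (ε • ((a : Tens 2) : Field 2)) (ε • ((b : Tens 2) : Field 2))) (dV m) 0) ∧
        chargeDbalbTwo 2 X =
          ∑ m ∈ ms 2, (dU m • toDistS (tenE 2 m) + dV m • toDistS (tenH 2 m))) ∧
    -- the other two charges are attained, by the choice of `∂_u³ f` (modes `l ≥ 3`) and `∂_u⁴ f`
    (∃ C : ℝ≥0∞, C ≠ ⊤ ∧ ∀ (Q₁ : GenField 0) (Q₂ : DistSTF),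
      lowPart 1 Q₁ = Q₁ → IsElectricHigh 3 Q₂ Q₂ → l2sq (ofSTF Q₂) < ⊤ →
      ∀ f₀ f₁ f₂ p q₁ q₂ : GenField 0, lowPart 2 p = p →
        ∃ f₃ f₄ g : GenField 0, f₃ = p + g ∧ IsHigh 3 f₃ g ∧ l2sq g < ⊤ ∧ l2sq f₄ < ⊤ ∧
          chargeDbDbomb 2 (linPert 2 ![f₀, f₁, f₂, f₃, f₄] q₁ q₂) = Q₁ ∧
          IsElectricHigh 3 (chargeDbalbField 2 (linPert 2 ![f₀, f₁, f₂, f₃, f₄] q₁ q₂)) Q₂ ∧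
          sobolevNorm 4 g + sobolevNorm 2 f₄ ≤
            C * (sobolevNorm 2 (ofSTF Q₂) + sobolevNorm 2 Q₁)) ∧
    -- `linPert` is the linearisation of the transversal and of the angular sphere perturbations
    (∀ f : ℝ → S2 → ℝ, SmoothFamily f → ∀ F : Fin 5 → Tens 0,
      (∀ n x a, (F n : Field 0) x a = iteratedDeriv n (fun s => f s x) 0) →
      IsTransversalLin f (linPert 2 (fun n => toDist (F n)) 0 0)) ∧
    (∀ q₁ q₂ : Tens 0, IsAngularLin q₁ q₂ (linPert 2 0 (toDist q₁) (toDist q₂))) := by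
  exact ⟨chargeDbalbTwo_linPert, ⟨range_chargeDbalbTwo, finrank_span_tensor_modes⟩,
    fun h a b X _ ha hb => chargeDbalbTwo_eq h a b X ha hb, exists_matching,
    fun _ hf _ hF => isTransversalLin hf hF, isAngularLin⟩
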